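/- Let $\mathcal H$ be an infinite-dimensional real Hilbert space with a complex structure $J\in\mathcal B(\mathcal H)$, $J^2=-1$, $J^*=-J$, and let $\mathcal B_2$ denote the Hilbert–Schmidt operators, with the norm $\|a\|_2={\rm Tr}(a^*a)^{1/2}$. Let ${\rm Sp}(\mathcal H)=\{g\in GL(\mathcal H): g^*Jg=J\}$ with its Banach manifold structure modelled on $\mathfrak{sp}(\mathcal H)=\{x\in\mathcal B(\mathcal H): xJ=-Jx^*\}$ (operator norm), and let ${\rm Sp}_2(\mathcal H)=\{g\in{\rm Sp}(\mathcal H): g-1\in\mathcal B_2(\mathcal H)\}$ with the topology of the metric $\|g_1-g_2\|_2$ and its manifold structure modelled on $\mathfrak{sp}_2(\mathcal H)=\mathfrak{sp}(\mathcal H)\cap\mathcal B_2(\mathcal H)$ ($2$-norm). Let $U(\mathcal H_J)$ be the group of unitary operators on $\mathcal H$ commuting with $J$, and $U_2(\mathcal H_J)=\{u\in U(\mathcal H_J): u-1\in\mathcal B_2(\mathcal H)\}$. Let $\Lambda(\mathcal H)$ be the set of closed subspaces $L\subset\mathcal H$ with $J(L)=L^\perp$, with the smooth structure given by the charts $\phi_L:\{W\in\Lambda(\mathcal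 H):\mathcal H=W\oplus L^\perp\}\to\mathcal B(L)_s$, $L\in\Lambda(\mathcal H)$, with values in the bounded symmetric operators on $L$: $\phi_L(W)=J|_{L^\perp}T$, where $T:L\to L^\perp$ is the operator whose graph is $W$. Fix $L_0\in\Lambda(\mathcal H)$, and let $\mathcal O_{L_0}=\{g(L_0): g\in{\rm Sp}_2(\mathcal H)\}$, with the smooth structure (and the topology) given by the restrictions of the charts $\phi_L$, $L\in\mathcal O_{L_0}$, to $\mathcal O_{L_0}$, with values in the space $\mathcal B_2(L)_s$ of symmetric Hilbert–Schmidt operators on $L$. For a Lagrangian subspace $L$ let $\pi_L(g)=g(L)$, let $P_L$ be the orthogonal projection onto $L$, and put $\epsilon_L=2P_L-1$ and $g_L=\frac12(1+\epsilon_L\epsilon_{L_0})$. A smooth map is called a submersion if its tangent map at every point is onto and has a complemented kernel. Then: 1. The maps $\pi_{L_0}:{\rm Sp}(\mathcal H)\to\Lambda(\mathcal H)$ and $\pi_{L_0}|_{{\rm Sp}_2(\mathcal H)}:{\rm Sp}_2(\mathcal H)\to\mathcal O_{L_0}$ are smooth submersions. 2. There are an open neighbourhood $V$ of $L_0$ in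 $\Lambda(\mathcal H)$ and a smooth map $\sigma:V\to{\rm Sp}(\mathcal H)$ such that for every $L\in V$ the operator $g_L$ is invertible, $\sigma(L)=u_L$ is the unitary part of $g_L$ (that is, $g_L=u_L|g_L|$ with $|g_L|=(g_L^*g_L)^{1/2}$), $u_L\in U(\mathcal H_J)$, and $\pi_{L_0}(u_L)=L$. Likewise there are an open neighbourhood $V_2$ of $L_0$ in $\mathcal O_{L_0}$ and a smooth map $\sigma_2:V_2\to{\rm Sp}_2(\mathcal H)$ such that for every $L\in V_2$ the operator $g_L$ is invertible, $\sigma_2(L)=u_L$ is its unitary part, $u_L\in U_2(\mathcal H_J)$, and $\pi_{L_0}(u_L)=L$. 3. Every $L\in\Lambda(\mathcal H)$ is of the form $L=g(L_0)$ with $g\in{\rm Sp}(\mathcal H)$, and for every such $g$ the map $W\mapsto g\,\sigma(g^{-1}(W))\,g^{-1}$ is a smooth section of $\pi_L:{\rm Sp}(\mathcal H)\to\Lambda(\mathcal H)$ on the open neighbourhood $g(V)$ of $L$. Likewise every $L\in\mathcal O_{L_0}$ is of the form $L=g(L_0)$ with $g\in{\rm Sp}_2(\mathcal H)$, and for every such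 $g$ the map $W\mapsto g\,\sigma_2(g^{-1}(W))\,g^{-1}$ is a smooth section of $\pi_L|_{{\rm Sp}_2(\mathcal H)}:{\rm Sp}_2(\mathcal H)\to\mathcal O_{L_0}$ on the open neighbourhood $g(V_2)$ of $L$. -/

import Mathlib

open scoped Manifold ContDiff InnerProductSpace

set_option linter.unusedSectionVars false

noncomputable section

namespace SympLagr

section HilbertSchmidt

variable {E F G : Type*}
  [NormedAddCommGroup E] [InnerProductSpace ℝ E] [CompleteSpace E]
  [NormedAddCommGroup F] [InnerProductSpace ℝ F] [CompleteSpace F]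
  [NormedAddCommGroup G] [InnerProductSpace ℝ G] [CompleteSpace G]

variable (E) in
/-- Index set of a chosen orthonormal basis of the Hilbert space `E`. -/
def basisIndex : Set E := (exists_hilbertBasis ℝ E).choose

variable (E) in
/-- A chosen orthonormal (Hilbert) basis of `E`. -/
def basis : HilbertBasis (basisIndex E) ℝ E := (exists_hilbertBasis ℝ E).choose_spec.choose

/-- `Tr (a* a) = ∑ ‖a eᵢ‖²`, as an extended nonnegative number. -/
def hsSq (a : E →L[ℝ] F) : ENNReal := ∑' i, ‖a (basis E i)‖ₑ ^ 2

theorem tsum_enorm_inner_sq {ι : Type*} (b : HilbertBasis ι ℝ E) (x : E) :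
    ∑' i, ‖⟪b i, x⟫_ℝ‖ₑ ^ 2 = ‖x‖ₑ ^ 2 := by
  have h := b.hasSum_inner_mul_inner x x
  have h2 : HasSum (fun i => ‖⟪b i, x⟫_ℝ‖ ^ 2) (‖x‖ ^ 2) := by
    rw [real_inner_self_eq_norm_sq] at h
    refine h.congr_fun ?_ |> id
    intro i
    rw [real_inner_comm, Real.norm_eq_abs, sq_abs, sq, real_inner_comm]
  have h3 : ∀ y : ℝ, ‖y‖ₑ ^ 2 = ENNReal.ofReal (‖y‖ ^ 2) := fun y => by
    rw [← ofReal_norm, ENNReal.ofReal_pow (norm_nonneg _)]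
  simp_rw [h3]
  rw [← ENNReal.ofReal_tsum_of_nonneg (fun _ => by positivity) h2.summable, h2.tsum_eq,
    ENNReal.ofReal_pow (norm_nonneg _), ofReal_norm]

theorem tsum_adjoint {ι κ : Type*} (b : HilbertBasis ι ℝ E) (c : HilbertBasis κ ℝ F)
    (a : E →L[ℝ] F) :
    ∑' i, ‖a (b i)‖ₑ ^ 2 = ∑' j, ‖a.adjoint (c j)‖ₑ ^ 2 := by
  simp_rw [← tsum_enorm_inner_sq c (a _), ← tsum_enorm_inner_sq b (a.adjoint _)]
  rw [ENNReal.tsum_comm]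
  refine tsum_congr fun j => tsum_congr fun i => ?_
  rw [ContinuousLinearMap.adjoint_inner_right, real_inner_comm]

/-- The value of `Tr (a* a)` may be computed in any orthonormal basis. -/
theorem hsSq_eq {ι : Type*} (b : HilbertBasis ι ℝ E) (a : E →L[ℝ] F) :
    hsSq a = ∑' i, ‖a (b i)‖ₑ ^ 2 := by
  rw [hsSq, tsum_adjoint (basis E) (basis F), tsum_adjoint b (basis F)]

theorem hsSq_adjoint (a : E →L[ℝ] F) : hsSq a.adjoint = hsSq a :=
  (tsum_adjoint (basis E) (basis F) a).symm

theorem hsSq_comp_le (x : F →L[ℝ] G) (a : E →L[ℝ] F) : hsSq (x ∘L a) ≤ ‖x‖ₑ ^ 2 * hsSq a := by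
  rw [hsSq, hsSq, ← ENNReal.tsum_mul_left]
  refine ENNReal.tsum_le_tsum fun i => ?_
  rw [← mul_pow]
  gcongr
  exact x.le_opENorm _

theorem hsSq_comp_le' (a : F →L[ℝ] G) (x : E →L[ℝ] F) : hsSq (a ∘L x) ≤ ‖x‖ₑ ^ 2 * hsSq a := by
  rw [← hsSq_adjoint, ContinuousLinearMap.adjoint_comp, ← hsSq_adjoint a]
  refine (hsSq_comp_le _ _).trans (le_of_eq ?_)
  congr 2
  rw [← ofReal_norm, ← ofReal_norm, LinearIsometryEquiv.norm_map]

theorem enorm_apply_le (a : E →L[ℝ] F) (v : E) : ‖a v‖ₑ ^ 2 ≤ hsSq a * ‖v‖ₑ ^ 2 := by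
  rw [← tsum_enorm_inner_sq (basis F), ← hsSq_adjoint, hsSq, ← ENNReal.tsum_mul_right]
  refine ENNReal.tsum_le_tsum fun i => ?_
  rw [← ContinuousLinearMap.adjoint_inner_left, ← mul_pow]
  gcongr
  rw [← ofReal_norm, ← ofReal_norm, ← ofReal_norm, ← ENNReal.ofReal_mul (norm_nonneg _)]
  exact ENNReal.ofReal_le_ofReal (norm_inner_le_norm _ _)

theorem hsSq_toReal (a : E →L[ℝ] F) : ENNReal.toReal (hsSq a) = ∑' i, ‖a (basis E i)‖ ^ 2 := by
  rw [hsSq, ENNReal.tsum_toReal_eq (fun i => by simp)]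
  simp

theorem memlp_iff (a : E →L[ℝ] F) :
    hsSq a < ⊤ ↔ Memℓp (fun i : basisIndex E => a (basis E i)) 2 := by
  have h3 : ∀ y : F, ‖y‖ₑ ^ 2 = ((‖y‖₊ ^ 2 : NNReal) : ENNReal) := fun y => by
    simp [enorm]
  rw [memℓp_gen_iff (by norm_num), hsSq, lt_top_iff_ne_top]
  simp_rw [h3]
  rw [ENNReal.tsum_coe_ne_top_iff_summable, ← NNReal.summable_coe]
  simp

variable (E F) in
/-- The Hilbert–Schmidt operators `{a : Tr (a* a) < ⊤}` as a linear subspace of the bounded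
operators. -/
def hsSubmodule : Submodule ℝ (E →L[ℝ] F) where
  carrier := {a | hsSq a < ⊤}
  zero_mem' := by simp [hsSq]
  add_mem' := by
    intro a b ha hb
    simp only [Set.mem_ofPred_eq, memlp_iff] at *
    exact ha.add hb
  smul_mem' := by
    intro r a ha
    simp only [Set.mem_ofPred_eq, memlp_iff] at *
    exact ha.const_smul r

theorem mem_hs {a : E →L[ℝ] F} : a ∈ hsSubmodule E F ↔ hsSq a < ⊤ := Iff.rfl

theorem comp_mem_hs (x : F →L[ℝ] G) {a : E →L[ℝ] F} (ha : a ∈ hsSubmodule E F) :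
    x ∘L a ∈ hsSubmodule E G :=
  (hsSq_comp_le x a).trans_lt (ENNReal.mul_lt_top (by simp) ha)

theorem mem_hs_comp {a : F →L[ℝ] G} (ha : a ∈ hsSubmodule F G) (x : E →L[ℝ] F) :
    a ∘L x ∈ hsSubmodule E G :=
  (hsSq_comp_le' a x).trans_lt (ENNReal.mul_lt_top (by simp) ha)

variable (E F) in
/-- The space `B₂(E, F)` of Hilbert–Schmidt operators. It is a type of its own, so that it carries
the `2`-norm and not the operator norm. -/
def HS : Type _ := hsSubmodule E F

namespace HS

instance : AddCommGroup (HS E F) := inferInstanceAs (AddCommGroup (hsSubmodule E F))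
instance : Module ℝ (HS E F) := inferInstanceAs (Module ℝ (hsSubmodule E F))

/-- The bounded operator underlying a Hilbert–Schmidt operator. -/
def toOp : HS E F →ₗ[ℝ] (E →L[ℝ] F) := (hsSubmodule E F).subtype

/-- Bundle an operator with a proof that it is Hilbert–Schmidt. -/
def mk (a : E →L[ℝ] F) (h : a ∈ hsSubmodule E F) : HS E F := ⟨a, h⟩

@[simp] theorem toOp_mk (a : E →L[ℝ] F) (h : a ∈ hsSubmodule E F) : toOp (mk a h) = a := rfl

theorem toOp_mem (a : HS E F) : toOp a ∈ hsSubmodule E F := a.2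

theorem toOp_injective : Function.Injective (toOp : HS E F → (E →L[ℝ] F)) :=
  Subtype.val_injective

@[ext] theorem ext {a b : HS E F} (h : toOp a = toOp b) : a = b := toOp_injective h

/-- The family `(a eᵢ)` in `ℓ²`. -/
def toLp : HS E F →ₗ[ℝ] lp (fun _ : basisIndex E => F) 2 where
  toFun a := ⟨fun i => toOp a (basis E i), (memlp_iff _).1 a.2⟩
  map_add' _ _ := rfl
  map_smul' _ _ := rfl

theorem toLp_injective : Function.Injective (toLp : HS E F → _) := by
  rw [injective_iff_map_eq_zero]
  intro a h
  have h0 : ∀ i, toOp a (basis E i) = 0 := fun i => by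
    exact congrArg (fun f : lp (fun _ : basisIndex E => F) 2 => f i) h
  have h1 : hsSq (toOp a) = 0 := by simp [hsSq, h0]
  ext v
  have := enorm_apply_le (toOp a) v
  simpa [h1] using this

/-- The `2`-norm `‖a‖₂ = Tr (a* a) ^ (1/2)`. -/
instance : NormedAddCommGroup (HS E F) :=
  NormedAddCommGroup.induced _ _ toLp toLp_injective

theorem norm_def (a : HS E F) : ‖a‖ = ‖toLp a‖ := rfl

instance : NormedSpace ℝ (HS E F) where
  norm_smul_le r a := by rw [norm_def, norm_def, map_smul, norm_smul]

theorem norm_sq (a : HS E F) : ‖a‖ ^ 2 = (hsSq (toOp a)).toReal := by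
  rw [norm_def, hsSq_toReal]
  have := lp.norm_rpow_eq_tsum (p := 2) (by norm_num) (toLp a)
  simp only [ENNReal.toReal_ofNat, Real.rpow_ofNat] at this
  exact this

theorem enorm_sq (a : HS E F) : ‖a‖ₑ ^ 2 = hsSq (toOp a) := by
  rw [← ofReal_norm, ← ENNReal.ofReal_pow (norm_nonneg _), norm_sq,
    ENNReal.ofReal_toReal (mem_hs.1 (toOp_mem a)).ne]

theorem norm_le_of_hsSq {E' F' : Type*} [NormedAddCommGroup E'] [InnerProductSpace ℝ E']
    [CompleteSpace E'] [NormedAddCommGroup F'] [InnerProductSpace ℝ F'] [CompleteSpace F']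
    (a : HS E F) (b : HS E' F') (r : ℝ) (hr : 0 ≤ r)
    (h : hsSq (toOp a) ≤ (ENNReal.ofReal r) ^ 2 * hsSq (toOp b)) : ‖a‖ ≤ r * ‖b‖ := by
  rw [← enorm_sq, ← enorm_sq, ← mul_pow, ← ofReal_norm, ← ofReal_norm,
    ← ENNReal.ofReal_mul hr] at h
  have h2 := (ENNReal.pow_le_pow_left_iff two_ne_zero).1 h
  exact (ENNReal.ofReal_le_ofReal_iff (by positivity)).1 h2

theorem norm_toOp_le (a : HS E F) : ‖toOp a‖ ≤ ‖a‖ := by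
  refine ContinuousLinearMap.opNorm_le_bound _ (norm_nonneg _) fun v => ?_
  have h := enorm_apply_le (toOp a) v
  rw [← enorm_sq, ← mul_pow, ENNReal.pow_le_pow_left_iff two_ne_zero, ← ofReal_norm,
    ← ofReal_norm, ← ofReal_norm, ← ENNReal.ofReal_mul (norm_nonneg _)] at h
  exact (ENNReal.ofReal_le_ofReal_iff (by positivity)).1 h

variable (E F) in
/-- The continuous inclusion of the Hilbert–Schmidt operators in the bounded operators. -/
def inclL : HS E F →L[ℝ] (E →L[ℝ] F) :=
  toOp.mkContinuous 1 fun a => by simpa using norm_toOp_le a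

@[simp] theorem inclL_apply (a : HS E F) : inclL E F a = toOp a := rfl

variable (E F G) in
/-- Composition `(x, a) ↦ x a` of a bounded with a Hilbert–Schmidt operator. -/
def compL : (F →L[ℝ] G) →L[ℝ] HS E F →L[ℝ] HS E G :=
  LinearMap.mkContinuous₂
    (LinearMap.mk₂ ℝ (fun (x : F →L[ℝ] G) (a : HS E F) =>
      mk (x ∘L toOp a) (comp_mem_hs x (toOp_mem a)))
      (fun _ _ _ => by ext; simp) (fun _ _ _ => by ext; simp)
      (fun _ _ _ => by ext; simp) (fun _ _ _ => by ext; simp)) 1 (fun x a => by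
        rw [one_mul]
        refine norm_le_of_hsSq _ _ _ (norm_nonneg _) ?_
        rw [ofReal_norm]
        exact hsSq_comp_le _ _)

variable (E F G) in
/-- Composition `(a, x) ↦ a x` of a Hilbert–Schmidt with a bounded operator. -/
def compR : HS F G →L[ℝ] (E →L[ℝ] F) →L[ℝ] HS E G :=
  LinearMap.mkContinuous₂
    (LinearMap.mk₂ ℝ (fun (a : HS F G) (x : E →L[ℝ] F) =>
      mk (toOp a ∘L x) (mem_hs_comp (toOp_mem a) x))
      (fun _ _ _ => by ext; simp) (fun _ _ _ => by ext; simp)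
      (fun _ _ _ => by ext; simp) (fun _ _ _ => by ext; simp)) 1 (fun a x => by
        rw [one_mul, mul_comm]
        refine norm_le_of_hsSq _ _ _ (norm_nonneg _) ?_
        rw [ofReal_norm]
        exact hsSq_comp_le' _ _)

@[simp] theorem toOp_compL (x : F →L[ℝ] G) (a : HS E F) :
    toOp (compL E F G x a) = x ∘L toOp a := rfl

@[simp] theorem toOp_compR (a : HS F G) (x : E →L[ℝ] F) :
    toOp (compR E F G a x) = toOp a ∘L x := rfl

end HS

end HilbertSchmidt

namespace HS

variable {E F : Type*}
  [NormedAddCommGroup E] [InnerProductSpace ℝ E] [CompleteSpace E]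
  [NormedAddCommGroup F] [InnerProductSpace ℝ F] [CompleteSpace F]

variable (E F) in
/-- The adjoint `a ↦ a*` on Hilbert–Schmidt operators. -/
def adjL : HS E F →L[ℝ] HS F E :=
  LinearMap.mkContinuous
    { toFun := fun a => mk (toOp a).adjoint
        (by rw [mem_hs, hsSq_adjoint]; exact mem_hs.1 (toOp_mem a))
      map_add' := fun _ _ => by ext1; simp
      map_smul' := fun _ _ => by ext1; simp } 1 (fun a => by
        refine norm_le_of_hsSq _ _ _ zero_le_one ?_
        simp [hsSq_adjoint])

@[simp] theorem toOp_adjL (a : HS E F) : toOp (adjL E F a) = (toOp a).adjoint := rfl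

end HS

/-- A map into a subspace that admits a bounded linear projection is smooth as soon as it is smooth
as a map into the whole space. -/
theorem contDiffOn_of_retract {X Y : Type*} [NormedAddCommGroup X] [NormedSpace ℝ X]
    [NormedAddCommGroup Y] [NormedSpace ℝ Y] {p : Submodule ℝ X} (q : X →L[ℝ] p)
    (hq : ∀ v : p, q v = v) {f : Y → p} {s : Set Y} {n : WithTop ℕ∞}
    (h : ContDiffOn ℝ n (fun y => (f y : X)) s) : ContDiffOn ℝ n f s := by
  have := q.contDiff.comp_contDiffOn h
  exact this.congr fun y _ => (hq (f y)).symm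

section Cayley

variable {A : Type*} [Ring A]

/-- The Cayley transform `(g - 1)(g + 1)⁻¹`. -/
def cayley (g : A) : A := (g - 1) * Ring.inverse (g + 1)

/-- The inverse Cayley transform `(1 + x)(1 - x)⁻¹`. -/
def cayleyInv (x : A) : A := (1 + x) * Ring.inverse (1 - x)

theorem cayley_eq {g : A} (h : IsUnit (g + 1)) : cayley g = 1 - 2 * Ring.inverse (g + 1) := by
  have e : g - 1 = (g + 1) - 2 := by rw [← one_add_one_eq_two]; abel
  rw [cayley, e, sub_mul, Ring.mul_inverse_cancel _ h]

theorem cayleyInv_eq {x : A} (h : IsUnit (1 - x)) :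
    cayleyInv x = 2 * Ring.inverse (1 - x) - 1 := by
  have e : 1 + x = 2 - (1 - x) := by rw [← one_add_one_eq_two]; abel
  rw [cayleyInv, e, sub_mul, Ring.mul_inverse_cancel _ h]

variable [Algebra ℝ A]

theorem isUnit_two' : IsUnit (2 : A) := by
  have : IsUnit (algebraMap ℝ A 2) := (isUnit_iff_ne_zero.2 two_ne_zero).map _
  rwa [map_ofNat] at this

theorem inverse_two_mul {a : A} (h : IsUnit a) :
    IsUnit (2 * Ring.inverse a) ∧ 2 * Ring.inverse (2 * Ring.inverse a) = a := by
  obtain ⟨u, rfl⟩ := h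
  have h1 : IsUnit (2 * Ring.inverse (u : A)) :=
    isUnit_two'.mul (by rw [Ring.inverse_unit]; exact Units.isUnit _)
  refine ⟨h1, ?_⟩
  refine h1.mul_right_cancel ?_
  have c : (u : A) * 2 = 2 * u := (Nat.cast_commute 2 (u : A)).eq.symm
  rw [mul_assoc, Ring.inverse_mul_cancel _ h1, Ring.inverse_unit, mul_one, ← mul_assoc, c,
    mul_assoc]
  simp

theorem one_sub_cayley {g : A} (h : IsUnit (g + 1)) :
    1 - cayley g = 2 * Ring.inverse (g + 1) := by
  rw [cayley_eq h]; abel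

theorem cayleyInv_add_one {x : A} (h : IsUnit (1 - x)) :
    cayleyInv x + 1 = 2 * Ring.inverse (1 - x) := by
  rw [cayleyInv_eq h]; abel

theorem isUnit_one_sub_cayley {g : A} (h : IsUnit (g + 1)) : IsUnit (1 - cayley g) := by
  rw [one_sub_cayley h]; exact (inverse_two_mul h).1

theorem isUnit_cayleyInv_add_one {x : A} (h : IsUnit (1 - x)) : IsUnit (cayleyInv x + 1) := by
  rw [cayleyInv_add_one h]; exact (inverse_two_mul h).1

theorem cayleyInv_cayley {g : A} (h : IsUnit (g + 1)) : cayleyInv (cayley g) = g := by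
  rw [cayleyInv_eq (isUnit_one_sub_cayley h), one_sub_cayley h, (inverse_two_mul h).2]; abel

theorem cayley_cayleyInv {x : A} (h : IsUnit (1 - x)) : cayley (cayleyInv x) = x := by
  rw [cayley_eq (isUnit_cayleyInv_add_one h), cayleyInv_add_one h, (inverse_two_mul h).2]; abel

end Cayley

section Groups

variable {H : Type*} [NormedAddCommGroup H] [InnerProductSpace ℝ H] [CompleteSpace H]

variable (H) in
/-- A complex structure on the real Hilbert space `H`: `J² = -1` and `J* = -J` (so that `J` is a
linear isometry). The symplectic form is `w(ξ, η) = ⟪J ξ, η⟫`. -/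
structure ComplexStructure where
  /-- The operator `J`. -/
  op : H →L[ℝ] H
  sq : op * op = -1
  adj : star op = -op

variable (J : ComplexStructure H)

/-- The symplectic group `Sp(H) = {g ∈ GL(H) : g* J g = J}`, with the topology of the operator
norm. -/
def SpGroup : Subgroup (H →L[ℝ] H)ˣ where
  carrier := {g | star (g : H →L[ℝ] H) * J.op * g = J.op}
  one_mem' := by simp
  mul_mem' := by
    intro a b ha hb
    simp only [Set.mem_ofPred_eq, Units.val_mul, star_mul] at *
    calc star (b : H →L[ℝ] H) * star (a : H →L[ℝ] H) * J.op * (a * b)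
        = star (b : H →L[ℝ] H) * (star (a : H →L[ℝ] H) * J.op * a) * b := by
          simp only [mul_assoc]
      _ = J.op := by rw [ha, hb]
  inv_mem' := by
    intro a ha
    simp only [Set.mem_ofPred_eq] at *
    have h1 : star ((a⁻¹ : (H →L[ℝ] H)ˣ) : H →L[ℝ] H) * star (a : H →L[ℝ] H) = 1 := by
      rw [← star_mul]; simp
    calc star ((a⁻¹ : (H →L[ℝ] H)ˣ) : H →L[ℝ] H) * J.op * (a⁻¹ : (H →L[ℝ] H)ˣ)
        = star ((a⁻¹ : (H →L[ℝ] H)ˣ) : H →L[ℝ] H) *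
          (star (a : H →L[ℝ] H) * J.op * a) * (a⁻¹ : (H →L[ℝ] H)ˣ) := by rw [ha]
      _ = (star ((a⁻¹ : (H →L[ℝ] H)ˣ) : H →L[ℝ] H) * star (a : H →L[ℝ] H)) * J.op *
          (a * (a⁻¹ : (H →L[ℝ] H)ˣ)) := by simp only [mul_assoc]
      _ = J.op := by rw [h1]; simp

/-- The symplectic group `Sp(H)` as a type. -/
abbrev Sp : Type _ := SpGroup J

/-- The Lie algebra `sp(H) = {x : x J = -J x*}`, with the operator norm. -/
def sp : Submodule ℝ (H →L[ℝ] H) where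
  carrier := {x | x * J.op = -(J.op * star x)}
  zero_mem' := by simp
  add_mem' := by
    intro a b ha hb
    simp only [Set.mem_ofPred_eq] at *
    rw [add_mul, ha, hb, star_add, mul_add]; abel
  smul_mem' := by
    intro r a ha
    simp only [Set.mem_ofPred_eq] at *
    rw [smul_mul_assoc, ha, star_smul, mul_smul_comm, smul_neg]; simp

variable {J}

/-- The operator underlying an element of the symplectic group. -/
def Sp.toOp (g : Sp J) : H →L[ℝ] H := (g : (H →L[ℝ] H)ˣ)

@[simp] theorem Sp.toOp_mul (g h : Sp J) : (g * h).toOp = g.toOp * h.toOp := rfl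
@[simp] theorem Sp.toOp_one : (1 : Sp J).toOp = 1 := rfl

theorem Sp.toOp_injective : Function.Injective (Sp.toOp : Sp J → (H →L[ℝ] H)) := fun _ _ h =>
  Subtype.ext (Units.ext h)

theorem Sp.isInducing_toOp : Topology.IsInducing (Sp.toOp : Sp J → (H →L[ℝ] H)) :=
  Units.isOpenEmbedding_val.isInducing.comp Topology.IsInducing.subtypeVal

theorem Sp.continuous_toOp : Continuous (Sp.toOp : Sp J → (H →L[ℝ] H)) :=
  Sp.isInducing_toOp.continuous

theorem Sp.star_mul_mul (g : Sp J) : star g.toOp * J.op * g.toOp = J.op := g.2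

theorem Sp.inv_mul (g : Sp J) : g⁻¹.toOp * g.toOp = 1 := by rw [← Sp.toOp_mul]; simp
theorem Sp.mul_inv (g : Sp J) : g.toOp * g⁻¹.toOp = 1 := by rw [← Sp.toOp_mul]; simp

theorem Sp.star_mul (g : Sp J) : star g.toOp * J.op = J.op * g⁻¹.toOp := by
  rw [← g.star_mul_mul, mul_assoc (_ * _), g.mul_inv, mul_one, g.star_mul_mul]

theorem Sp.mul_mul_star (g : Sp J) : g.toOp * J.op * star g.toOp = J.op := by
  have h := congrArg (fun y => -(y * J.op)) g.star_mul
  have h1 : star g.toOp = -(J.op * g⁻¹.toOp * J.op) := by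
    simpa [mul_assoc, J.sq] using h
  rw [h1, mul_neg, mul_assoc (J.op), mul_assoc g.toOp, ← mul_assoc J.op J.op, J.sq]
  simp only [neg_mul, one_mul, mul_neg, neg_neg]
  rw [← mul_assoc, g.mul_inv, one_mul]

theorem cayley_mem_sp (g : Sp J) : cayley g.toOp ∈ sp J := by
  by_cases h : IsUnit (g.toOp + 1)
  · have hs : IsUnit (star (g.toOp + 1)) := h.star
    have e2 : star (2 : H →L[ℝ] H) = 2 := by
      rw [← one_add_one_eq_two, star_add, star_one]
    have key : J.op = Ring.inverse (g.toOp + 1) * J.op +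
        J.op * Ring.inverse (star (g.toOp + 1)) := by
      apply h.mul_left_cancel
      apply hs.mul_right_cancel
      have a1 : (g.toOp + 1) * (Ring.inverse (g.toOp + 1) * J.op +
          J.op * Ring.inverse (star (g.toOp + 1))) * star (g.toOp + 1) =
          ((g.toOp + 1) * Ring.inverse (g.toOp + 1)) * J.op * star (g.toOp + 1) +
          (g.toOp + 1) * J.op * (Ring.inverse (star (g.toOp + 1)) * star (g.toOp + 1)) := by
        noncomm_ring
      rw [a1, Ring.mul_inverse_cancel _ h, Ring.inverse_mul_cancel _ hs]
      have a2 : (g.toOp + 1) * J.op * star (g.toOp + 1) =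
          g.toOp * J.op * star g.toOp + g.toOp * J.op + J.op * star g.toOp + J.op := by
        rw [star_add, star_one]; noncomm_ring
      rw [a2, g.mul_mul_star, star_add, star_one]
      noncomm_ring
    change cayley g.toOp * J.op = -(J.op * star (cayley g.toOp))
    rw [cayley_eq h, star_sub, star_one, StarMul.star_mul, e2, ← Ring.inverse_star]
    have c : ∀ y : H →L[ℝ] H, y * 2 = 2 * y := fun y => (Nat.cast_commute 2 y).eq.symm
    rw [c]
    calc (1 - 2 * Ring.inverse (g.toOp + 1)) * J.op
        = J.op - 2 * (Ring.inverse (g.toOp + 1) * J.op +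
        J.op * Ring.inverse (star (g.toOp + 1))) +
          2 * (J.op * Ring.inverse (star (g.toOp + 1))) := by noncomm_ring
      _ = J.op - 2 * J.op + 2 * (J.op * Ring.inverse (star (g.toOp + 1))) := by rw [← key]
      _ = _ := by
        rw [mul_sub, mul_one, ← mul_assoc J.op 2, c J.op, mul_assoc, two_mul J.op]; abel
  · rw [cayley, Ring.inverse_non_unit _ h, mul_zero]; exact zero_mem _

theorem sp_eq {x : H →L[ℝ] H} (hx : x ∈ sp J) : x = J.op * star x * J.op := by
  have h : x * J.op = -(J.op * star x) := hx
  have := congrArg (fun y => -(y * J.op)) h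
  simpa [mul_assoc, J.sq] using this

theorem star_sp_mul {x : H →L[ℝ] H} (hx : x ∈ sp J) : star x * J.op = -(J.op * x) := by
  have h : J.op * x = J.op * (J.op * star x * J.op) := congrArg (J.op * ·) (sp_eq hx)
  rw [h, ← mul_assoc, ← mul_assoc, J.sq]; simp

theorem isUnit_one_add {x : H →L[ℝ] H} (hx : x ∈ sp J) (h : IsUnit (1 - x)) :
    IsUnit (1 + x) := by
  have hJ : IsUnit J.op := ⟨⟨J.op, -J.op, by simp [J.sq], by simp [J.sq]⟩, rfl⟩
  have h1 : star (1 - x) * J.op = J.op * (1 + x) := by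
    rw [star_sub, star_one, sub_mul, star_sp_mul hx]; noncomm_ring
  have h2 : IsUnit (J.op * (1 + x)) := h1 ▸ h.star.mul hJ
  obtain ⟨u, hu⟩ := hJ
  rw [← hu] at h2
  exact (Units.isUnit_units_mul u _).1 h2

theorem cayleyInv_mem {x : H →L[ℝ] H} (hx : x ∈ sp J) (h : IsUnit (1 - x)) :
    star (cayleyInv x) * J.op * cayleyInv x = J.op := by
  have h' := isUnit_one_add hx h
  have s1 : star (1 - x) * J.op = J.op * (1 + x) := by
    rw [star_sub, star_one, sub_mul, star_sp_mul hx]; noncomm_ring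
  have s2 : star (1 + x) * J.op = J.op * (1 - x) := by
    rw [star_add, star_one, add_mul, star_sp_mul hx]; noncomm_ring
  have c : (1 - x) * (1 + x) = (1 + x) * (1 - x) := by noncomm_ring
  rw [cayleyInv, StarMul.star_mul, ← Ring.inverse_star]
  apply h.star.mul_left_cancel
  apply h.mul_right_cancel
  calc star (1 - x) * (Ring.inverse (star (1 - x)) * star (1 + x) * J.op *
          ((1 + x) * Ring.inverse (1 - x))) * (1 - x)
      = (star (1 - x) * Ring.inverse (star (1 - x))) * (star (1 + x) * J.op) * (1 + x) *
          (Ring.inverse (1 - x) * (1 - x)) := by simp only [mul_assoc]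
    _ = J.op * ((1 - x) * (1 + x)) := by
      rw [Ring.mul_inverse_cancel _ h.star, Ring.inverse_mul_cancel _ h, s2]
      simp only [mul_assoc, one_mul, mul_one]
    _ = star (1 - x) * J.op * (1 - x) := by rw [s1, c, mul_assoc]

theorem isUnit_cayleyInv {x : H →L[ℝ] H} (hx : x ∈ sp J) (h : IsUnit (1 - x)) :
    IsUnit (cayleyInv x) :=
  (isUnit_one_add hx h).mul h.ringInverse

/-- The symplectic operator `(1 + x)(1 - x)⁻¹` for `x ∈ sp(H)` with `1 - x` invertible. -/
def cayleySp (x : sp J) (h : IsUnit (1 - (x : H →L[ℝ] H))) : Sp J :=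
  ⟨(isUnit_cayleyInv x.2 h).unit, cayleyInv_mem x.2 h⟩

@[simp] theorem toOp_cayleySp (x : sp J) (h : IsUnit (1 - (x : H →L[ℝ] H))) :
    (cayleySp x h).toOp = cayleyInv (x : H →L[ℝ] H) := rfl

theorem contDiffAt_inverse_comp {X : Type*} [NormedAddCommGroup X] [NormedSpace ℝ X]
    {f : X → (H →L[ℝ] H)} {s : Set X} {n : WithTop ℕ∞} (hf : ContDiffOn ℝ n f s)
    (h : ∀ x ∈ s, IsUnit (f x)) : ContDiffOn ℝ n (fun x => Ring.inverse (f x)) s := by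
  intro x hx
  obtain ⟨u, hu⟩ := h x hx
  have := contDiffAt_ringInverse (𝕜 := ℝ) (n := n) u
  rw [hu] at this
  exact this.comp_contDiffWithinAt x (hf x hx)

open Classical in
variable (J) in
/-- The Cayley chart of `Sp(H)` at `1`, with values in `sp(H)`. -/
def spChartOne : OpenPartialHomeomorph (Sp J) (sp J) where
  toFun g := ⟨cayley g.toOp, cayley_mem_sp g⟩
  invFun x := if h : IsUnit (1 - (x : H →L[ℝ] H)) then cayleySp x h else 1
  source := {g | IsUnit (g.toOp + 1)}
  target := {x | IsUnit (1 - (x : H →L[ℝ] H))}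
  map_source' g hg := isUnit_one_sub_cayley hg
  map_target' x hx := by
    have hx' : IsUnit (1 - (x : H →L[ℝ] H)) := hx
    rw [dif_pos hx']
    exact isUnit_cayleyInv_add_one hx'
  left_inv' g hg := by
    have h : IsUnit (1 - cayley g.toOp) := isUnit_one_sub_cayley hg
    rw [dif_pos h]
    exact Sp.toOp_injective (cayleyInv_cayley hg)
  right_inv' x hx := by
    have hx' : IsUnit (1 - (x : H →L[ℝ] H)) := hx
    rw [dif_pos hx']
    exact Subtype.ext (cayley_cayleyInv hx')
  open_source := Units.isOpen.preimage (Sp.continuous_toOp.add continuous_const)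
  open_target := Units.isOpen.preimage (continuous_const.sub continuous_subtype_val)
  continuousOn_toFun := by
    refine Topology.IsInducing.subtypeVal.continuousOn_iff.2 ?_
    have h1 : ContinuousOn (fun y : H →L[ℝ] H => cayley y) {y | IsUnit (y + 1)} :=
      ((contDiffOn_id.sub contDiffOn_const).mul (contDiffAt_inverse_comp (n := 0)
        (contDiffOn_id.add contDiffOn_const) fun x hx => hx)).continuousOn
    exact h1.comp Sp.continuous_toOp.continuousOn fun g hg => hg
  continuousOn_invFun := by
    refine Sp.isInducing_toOp.continuousOn_iff.2 ?_
    have h1 : ContinuousOn (fun y : H →L[ℝ] H => cayleyInv y) {y | IsUnit (1 - y)} :=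
      ((contDiffOn_const.add contDiffOn_id).mul (contDiffAt_inverse_comp (n := 0)
        (contDiffOn_const.sub contDiffOn_id) fun x hx => hx)).continuousOn
    refine (h1.comp continuous_subtype_val.continuousOn fun x hx => hx).congr fun x hx => ?_
    have hx' : IsUnit (1 - (x : H →L[ℝ] H)) := hx
    simp only [Function.comp_apply, dif_pos hx']
    rfl

theorem spChartOne_symm_apply {x : sp J} (h : IsUnit (1 - (x : H →L[ℝ] H))) :
    (spChartOne J).symm x = cayleySp x h := dif_pos h

/-- The chart `g ↦ (g₀⁻¹ g - 1)(g₀⁻¹ g + 1)⁻¹ ∈ sp(H)` of `Sp(H)` at `g₀`. -/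
def spChart (g₀ : Sp J) : OpenPartialHomeomorph (Sp J) (sp J) :=
  (Homeomorph.mulLeft g₀⁻¹).toOpenPartialHomeomorph.trans (spChartOne J)

theorem one_mem_spChartOne : (1 : Sp J) ∈ (spChartOne J).source := by
  change IsUnit ((1 : H →L[ℝ] H) + 1)
  rw [one_add_one_eq_two]; exact isUnit_two'

/-- The Banach manifold structure of `Sp(H)`, modelled on `sp(H)`. The inverse charts are the maps
`x ↦ g₀ (1 + x)(1 - x)⁻¹`, so that this is the structure of a submanifold of `B(H)`. -/
instance : ChartedSpace (sp J) (Sp J) where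
  atlas := Set.range spChart
  chartAt := spChart
  mem_chart_source g := by
    simp [spChart, one_mem_spChartOne]
  chart_mem_atlas g := ⟨g, rfl⟩

variable (J) in
/-- A bounded projection of `B(H)` onto `sp(H)`. -/
def spProj : (H →L[ℝ] H) →L[ℝ] sp J :=
  ContinuousLinearMap.codRestrict
    ((1 / 2 : ℝ) • (ContinuousLinearMap.id ℝ (H →L[ℝ] H) +
      ((ContinuousLinearMap.mul ℝ (H →L[ℝ] H)).flip J.op ∘L
        ContinuousLinearMap.mul ℝ (H →L[ℝ] H) J.op) ∘L
        (starL' ℝ : (H →L[ℝ] H) ≃L[ℝ] (H →L[ℝ] H)).toContinuousLinearMap)) (sp J) (by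
      intro x
      change ((1 / 2 : ℝ) • (x + J.op * star x * J.op)) * J.op =
        -(J.op * star ((1 / 2 : ℝ) • (x + J.op * star x * J.op)))
      rw [star_smul, star_add, StarMul.star_mul, StarMul.star_mul, J.adj, star_star,
        smul_mul_assoc, mul_smul_comm, ← smul_neg]
      have e : star (1 / 2 : ℝ) = 1 / 2 := by simp
      rw [e]
      congr 1
      have e2 : ∀ y : H →L[ℝ] H, J.op * (J.op * y) = -y := fun y => by
        rw [← mul_assoc, J.sq]; simp
      simp only [add_mul, mul_add, mul_assoc, J.sq, neg_mul, mul_neg, e2, neg_neg, mul_one, neg_add]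
      abel)

theorem spProj_coe (x : sp J) : spProj J x = x := by
  apply Subtype.ext
  change (1 / 2 : ℝ) • ((x : H →L[ℝ] H) + J.op * star (x : H →L[ℝ] H) * J.op) = x
  rw [← sp_eq x.2, ← two_smul ℝ, smul_smul]; norm_num

instance : IsManifold 𝓘(ℝ, sp J) ∞ (Sp J) := by
  refine isManifold_of_contDiffOn _ _ _ ?_
  rintro _ _ ⟨g, rfl⟩ ⟨g', rfl⟩
  refine contDiffOn_of_retract (spProj J) spProj_coe ?_
  simp only [modelWithCornersSelf_coe, modelWithCornersSelf_coe_symm, Set.preimage_id,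
    Set.range_id, Set.inter_univ, Function.comp_id, Function.id_comp]
  set s := ((spChart g).symm.trans (spChart g')).source with hs
  have hs1 : ∀ x ∈ s, IsUnit (1 - (x : H →L[ℝ] H)) := by
    intro x hx
    simp only [hs, spChart, mfld_simps] at hx
    exact hx.1
  have hs3 : ∀ x ∈ s, ((spChart g).symm x).toOp = g.toOp * cayleyInv (x : H →L[ℝ] H) := by
    intro x hx
    simp only [spChart, mfld_simps]
    change ((g⁻¹)⁻¹ * (spChartOne J).symm x).toOp = _
    rw [inv_inv, Sp.toOp_mul, spChartOne_symm_apply (hs1 x hx)]; rfl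
  have hs2 : ∀ x ∈ s, IsUnit (g'⁻¹.toOp * (g.toOp * cayleyInv (x : H →L[ℝ] H)) + 1) := by
    intro x hx
    rw [← hs3 x hx]
    simp only [hs, spChart, mfld_simps] at hx
    exact hx.2
  have hc : ContDiffOn ℝ ∞ (fun x : sp J => (x : H →L[ℝ] H)) s :=
    (show ContDiff ℝ ∞ (sp J).subtypeL from ContinuousLinearMap.contDiff _).contDiffOn
  have hi : ContDiffOn ℝ ∞ (fun x : sp J =>
      g'⁻¹.toOp * (g.toOp * cayleyInv (x : H →L[ℝ] H))) s :=
    contDiffOn_const.mul (contDiffOn_const.mul ((contDiffOn_const.add hc).mul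
      (contDiffAt_inverse_comp (contDiffOn_const.sub hc) hs1)))
  refine ((hi.sub (contDiffOn_const (c := 1))).mul
    (contDiffAt_inverse_comp (hi.add contDiffOn_const) hs2)).congr fun x hx => ?_
  change cayley (g'⁻¹ * (spChart g).symm x).toOp = _
  rw [Sp.toOp_mul, hs3 x hx]
  rfl

end Groups

section RestrictedGroup

variable {H : Type*} [NormedAddCommGroup H] [InnerProductSpace ℝ H] [CompleteSpace H]
  (J : ComplexStructure H)

/-- The restricted symplectic group `Sp₂(H) = {g ∈ Sp(H) : g - 1 ∈ B₂(H)}` as a subgroup. -/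
def Sp2Group : Subgroup (Sp J) where
  carrier := {g | g.toOp - 1 ∈ hsSubmodule H H}
  one_mem' := by simp
  mul_mem' := by
    intro a b ha hb
    simp only [Set.mem_ofPred_eq] at *
    have e : (a * b).toOp - 1 = a.toOp ∘L (b.toOp - 1) + (a.toOp - 1) := by
      change a.toOp * b.toOp - 1 = a.toOp * (b.toOp - 1) + (a.toOp - 1)
      noncomm_ring
    rw [e]
    exact add_mem (comp_mem_hs _ hb) ha
  inv_mem' := by
    intro a ha
    simp only [Set.mem_ofPred_eq] at *
    have e : a⁻¹.toOp - 1 = -(a⁻¹.toOp ∘L (a.toOp - 1)) := by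
      change a⁻¹.toOp - 1 = -(a⁻¹.toOp * (a.toOp - 1))
      rw [mul_sub, a.inv_mul]; noncomm_ring
    rw [e]
    exact neg_mem (comp_mem_hs _ ha)

/-- The restricted symplectic group as a type of its own: it carries the topology of the metric
`‖g₁ - g₂‖₂`, not the one of the operator norm. -/
def Sp2 : Type _ := Sp2Group J

/-- The Lie algebra `sp₂(H) = {x ∈ B₂(H) : x J = -J x*}`, with the `2`-norm. -/
def sp2 : Submodule ℝ (HS H H) := (sp J).comap HS.toOp

variable {J}

namespace Sp2

instance : Group (Sp2 J) := inferInstanceAs (Group (Sp2Group J))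

/-- The inclusion of `Sp₂(H)` in `Sp(H)`. -/
def toSp : Sp2 J →* Sp J := (Sp2Group J).subtype

theorem toSp_injective : Function.Injective (toSp : Sp2 J → Sp J) := Subtype.val_injective

/-- The Hilbert–Schmidt operator `g - 1`. -/
def toHS (g : Sp2 J) : HS H H := HS.mk ((toSp g).toOp - 1) g.2

theorem toOp_toHS (g : Sp2 J) : HS.toOp (toHS g) = (toSp g).toOp - 1 := rfl

theorem toOp_eq (g : Sp2 J) : (toSp g).toOp = 1 + HS.toOp (toHS g) := by
  rw [toOp_toHS]; abel

/-- The topology of the metric `‖g₁ - g₂‖₂`. -/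
instance : TopologicalSpace (Sp2 J) := TopologicalSpace.induced toHS inferInstance

theorem isInducing_toHS : Topology.IsInducing (toHS : Sp2 J → HS H H) := ⟨rfl⟩

theorem continuous_toHS : Continuous (toHS : Sp2 J → HS H H) := isInducing_toHS.continuous

theorem continuous_toOp : Continuous (fun g : Sp2 J => (toSp g).toOp) := by
  simp_rw [toOp_eq]
  exact continuous_const.add ((HS.inclL H H).continuous.comp continuous_toHS)

theorem toHS_mul (c g : Sp2 J) :
    toHS (c * g) = toHS c + HS.compL H H H (toSp c).toOp (toHS g) := by
  ext1
  rw [map_add, HS.toOp_compL, toOp_toHS, toOp_toHS, toOp_toHS, map_mul, Sp.toOp_mul]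
  change _ = (toSp c).toOp - 1 + (toSp c).toOp * ((toSp g).toOp - 1)
  noncomm_ring

theorem continuous_mul_left (c : Sp2 J) : Continuous (fun g : Sp2 J => c * g) := by
  rw [isInducing_toHS.continuous_iff]
  simp only [Function.comp_def, toHS_mul]
  exact continuous_const.add ((HS.compL H H H (toSp c).toOp).continuous.comp continuous_toHS)

/-- Left translation as a homeomorphism. -/
def mulLeft (c : Sp2 J) : Sp2 J ≃ₜ Sp2 J where
  toEquiv := Equiv.mulLeft c
  continuous_toFun := continuous_mul_left c
  continuous_invFun := continuous_mul_left c⁻¹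

end Sp2

/-- The Cayley transform `(g - 1)(g + 1)⁻¹` of `g ∈ Sp₂(H)`, as an element of `sp₂(H)`. -/
def cayley2 (g : Sp2 J) : sp2 J :=
  ⟨HS.compR H H H g.toHS (Ring.inverse (g.toSp.toOp + 1)), cayley_mem_sp g.toSp⟩

theorem toOp_cayley2 (g : Sp2 J) : HS.toOp (cayley2 g : HS H H) = cayley g.toSp.toOp := rfl

/-- The element `x` of `sp₂(H)`, seen in `sp(H)`. -/
def sp2Incl (x : sp2 J) : sp J := ⟨HS.toOp (x : HS H H), x.2⟩

theorem cayleyInv_sub_one {x : H →L[ℝ] H} (h : IsUnit (1 - x)) :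
    cayleyInv x - 1 = x * ((2 : ℝ) • Ring.inverse (1 - x)) := by
  have e : (1 + x : H →L[ℝ] H) = (1 - x) + (2 : ℝ) • x := by rw [two_smul]; abel
  rw [cayleyInv, e, add_mul, Ring.mul_inverse_cancel _ h, mul_smul_comm, smul_mul_assoc]
  abel

/-- The element `(1 + x)(1 - x)⁻¹` of `Sp₂(H)` for `x ∈ sp₂(H)` with `1 - x` invertible. -/
def cayleySp2 (x : sp2 J) (h : IsUnit (1 - HS.toOp (x : HS H H))) : Sp2 J :=
  ⟨cayleySp (sp2Incl x) h, by
    change cayleyInv (HS.toOp (x : HS H H)) - 1 ∈ hsSubmodule H H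
    rw [cayleyInv_sub_one h]
    exact mem_hs_comp (HS.toOp_mem _) _⟩

theorem toSp_cayleySp2 (x : sp2 J) (h : IsUnit (1 - HS.toOp (x : HS H H))) :
    (cayleySp2 x h).toSp = cayleySp (sp2Incl x) h := rfl

theorem toHS_cayleySp2 (x : sp2 J) (h : IsUnit (1 - HS.toOp (x : HS H H))) :
    (cayleySp2 x h).toHS =
      HS.compR H H H x ((2 : ℝ) • Ring.inverse (1 - HS.toOp (x : HS H H))) := by
  ext1
  exact cayleyInv_sub_one h

theorem contDiff_sp2_toOp : ContDiff ℝ ∞ (fun x : sp2 J => HS.toOp (x : HS H H)) :=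
  (show ContDiff ℝ ∞ (HS.inclL H H ∘L (sp2 J).subtypeL) from ContinuousLinearMap.contDiff _)

theorem contDiff_sp2_coe : ContDiff ℝ ∞ (fun x : sp2 J => (x : HS H H)) :=
  (show ContDiff ℝ ∞ (sp2 J).subtypeL from ContinuousLinearMap.contDiff _)

theorem HS.contDiffOn_compR {X E F G : Type*} [NormedAddCommGroup X] [NormedSpace ℝ X]
    [NormedAddCommGroup E] [InnerProductSpace ℝ E] [CompleteSpace E]
    [NormedAddCommGroup F] [InnerProductSpace ℝ F] [CompleteSpace F]
    [NormedAddCommGroup G] [InnerProductSpace ℝ G] [CompleteSpace G]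
    {a : X → HS F G} {x : X → (E →L[ℝ] F)} {s : Set X} {n : WithTop ℕ∞}
    (ha : ContDiffOn ℝ n a s) (hx : ContDiffOn ℝ n x s) :
    ContDiffOn ℝ n (fun y => HS.compR E F G (a y) (x y)) s :=
  ((show ContDiff ℝ n (HS.compR E F G) from ContinuousLinearMap.contDiff _).comp_contDiffOn
    ha).clm_apply hx

theorem contDiffOn_cayleySp2 {s : Set (sp2 J)}
    (h : ∀ x ∈ s, IsUnit (1 - HS.toOp (x : HS H H))) :
    ContDiffOn ℝ ∞ (fun x : sp2 J =>
      HS.compR H H H x ((2 : ℝ) • Ring.inverse (1 - HS.toOp (x : HS H H)))) s :=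
  HS.contDiffOn_compR contDiff_sp2_coe.contDiffOn (contDiffOn_const (c := (2 : ℝ)) |>.smul
    (contDiffAt_inverse_comp (contDiffOn_const.sub contDiff_sp2_toOp.contDiffOn) h))

open Classical in
variable (J) in
/-- The Cayley chart of `Sp₂(H)` at `1`, with values in `sp₂(H)`. -/
def sp2ChartOne : OpenPartialHomeomorph (Sp2 J) (sp2 J) where
  toFun g := cayley2 g
  invFun x := if h : IsUnit (1 - HS.toOp (x : HS H H)) then cayleySp2 x h else 1
  source := {g | IsUnit (g.toSp.toOp + 1)}
  target := {x | IsUnit (1 - HS.toOp (x : HS H H))}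
  map_source' g hg := isUnit_one_sub_cayley hg
  map_target' x hx := by
    have hx' : IsUnit (1 - HS.toOp (x : HS H H)) := hx
    rw [dif_pos hx']
    exact isUnit_cayleyInv_add_one hx'
  left_inv' g hg := by
    have h : IsUnit (1 - HS.toOp (cayley2 g : HS H H)) := isUnit_one_sub_cayley hg
    rw [dif_pos h]
    exact Sp2.toSp_injective (Sp.toOp_injective (cayleyInv_cayley hg))
  right_inv' x hx := by
    have hx' : IsUnit (1 - HS.toOp (x : HS H H)) := hx
    rw [dif_pos hx']
    exact Subtype.ext (HS.ext (cayley_cayleyInv hx'))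
  open_source := Units.isOpen.preimage (Sp2.continuous_toOp.add continuous_const)
  open_target := Units.isOpen.preimage (continuous_const.sub contDiff_sp2_toOp.continuous)
  continuousOn_toFun := by
    refine Topology.IsInducing.subtypeVal.continuousOn_iff.2 ?_
    have h1 : ContinuousOn (fun g : Sp2 J => Ring.inverse (g.toSp.toOp + 1))
        {g | IsUnit (g.toSp.toOp + 1)} :=
      (contDiffAt_inverse_comp (n := 0) (s := {y : H →L[ℝ] H | IsUnit (y + 1)})
        (contDiffOn_id.add contDiffOn_const) fun x hx => hx).continuousOn.comp
        Sp2.continuous_toOp.continuousOn fun g hg => hg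
    exact ((HS.compR H H H).continuous.comp Sp2.continuous_toHS).continuousOn.clm_apply h1
  continuousOn_invFun := by
    refine Sp2.isInducing_toHS.continuousOn_iff.2 ?_
    refine (contDiffOn_cayleySp2 fun x hx => hx).continuousOn.congr fun x hx => ?_
    have hx' : IsUnit (1 - HS.toOp (x : HS H H)) := hx
    simp only [Function.comp_apply, dif_pos hx', toHS_cayleySp2]

theorem sp2ChartOne_symm_apply {x : sp2 J} (h : IsUnit (1 - HS.toOp (x : HS H H))) :
    (sp2ChartOne J).symm x = cayleySp2 x h := dif_pos h

/-- The chart `g ↦ (g₀⁻¹ g - 1)(g₀⁻¹ g + 1)⁻¹ ∈ sp₂(H)` of `Sp₂(H)` at `g₀`. -/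
def sp2Chart (g₀ : Sp2 J) : OpenPartialHomeomorph (Sp2 J) (sp2 J) :=
  (Sp2.mulLeft g₀⁻¹).toOpenPartialHomeomorph.trans (sp2ChartOne J)

theorem one_mem_sp2ChartOne : (1 : Sp2 J) ∈ (sp2ChartOne J).source := by
  change IsUnit ((1 : H →L[ℝ] H) + 1)
  rw [one_add_one_eq_two]; exact isUnit_two'

/-- The Banach manifold structure of `Sp₂(H)`, modelled on `sp₂(H)`. The inverse charts are the
maps `x ↦ g₀ (1 + x)(1 - x)⁻¹`, so that this is the structure of a submanifold of the affine space
`1 + B₂(H)`. -/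
instance : ChartedSpace (sp2 J) (Sp2 J) where
  atlas := Set.range sp2Chart
  chartAt := sp2Chart
  mem_chart_source g := by
    refine ⟨Set.mem_univ _, ?_⟩
    change g⁻¹ * g ∈ (sp2ChartOne J).source
    rw [inv_mul_cancel]
    exact one_mem_sp2ChartOne
  chart_mem_atlas g := ⟨g, rfl⟩

theorem HS.toOp_compR' (a : HS H H) (x : H →L[ℝ] H) :
    HS.toOp (HS.compR H H H a x) = HS.toOp a * x := rfl

variable (J) in
/-- A bounded projection of `B₂(H)` onto `sp₂(H)`. -/
def sp2Proj : HS H H →L[ℝ] sp2 J :=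
  ContinuousLinearMap.codRestrict
    ((1 / 2 : ℝ) • (ContinuousLinearMap.id ℝ (HS H H) +
      ((HS.compR H H H).flip J.op ∘L HS.compL H H H J.op) ∘L HS.adjL H H)) (sp2 J)
    (fun x => (spProj J (HS.toOp x)).2)

theorem sp2Proj_coe (x : sp2 J) : sp2Proj J x = x := by
  have h := congrArg Subtype.val (spProj_coe (sp2Incl x))
  exact Subtype.ext (HS.ext h)

instance : IsManifold 𝓘(ℝ, sp2 J) ∞ (Sp2 J) := by
  refine isManifold_of_contDiffOn _ _ _ ?_
  rintro _ _ ⟨g, rfl⟩ ⟨g', rfl⟩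
  refine contDiffOn_of_retract (sp2Proj J) sp2Proj_coe ?_
  simp only [modelWithCornersSelf_coe, modelWithCornersSelf_coe_symm, Set.preimage_id,
    Set.range_id, Set.inter_univ, Function.comp_id, Function.id_comp]
  set s := ((sp2Chart g).symm.trans (sp2Chart g')).source with hs
  have hs1 : ∀ x ∈ s, IsUnit (1 - HS.toOp (x : HS H H)) := by
    intro x hx
    simp only [hs, sp2Chart, mfld_simps] at hx
    exact hx.1
  have hs3 : ∀ x (hx : x ∈ s), (sp2Chart g).symm x = g * cayleySp2 x (hs1 x hx) := by
    intro x hx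
    simp only [sp2Chart, mfld_simps]
    change (g⁻¹)⁻¹ * (sp2ChartOne J).symm x = _
    rw [inv_inv, sp2ChartOne_symm_apply (hs1 x hx)]
  let f : sp2 J → HS H H := fun x => Sp2.toHS (g'⁻¹ * g) + HS.compL H H H
    (Sp2.toSp (g'⁻¹ * g)).toOp
      (HS.compR H H H x ((2 : ℝ) • Ring.inverse (1 - HS.toOp (x : HS H H))))
  have hf : ContDiffOn ℝ ∞ f s := contDiffOn_const.add
    ((HS.compL H H H (Sp2.toSp (g'⁻¹ * g)).toOp).contDiff.comp_contDiffOn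
      (contDiffOn_cayleySp2 hs1))
  have hf1 : ∀ x ∈ s, f x = Sp2.toHS (g'⁻¹ * (sp2Chart g).symm x) := by
    intro x hx
    rw [hs3 x hx, ← mul_assoc, Sp2.toHS_mul, toHS_cayleySp2]
  have hs2 : ∀ x ∈ s, IsUnit (1 + HS.toOp (f x) + 1) := by
    intro x hx
    rw [hf1 x hx, ← Sp2.toOp_eq]
    simp only [hs, sp2Chart, mfld_simps] at hx
    exact hx.2
  have hf2 : ContDiffOn ℝ ∞ (fun x => 1 + HS.toOp (f x) + 1) s :=
    (contDiffOn_const.add ((HS.inclL H H).contDiff.comp_contDiffOn hf)).add contDiffOn_const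
  refine (HS.contDiffOn_compR hf (contDiffAt_inverse_comp hf2 hs2)).congr fun x hx => ?_
  change (cayley2 (g'⁻¹ * (sp2Chart g).symm x) : HS H H) = _
  rw [hf1 x hx, ← Sp2.toOp_eq]
  rfl

end RestrictedGroup

section SymmetricOperators

variable (E : Type*) [NormedAddCommGroup E] [InnerProductSpace ℝ E] [CompleteSpace E]

/-- The space `B(E)_s` of symmetric bounded operators on a Hilbert space, with the operator
norm. -/
def symOp : Submodule ℝ (E →L[ℝ] E) where
  carrier := {ψ | ψ.adjoint = ψ}
  zero_mem' := map_zero _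
  add_mem' := by
    intro a b ha hb
    simp only [Set.mem_ofPred_eq] at *
    rw [map_add, ha, hb]
  smul_mem' := by
    intro r a ha
    simp only [Set.mem_ofPred_eq] at *
    rw [map_smulₛₗ, ha]; rfl

/-- The space `B₂(E)_s` of symmetric Hilbert–Schmidt operators, with the `2`-norm. -/
def symHS : Submodule ℝ (HS E E) := (symOp E).comap HS.toOp

/-- The adjoint `a ↦ a*` as a real linear map. -/
def adjRL : (E →L[ℝ] E) →L[ℝ] (E →L[ℝ] E) :=
  LinearMap.mkContinuous
    { toFun := fun a => a.adjoint
      map_add' := fun _ _ => map_add _ _ _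
      map_smul' := fun r a => by simp } 1 (fun a => by simp)

/-- A bounded projection of `B(E)` onto `B(E)_s`. -/
def symProj : (E →L[ℝ] E) →L[ℝ] symOp E :=
  ContinuousLinearMap.codRestrict
    ((1 / 2 : ℝ) • (ContinuousLinearMap.id ℝ _ + adjRL E)) (symOp E) (by
      intro x
      change ((1 / 2 : ℝ) • (x + x.adjoint)).adjoint = (1 / 2 : ℝ) • (x + x.adjoint)
      rw [map_smulₛₗ, map_add, ContinuousLinearMap.adjoint_adjoint, add_comm]; simp)

/-- A bounded projection of `B₂(E)` onto `B₂(E)_s`. -/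
def symHSProj : HS E E →L[ℝ] symHS E :=
  ContinuousLinearMap.codRestrict
    ((1 / 2 : ℝ) • (ContinuousLinearMap.id ℝ (HS E E) + HS.adjL E E)) (symHS E)
    (fun x => (symProj E (HS.toOp x)).2)

variable {E}

theorem symProj_coe (x : symOp E) : symProj E x = x := by
  apply Subtype.ext
  change (1 / 2 : ℝ) • (x.1 + x.1.adjoint) = x.1
  have h : x.1.adjoint = x.1 := x.2
  rw [h, ← two_smul ℝ, smul_smul]; norm_num

/-- A symmetric Hilbert–Schmidt operator as a symmetric operator. -/
def symHSIncl (x : symHS E) : symOp E := ⟨HS.toOp (x : HS E E), x.2⟩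

theorem symHSProj_coe (x : symHS E) : symHSProj E x = x := by
  have h := congrArg Subtype.val (symProj_coe (symHSIncl x))
  exact Subtype.ext (HS.ext h)

theorem contDiff_symOp_coe : ContDiff ℝ ∞ (fun ψ : symOp E => (ψ : E →L[ℝ] E)) :=
  (show ContDiff ℝ ∞ (symOp E).subtypeL from ContinuousLinearMap.contDiff _)

theorem contDiff_symHS_coe : ContDiff ℝ ∞ (fun ψ : symHS E => (ψ : HS E E)) :=
  (show ContDiff ℝ ∞ (symHS E).subtypeL from ContinuousLinearMap.contDiff _)

theorem contDiff_symHSIncl : ContDiff ℝ ∞ (fun ψ : symHS E => HS.toOp (ψ : HS E E)) :=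
  (show ContDiff ℝ ∞ (HS.inclL E E ∘L (symHS E).subtypeL) from ContinuousLinearMap.contDiff _)

variable {F : Type*} [NormedAddCommGroup F] [InnerProductSpace ℝ F] [CompleteSpace F]

/-- Transport of symmetric operators, `ψ ↦ e* ψ e`, along an isomorphism `e : F → E`. -/
def symCongrAux (e : F ≃L[ℝ] E) : symOp E →L[ℝ] symOp F :=
  ContinuousLinearMap.codRestrict
    ((ContinuousLinearMap.compL ℝ F E F (e : F →L[ℝ] E).adjoint ∘L
      (ContinuousLinearMap.compL ℝ F E E).flip (e : F →L[ℝ] E)) ∘L (symOp E).subtypeL)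
    (symOp F) (fun ψ => by
      have h : ψ.1.adjoint = ψ.1 := ψ.2
      change ((e : F →L[ℝ] E).adjoint ∘L ψ.1 ∘L (e : F →L[ℝ] E)).adjoint =
        (e : F →L[ℝ] E).adjoint ∘L ψ.1 ∘L (e : F →L[ℝ] E)
      rw [ContinuousLinearMap.adjoint_comp, ContinuousLinearMap.adjoint_comp, h,
        ContinuousLinearMap.adjoint_adjoint]
      rfl)

theorem adjoint_symm_comp (e : F ≃L[ℝ] E) (a : F →L[ℝ] F) :
    (e : F →L[ℝ] E).adjoint ∘L ((e.symm : E →L[ℝ] F).adjoint ∘L a ∘L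
      (e.symm : E →L[ℝ] F)) ∘L (e : F →L[ℝ] E) = a := by
  have h1 : (e : F →L[ℝ] E).adjoint ∘L (e.symm : E →L[ℝ] F).adjoint =
      ContinuousLinearMap.id ℝ F := by
    rw [← ContinuousLinearMap.adjoint_comp, ContinuousLinearEquiv.coe_symm_comp_coe]
    exact ContinuousLinearMap.adjoint_id
  ext1 x
  have := congrArg (fun f : F →L[ℝ] F => f (a x)) h1
  simpa using this

/-- The isomorphism `ψ ↦ e* ψ e` from `B(E)_s` to `B(F)_s`, for an isomorphism `e : F → E`. -/
def symCongr (e : F ≃L[ℝ] E) : symOp E ≃L[ℝ] symOp F :=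
  ContinuousLinearEquiv.equivOfInverse (symCongrAux e) (symCongrAux e.symm)
    (fun ψ => Subtype.ext (adjoint_symm_comp e.symm ψ.1))
    (fun ψ => Subtype.ext (adjoint_symm_comp e ψ.1))

/-- Transport of symmetric Hilbert–Schmidt operators, `ψ ↦ e* ψ e`. -/
def symHSCongrAux (e : F ≃L[ℝ] E) : symHS E →L[ℝ] symHS F :=
  ContinuousLinearMap.codRestrict
    ((HS.compL F E F (e : F →L[ℝ] E).adjoint ∘L
      (HS.compR F E E).flip (e : F →L[ℝ] E)) ∘L (symHS E).subtypeL)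
    (symHS F) (fun ψ => (symCongrAux e (symHSIncl ψ)).2)

/-- The isomorphism `ψ ↦ e* ψ e` from `B₂(E)_s` to `B₂(F)_s`, for an isomorphism `e : F → E`. -/
def symHSCongr (e : F ≃L[ℝ] E) : symHS E ≃L[ℝ] symHS F :=
  ContinuousLinearEquiv.equivOfInverse (symHSCongrAux e) (symHSCongrAux e.symm)
    (fun ψ => Subtype.ext (HS.ext (adjoint_symm_comp e.symm (HS.toOp (ψ : HS E E)))))
    (fun ψ => Subtype.ext (HS.ext (adjoint_symm_comp e (HS.toOp (ψ : HS F F)))))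

theorem contDiff_symCongr (e : F ≃L[ℝ] E) : ContDiff ℝ ∞ (symCongr e) :=
  (show ContDiff ℝ ∞ (symCongrAux e) from ContinuousLinearMap.contDiff _)

theorem contDiff_symCongr_symm (e : F ≃L[ℝ] E) : ContDiff ℝ ∞ (symCongr e).symm :=
  (show ContDiff ℝ ∞ (symCongrAux e.symm) from ContinuousLinearMap.contDiff _)

theorem contDiff_symHSCongr (e : F ≃L[ℝ] E) : ContDiff ℝ ∞ (symHSCongr e) :=
  (show ContDiff ℝ ∞ (symHSCongrAux e) from ContinuousLinearMap.contDiff _)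

theorem contDiff_symHSCongr_symm (e : F ≃L[ℝ] E) : ContDiff ℝ ∞ (symHSCongr e).symm :=
  (show ContDiff ℝ ∞ (symHSCongrAux e.symm) from ContinuousLinearMap.contDiff _)

end SymmetricOperators

section Grassmannian

variable {H : Type*} [NormedAddCommGroup H] [InnerProductSpace ℝ H] [CompleteSpace H]

/-- The Lagrangian Grassmannian `Λ(H)`: the closed subspaces `L` with `J(L) = L^⊥`. -/
@[ext] structure Lagr (J : ComplexStructure H) where
  /-- The subspace `L`. -/
  carrier : Submodule ℝ H
  isClosed : IsClosed (carrier : Set H)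
  map_eq : carrier.map (J.op : H →ₗ[ℝ] H) = carrierᗮ

variable {J : ComplexStructure H}

theorem J_J (x : H) : J.op (J.op x) = -x := by
  have := congrArg (fun a : H →L[ℝ] H => a x) J.sq
  simpa using this

theorem inner_J (x y : H) : ⟪J.op x, y⟫_ℝ = -⟪x, J.op y⟫_ℝ := by
  have h : J.op.adjoint = -J.op := J.adj
  rw [← ContinuousLinearMap.adjoint_inner_right, h]; simp

theorem adjoint_J : J.op.adjoint = -J.op := J.adj

namespace Lagr

instance (L : Lagr J) : CompleteSpace L.carrier := L.isClosed.completeSpace_coe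

/-- The inclusion `L → H`. -/
def incl (L : Lagr J) : L.carrier →L[ℝ] H := L.carrier.subtypeL

/-- The orthogonal projection `π₀ : H → L`. -/
def proj (L : Lagr J) : H →L[ℝ] L.carrier := L.carrier.orthogonalProjectionOnto

/-- The orthogonal projection `π₁ : H → L^⊥`. -/
def projPerp (L : Lagr J) : H →L[ℝ] L.carrierᗮ := L.carrierᗮ.orthogonalProjectionOnto

/-- The orthogonal projection `P_L`, as an operator on `H`. -/
def P (L : Lagr J) : H →L[ℝ] H := L.carrier.starProjection

/-- The symmetry `ε_L = 2 P_L - 1`. -/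
def eps (L : Lagr J) : H →L[ℝ] H := (2 : ℝ) • L.P - 1

@[simp] theorem incl_apply (L : Lagr J) (l : L.carrier) : L.incl l = l := rfl

theorem proj_incl (L : Lagr J) (l : L.carrier) : L.proj l = l :=
  Submodule.orthogonalProjectionOnto_mem_subspace_eq_self l

theorem J_mem (L : Lagr J) {x : H} (hx : x ∈ L.carrier) : J.op x ∈ L.carrierᗮ := by
  rw [← L.map_eq]; exact Submodule.mem_map_of_mem hx

theorem J_mem_of_perp (L : Lagr J) {x : H} (hx : x ∈ L.carrierᗮ) : J.op x ∈ L.carrier := by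
  rw [← L.map_eq] at hx
  obtain ⟨l, hl, rfl⟩ := hx
  change J.op (J.op l) ∈ _
  rw [J_J]; exact neg_mem hl

theorem proj_perp (L : Lagr J) {x : H} (hx : x ∈ L.carrierᗮ) : L.proj x = 0 :=
  Submodule.orthogonalProjectionOnto_apply_of_mem_orthogonal hx

theorem proj_J (L : Lagr J) (l : L.carrier) : L.proj (J.op l) = 0 :=
  L.proj_perp (L.J_mem l.2)

theorem proj_of_mem (L : Lagr J) {x : H} (hx : x ∈ L.carrier) : (L.proj x : H) = x :=
  congrArg Subtype.val (L.proj_incl ⟨x, hx⟩)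

theorem add_proj (L : Lagr J) (x : H) : (L.proj x : H) + L.projPerp x = x :=
  L.carrier.starProjection_add_starProjection_orthogonal x

theorem adjoint_incl (L : Lagr J) : L.incl.adjoint = L.proj :=
  L.carrier.adjoint_subtypeL

theorem adjoint_proj (L : Lagr J) : L.proj.adjoint = L.incl :=
  L.carrier.adjoint_orthogonalProjectionOnto

end Lagr

/-- The action `g • L = g(L)` of the symplectic group. -/
instance : SMul (Sp J) (Lagr J) where
  smul g L :=
    { carrier := L.carrier.map (g.toOp : H →ₗ[ℝ] H)
      isClosed := by
        have : (L.carrier.map (g.toOp : H →ₗ[ℝ] H) : Set H) = g⁻¹.toOp ⁻¹' L.carrier := by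
          ext x
          constructor
          · rintro ⟨l, hl, rfl⟩
            change (g⁻¹.toOp * g.toOp) l ∈ L.carrier
            rw [g.inv_mul]; exact hl
          · intro hx
            refine ⟨_, hx, ?_⟩
            change (g.toOp * g⁻¹.toOp) x = x
            rw [g.mul_inv]; rfl
        rw [this]
        exact L.isClosed.preimage g⁻¹.toOp.continuous
      map_eq := by
        have key : ∀ l : H, g.toOp.adjoint (J.op (g.toOp l)) = J.op l := fun l =>
          congrArg (fun a : H →L[ℝ] H => a l) g.star_mul_mul
        have inj : ∀ x y : H, g.toOp.adjoint x = g.toOp.adjoint y → x = y := by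
          intro x y h
          have e : star g⁻¹.toOp * star g.toOp = 1 := by rw [← StarMul.star_mul, g.mul_inv, star_one]
          have e' : ∀ z : H, star g⁻¹.toOp (g.toOp.adjoint z) = z := fun z =>
            congrArg (fun a : H →L[ℝ] H => a z) e
          rw [← e' x, h, e']
        ext x
        constructor
        · rintro ⟨_, ⟨l, hl, rfl⟩, rfl⟩
          rw [Submodule.mem_orthogonal]
          rintro _ ⟨l', hl', rfl⟩
          change ⟪g.toOp l', J.op (g.toOp l)⟫_ℝ = 0
          rw [← ContinuousLinearMap.adjoint_inner_right, key]
          exact Submodule.inner_right_of_mem_orthogonal hl' (L.J_mem hl)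
        · intro hx
          have h1 : g.toOp.adjoint x ∈ L.carrierᗮ := by
            rw [Submodule.mem_orthogonal]
            intro l hl
            rw [ContinuousLinearMap.adjoint_inner_right]
            exact Submodule.inner_right_of_mem_orthogonal (Submodule.mem_map_of_mem hl) hx
          rw [← L.map_eq] at h1
          obtain ⟨l, hl, h2⟩ := h1
          refine ⟨g.toOp l, Submodule.mem_map_of_mem hl, inj _ _ ?_⟩
          exact (key l).trans h2 }

theorem smul_carrier (g : Sp J) (L : Lagr J) :
    (g • L).carrier = L.carrier.map (g.toOp : H →ₗ[ℝ] H) := rfl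

instance : MulAction (Sp J) (Lagr J) where
  one_smul L := Lagr.ext (by rw [smul_carrier]; exact Submodule.map_id _)
  mul_smul g h L := Lagr.ext (by
    simp only [smul_carrier]
    rw [← Submodule.map_comp]; rfl)

/-- The isomorphism `L → g(L)` induced by `g`. -/
def actEquiv (g : Sp J) (L : Lagr J) : L.carrier ≃L[ℝ] (g • L).carrier :=
  ContinuousLinearEquiv.equivOfInverse
    ((g.toOp ∘L L.incl).codRestrict _ fun l => Submodule.mem_map_of_mem l.2)
    ((g⁻¹.toOp ∘L (g • L).incl).codRestrict _ (by
      rintro ⟨_, l, hl, rfl⟩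
      change (g⁻¹.toOp * g.toOp) l ∈ L.carrier
      rw [g.inv_mul]; exact hl))
    (fun l => Subtype.ext (by
      change (g⁻¹.toOp * g.toOp) l = l
      rw [g.inv_mul]; rfl))
    (fun l => Subtype.ext (by
      change (g.toOp * g⁻¹.toOp) l = l
      rw [g.mul_inv]; rfl))

theorem incl_actEquiv (g : Sp J) (L : Lagr J) :
    (g • L).incl ∘L (actEquiv g L : L.carrier →L[ℝ] (g • L).carrier) = g.toOp ∘L L.incl := rfl

/-- The set `Ω(L^⊥) = {W ∈ Λ(H) : H = W ⊕ L^⊥}`. -/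
def Omega (L : Lagr J) : Set (Lagr J) := {W | IsCompl W.carrier L.carrierᗮ}

/-- The operator `T = π₁|_W ∘ (π₀|_W)⁻¹ : L → L^⊥`, with graph `W`, for `W ∈ Ω(L^⊥)`. -/
def graphOp (L W : Lagr J) : L.carrier →L[ℝ] L.carrierᗮ :=
  (L.projPerp ∘L W.incl) ∘L (L.proj ∘L W.incl).inverse

/-- The operator `φ_L(W) = J|_{L^⊥} T : L → L`. (The outer `π₀` only records that `J` maps `L^⊥`
into `L`.) -/
def phi (L W : Lagr J) : L.carrier →L[ℝ] L.carrier :=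
  (L.proj ∘L J.op ∘L L.carrierᗮ.subtypeL) ∘L graphOp L W

theorem mem_Omega_iff (L W : Lagr J) : W ∈ Omega L ↔ (L.proj ∘L W.incl).IsInvertible := by
  have hk : ∀ x : H, L.proj x = 0 ↔ x ∈ L.carrierᗮ := fun x => by
    refine ⟨fun h => ?_, L.proj_perp⟩
    rw [← L.add_proj x, h]; simp
  constructor
  · intro h
    have hinj : (L.proj ∘L W.incl).ker = ⊥ := by
      rw [Submodule.eq_bot_iff]
      intro w hw
      have : (w : H) ∈ L.carrierᗮ := (hk _).1 hw
      exact Subtype.ext (Submodule.disjoint_def.1 h.disjoint _ w.2 this)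
    have hsurj : (L.proj ∘L W.incl).range = ⊤ := by
      rw [Submodule.eq_top_iff']
      intro l
      have : (l : H) ∈ W.carrier ⊔ L.carrierᗮ := by rw [h.sup_eq_top]; trivial
      obtain ⟨w, hw, y, hy, e⟩ := Submodule.mem_sup.1 this
      refine ⟨⟨w, hw⟩, ?_⟩
      change L.proj w = l
      rw [← L.proj_incl l, ← e, map_add, L.proj_perp hy, add_zero]
    exact ⟨ContinuousLinearEquiv.ofBijective _ hinj hsurj,
      ContinuousLinearEquiv.coe_ofBijective _ hinj hsurj⟩
  · intro h
    refine ⟨Submodule.disjoint_def.2 fun x hx hx' => ?_, codisjoint_iff.2 ?_⟩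
    · have : (L.proj ∘L W.incl) ⟨x, hx⟩ = (L.proj ∘L W.incl) 0 := by
        rw [map_zero]; exact L.proj_perp hx'
      exact congrArg Subtype.val (h.injective this)
    · rw [Submodule.eq_top_iff']
      intro x
      obtain ⟨w, hw⟩ := h.surjective (L.proj x)
      refine Submodule.mem_sup.2 ⟨w, w.2, x - w, ?_, by abel⟩
      rw [← hk, map_sub, ← hw]
      exact sub_self _

theorem phi_eq (L W : Lagr J) :
    phi L W = (L.proj ∘L J.op ∘L W.incl) ∘L (L.proj ∘L W.incl).inverse := by
  ext l : 1
  set w : W.carrier := (L.proj ∘L W.incl).inverse l with hw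
  change L.proj (J.op (L.projPerp w)) = L.proj (J.op w)
  conv_rhs => rw [← L.add_proj w, map_add, map_add, L.proj_J, zero_add]

theorem smul_mem_Omega_iff (g : Sp J) (L M : Lagr J) :
    g • L ∈ Omega M ↔ (M.proj ∘L g.toOp ∘L L.incl).IsInvertible := by
  rw [mem_Omega_iff, ← incl_actEquiv, ← ContinuousLinearMap.comp_assoc,
    ContinuousLinearMap.isInvertible_comp_equiv]

theorem phi_smul (g : Sp J) (L M : Lagr J) :
    phi M (g • L) =
      (M.proj ∘L J.op ∘L g.toOp ∘L L.incl) ∘L (M.proj ∘L g.toOp ∘L L.incl).inverse := by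
  rw [phi_eq, ← incl_actEquiv, ← ContinuousLinearMap.comp_assoc M.proj (g • L).incl,
    ContinuousLinearMap.inverse_comp_equiv]
  ext l : 1
  simp

/-- The space `B(L)_s` of symmetric operators on `L`, with the operator norm. -/
abbrev SymB (L : Lagr J) : Type _ := symOp L.carrier

theorem SymB.inner_eq {L : Lagr J} (ψ : SymB L) (x y : L.carrier) :
    ⟪ψ.1 x, y⟫_ℝ = ⟪x, ψ.1 y⟫_ℝ := by
  have h : ψ.1.adjoint = ψ.1 := ψ.2
  conv_lhs => rw [← h]
  exact ContinuousLinearMap.adjoint_inner_left _ _ _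

theorem proj_J_incl (L : Lagr J) : L.proj ∘L J.op ∘L L.incl = 0 := by
  ext1 l; exact L.proj_J l

/-- The operator `ψ P_L` on `H`. -/
def extOp (L : Lagr J) (ψ : L.carrier →L[ℝ] L.carrier) : H →L[ℝ] H := L.incl ∘L ψ ∘L L.proj

theorem extOp_mul (L : Lagr J) (ψ χ : L.carrier →L[ℝ] L.carrier) :
    extOp L ψ * J.op * extOp L χ = 0 := by
  ext1 x
  change (ψ (L.proj (J.op (χ (L.proj x) : H))) : H) = 0
  rw [L.proj_J]; simp

theorem star_extOp (L : Lagr J) (ψ : SymB L) : star (extOp L ψ.1) = extOp L ψ.1 := by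
  have h : ψ.1.adjoint = ψ.1 := ψ.2
  rw [ContinuousLinearMap.star_eq_adjoint, extOp, ContinuousLinearMap.adjoint_comp,
    ContinuousLinearMap.adjoint_comp, h, L.adjoint_incl, L.adjoint_proj]
  rfl

/-- The symplectic operator `1 - J ψ P_L`; it maps `L` onto the graph of `-J|_L ψ`. -/
def shear (L : Lagr J) (ψ : SymB L) : Sp J :=
  ⟨⟨1 - J.op * extOp L ψ.1, 1 + J.op * extOp L ψ.1, by
      have h := extOp_mul L ψ.1 ψ.1
      have : (1 - J.op * extOp L ψ.1) * (1 + J.op * extOp L ψ.1) =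
        1 - J.op * (extOp L ψ.1 * J.op * extOp L ψ.1) := by noncomm_ring
      rw [this, h]; simp, by
      have h := extOp_mul L ψ.1 ψ.1
      have : (1 + J.op * extOp L ψ.1) * (1 - J.op * extOp L ψ.1) =
        1 - J.op * (extOp L ψ.1 * J.op * extOp L ψ.1) := by noncomm_ring
      rw [this, h]; simp⟩, by
    change star (1 - J.op * extOp L ψ.1) * J.op * (1 - J.op * extOp L ψ.1) = J.op
    rw [star_sub, star_one, StarMul.star_mul, star_extOp, J.adj]
    have : (1 - extOp L ψ.1 * -J.op) * J.op * (1 - J.op * extOp L ψ.1) =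
        J.op - J.op * J.op * extOp L ψ.1 + extOp L ψ.1 * (J.op * J.op)
        - extOp L ψ.1 * (J.op * J.op) * J.op * extOp L ψ.1 := by noncomm_ring
    rw [this, J.sq]
    have h2 : extOp L ψ.1 * (-1) * J.op * extOp L ψ.1 =
      -(extOp L ψ.1 * J.op * extOp L ψ.1) := by noncomm_ring
    rw [h2, extOp_mul]
    noncomm_ring⟩

theorem toOp_shear (L : Lagr J) (ψ : SymB L) : (shear L ψ).toOp = 1 - J.op * extOp L ψ.1 := rfl

theorem shear_incl (L : Lagr J) (ψ : SymB L) :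
    (shear L ψ).toOp ∘L L.incl = L.incl - J.op ∘L L.incl ∘L ψ.1 := by
  ext1 l
  change (l : H) - J.op (ψ.1 (L.proj l)) = l - J.op (ψ.1 l)
  rw [L.proj_incl]

/-- The Lagrangian subspace `Gr_{-J|_L ψ} = (1 - J ψ P_L)(L)`. -/
def graph (L : Lagr J) (ψ : SymB L) : Lagr J := shear L ψ • L

theorem mem_graph (L : Lagr J) (ψ : SymB L) (x : H) :
    x ∈ (graph L ψ).carrier ↔ ∃ l : L.carrier, (l : H) - J.op (ψ.1 l) = x := by
  have h : ∀ l : L.carrier, (shear L ψ).toOp l = l - J.op (ψ.1 l) := fun l =>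
    congrArg (fun a : L.carrier →L[ℝ] H => a l) (shear_incl L ψ)
  constructor
  · rintro ⟨l, hl, rfl⟩
    exact ⟨⟨l, hl⟩, (h ⟨l, hl⟩).symm⟩
  · rintro ⟨l, rfl⟩
    exact ⟨l, l.2, h l⟩

theorem proj_shear (L : Lagr J) (ψ : SymB L) :
    L.proj ∘L (shear L ψ).toOp ∘L L.incl = ContinuousLinearMap.id ℝ L.carrier := by
  ext1 l
  rw [shear_incl]
  change L.proj ((l : H) - J.op (ψ.1 l)) = l
  rw [map_sub, L.proj_incl, L.proj_J, sub_zero]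

theorem graph_mem_Omega (L : Lagr J) (ψ : SymB L) : graph L ψ ∈ Omega L := by
  rw [graph, smul_mem_Omega_iff, proj_shear]
  exact ⟨ContinuousLinearEquiv.refl ℝ _, rfl⟩

theorem phi_graph (L : Lagr J) (ψ : SymB L) : phi L (graph L ψ) = ψ.1 := by
  rw [graph, phi_smul, proj_shear, ContinuousLinearMap.inverse_id, shear_incl]
  ext1 l
  change L.proj (J.op ((l : H) - J.op (ψ.1 l))) = ψ.1 l
  rw [map_sub, map_sub, L.proj_J, J_J, map_neg, L.proj_incl]; simp

theorem phi_proj {L W : Lagr J} (h : W ∈ Omega L) (w : W.carrier) :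
    (phi L W (L.proj w) : H) = J.op (L.projPerp w) := by
  have h1 : (L.proj ∘L W.incl).inverse (L.proj w) = w :=
    ((mem_Omega_iff L W).1 h).inverse_apply_self w
  change (L.proj (J.op (L.projPerp ((L.proj ∘L W.incl).inverse (L.proj w) : W.carrier))) : H) = _
  rw [h1]
  exact L.proj_of_mem (L.J_mem_of_perp (L.projPerp _).2)

theorem exists_proj {L W : Lagr J} (h : W ∈ Omega L) (l : L.carrier) :
    ∃ w : W.carrier, L.proj w = l := ((mem_Omega_iff L W).1 h).surjective l

theorem phi_mem (L W : Lagr J) : phi L W ∈ symOp L.carrier := by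
  by_cases h : W ∈ Omega L
  · change (phi L W).adjoint = phi L W
    symm
    rw [ContinuousLinearMap.eq_adjoint_iff]
    intro l l'
    obtain ⟨w, rfl⟩ := exists_proj h l
    obtain ⟨w', rfl⟩ := exists_proj h l'
    rw [Submodule.coe_inner, Submodule.coe_inner, phi_proj h, phi_proj h]
    have h0 : ⟪J.op w, (w' : H)⟫_ℝ = 0 :=
      Submodule.inner_left_of_mem_orthogonal w'.2 (W.J_mem w.2)
    rw [← L.add_proj w, ← L.add_proj w', map_add, inner_add_left, inner_add_right,
      inner_add_right] at h0
    have e1 : ⟪J.op (L.proj w), (L.proj w' : H)⟫_ℝ = 0 :=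
      Submodule.inner_left_of_mem_orthogonal (L.proj w').2 (L.J_mem (L.proj w).2)
    have e2 : ⟪J.op (L.projPerp w), (L.projPerp w' : H)⟫_ℝ = 0 :=
      Submodule.inner_right_of_mem_orthogonal (L.J_mem_of_perp (L.projPerp w).2) (L.projPerp w').2
    have e3 := inner_J (J := J) (L.proj w : H) (L.projPerp w')
    linarith
  · rw [mem_Omega_iff] at h
    rw [phi_eq, ContinuousLinearMap.inverse_of_not_isInvertible h, ContinuousLinearMap.comp_zero]
    exact zero_mem _

/-- The chart map `φ_L`, with values in `B(L)_s`. -/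
def phiSym (L W : Lagr J) : SymB L := ⟨phi L W, phi_mem L W⟩

theorem graph_phiSym {L W : Lagr J} (h : W ∈ Omega L) : graph L (phiSym L W) = W := by
  have key : ∀ w : W.carrier,
      (L.proj w : H) - J.op ((phiSym L W).1 (L.proj w)) = w := fun w => by
    change (L.proj w : H) - J.op (phi L W (L.proj w)) = w
    rw [phi_proj h, J_J, sub_neg_eq_add, L.add_proj]
  ext x
  rw [mem_graph]
  constructor
  · rintro ⟨l, rfl⟩
    obtain ⟨w, rfl⟩ := exists_proj h l
    rw [key]; exact w.2
  · intro hx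
    exact ⟨L.proj x, key ⟨x, hx⟩⟩

/-- The operator `l ↦ l - J ψ l` from `L` onto `Gr_{-J|_L ψ}`. -/
def graphMap (L : Lagr J) (ψ : L.carrier →L[ℝ] L.carrier) : L.carrier →L[ℝ] H :=
  L.incl - J.op ∘L L.incl ∘L ψ

theorem graph_mem_Omega_iff (L M : Lagr J) (ψ : SymB L) :
    graph L ψ ∈ Omega M ↔ (M.proj ∘L graphMap L ψ.1).IsInvertible := by
  rw [graph, smul_mem_Omega_iff, shear_incl]; rfl

theorem phi_graph' (L M : Lagr J) (ψ : SymB L) :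
    phi M (graph L ψ) =
      (M.proj ∘L J.op ∘L graphMap L ψ.1) ∘L (M.proj ∘L graphMap L ψ.1).inverse := by
  rw [graph, phi_smul, shear_incl]; rfl

theorem contDiff_graphMap (L : Lagr J) : ContDiff ℝ ∞ (graphMap L) := by
  unfold graphMap; fun_prop

theorem isOpen_isInvertible {E F : Type*} [NormedAddCommGroup E] [NormedSpace ℝ E]
    [CompleteSpace E] [NormedAddCommGroup F] [NormedSpace ℝ F] :
    IsOpen {f : E →L[ℝ] F | f.IsInvertible} := ContinuousLinearEquiv.isOpen

theorem contDiffOn_inverse {X E F : Type*} [NormedAddCommGroup E] [NormedSpace ℝ E]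
    [CompleteSpace E] [NormedAddCommGroup F] [NormedSpace ℝ F] [NormedAddCommGroup X]
    [NormedSpace ℝ X] {f : X → (E →L[ℝ] F)} {s : Set X} {n : WithTop ℕ∞}
    (hf : ContDiffOn ℝ n f s) (h : ∀ x ∈ s, (f x).IsInvertible) :
    ContDiffOn ℝ n (fun x => (f x).inverse) s := fun x hx =>
  (h x hx).contDiffAt_map_inverse.comp_contDiffWithinAt x (hf x hx)

variable (J) in
/-- The topology of `Λ(H)` defined by the atlas `φ_L`: a set is open if and only if its image in
each chart is open. -/
instance : TopologicalSpace (Lagr J) :=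
  ⨆ L : Lagr J, TopologicalSpace.coinduced (graph L) inferInstance

theorem isOpen_Lagr {s : Set (Lagr J)} :
    IsOpen s ↔ ∀ L : Lagr J, IsOpen (graph L ⁻¹' s) := by
  rw [isOpen_iSup_iff]; rfl

theorem isOpen_trans (L M : Lagr J) : IsOpen {ψ : SymB L | graph L ψ ∈ Omega M} := by
  simp only [graph_mem_Omega_iff]
  exact isOpen_isInvertible.preimage (continuous_const.clm_comp
    ((contDiff_graphMap L).continuous.comp contDiff_symOp_coe.continuous))

theorem contDiffOn_trans (L M : Lagr J) :
    ContDiffOn ℝ ∞ (fun ψ : SymB L => phiSym M (graph L ψ)) {ψ | graph L ψ ∈ Omega M} := by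
  refine contDiffOn_of_retract (symProj M.carrier) symProj_coe ?_
  change ContDiffOn ℝ ∞ (fun ψ : SymB L => phi M (graph L ψ)) _
  simp only [phi_graph', graph_mem_Omega_iff]
  have h := (contDiff_graphMap L).comp contDiff_symOp_coe
  refine ContDiffOn.clm_comp ?_ (contDiffOn_inverse ?_ fun ψ hψ => hψ)
  · exact (contDiff_const.clm_comp (contDiff_const.clm_comp h)).contDiffOn
  · exact (contDiff_const.clm_comp h).contDiffOn

/-- The chart `φ_L : Ω(L^⊥) → B(L)_s`, with inverse `ψ ↦ Gr_{-J|_L ψ}`. -/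
def phiChart (L : Lagr J) : OpenPartialHomeomorph (Lagr J) (SymB L) where
  toFun := phiSym L
  invFun := graph L
  source := Omega L
  target := Set.univ
  map_source' _ _ := Set.mem_univ _
  map_target' ψ _ := graph_mem_Omega L ψ
  left_inv' _ h := graph_phiSym h
  right_inv' ψ _ := Subtype.ext (phi_graph L ψ)
  open_source := isOpen_Lagr.2 fun M => isOpen_trans M L
  open_target := isOpen_univ
  continuousOn_toFun := by
    have hΩ : IsOpen (Omega L) := isOpen_Lagr.2 fun M => isOpen_trans M L
    rw [continuousOn_open_iff hΩ]
    intro t ht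
    exact isOpen_Lagr.2 fun M =>
      (contDiffOn_trans M L).continuousOn.isOpen_inter_preimage (isOpen_trans M L) ht
  continuousOn_invFun := by
    rw [continuousOn_univ, continuous_def]
    exact fun s hs => isOpen_Lagr.1 hs L

/-- The chart `φ_L`, with its model space `B(L)_s` identified with `B(L₀)_s` by an isomorphism
`e : L₀ → L`: `W ↦ e* φ_L(W) e`. -/
def lagrChart {L₀ : Lagr J} (L : Lagr J) (e : L₀.carrier ≃L[ℝ] L.carrier) :
    OpenPartialHomeomorph (Lagr J) (SymB L₀) :=
  (phiChart L).trans (symCongr e).toHomeomorph.toOpenPartialHomeomorph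

end Grassmannian

section Existence

variable {H : Type*} [NormedAddCommGroup H] [InnerProductSpace ℝ H] [CompleteSpace H]
  {J : ComplexStructure H}

theorem eq_zero_of_inner_basis {E κ : Type*} [NormedAddCommGroup E] [InnerProductSpace ℝ E]
    [CompleteSpace E] (c : HilbertBasis κ ℝ E) {y : E} (h : ∀ k, ⟪c k, y⟫_ℝ = 0) : y = 0 := by
  have := tsum_enorm_inner_sq c y
  rw [eq_comm] at this
  simpa [h] using this

theorem mk_basis_le {ι κ : Type _} {L M : Lagr J} (b : HilbertBasis ι ℝ L.carrier)
    (c : HilbertBasis κ ℝ M.carrier) [Infinite κ] :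
    Cardinal.mk ι ≤ Cardinal.mk κ := by
  have hb : Orthonormal ℝ (fun i => (b i : H)) :=
    b.orthonormal.comp_linearIsometry L.carrier.subtypeₗᵢ
  let S : κ → Set ι := fun k =>
    Function.support (fun i => ‖⟪(b i : H), (c k : H)⟫_ℝ‖ ^ 2) ∪
      Function.support (fun i => ‖⟪(b i : H), J.op (c k)⟫_ℝ‖ ^ 2)
  have hS : ∀ k, (S k).Countable := fun k =>
    (hb.inner_products_summable _).countable_support.union
      (hb.inner_products_summable _).countable_support
  have hU : (⋃ k, S k) = Set.univ := by
    rw [Set.eq_univ_iff_forall]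
    intro i
    by_contra hi
    simp only [Set.mem_iUnion, S, Set.mem_union, Function.mem_support, not_exists, not_or,
      ne_eq, not_not, pow_eq_zero_iff, norm_eq_zero, two_ne_zero, not_false_eq_true] at hi
    have h1 : M.proj (b i : H) = 0 := by
      refine eq_zero_of_inner_basis c fun k => ?_
      have : ⟪M.incl (c k), (b i : H)⟫_ℝ = 0 := by rw [real_inner_comm]; exact (hi k).1
      rwa [← M.adjoint_incl, ContinuousLinearMap.adjoint_inner_right]
    have h2 : M.proj (J.op (b i : H)) = 0 := by
      refine eq_zero_of_inner_basis c fun k => ?_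
      rw [← M.adjoint_incl, ContinuousLinearMap.adjoint_inner_right, real_inner_comm, inner_J]
      rw [neg_eq_zero]; exact (hi k).2
    have h3 : (b i : H) ∈ M.carrierᗮ := by
      rw [← M.add_proj (b i : H), h1]; simp
    have h4 := M.proj_of_mem (M.J_mem_of_perp h3)
    rw [h2] at h4
    have h5 := J_J (J := J) (b i : H)
    rw [← h4] at h5
    have h6 : (b i : H) = 0 := by simpa using h5.symm
    exact hb.ne_zero i h6
  calc Cardinal.mk ι = Cardinal.mk (⋃ k, S k : Set ι) := by rw [hU, Cardinal.mk_univ]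
    _ ≤ Cardinal.mk κ * ⨆ k, Cardinal.mk (S k) := Cardinal.mk_iUnion_le S
    _ ≤ Cardinal.mk κ * Cardinal.aleph0 := by
      gcongr
      exact ciSup_le' fun k => (Cardinal.le_aleph0_iff_set_countable).2 (hS k)
    _ = Cardinal.mk κ := Cardinal.mul_aleph0_eq (Cardinal.aleph0_le_mk κ)

theorem finiteDimensional_of_Lagr (L : Lagr J) [FiniteDimensional ℝ L.carrier] :
    FiniteDimensional ℝ H := by
  have h1 : FiniteDimensional ℝ L.carrierᗮ := by
    rw [← L.map_eq]; infer_instance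
  have h2 : L.carrier ⊔ L.carrierᗮ = ⊤ := Submodule.sup_orthogonal_of_hasOrthogonalProjection
  have h3 : FiniteDimensional ℝ (⊤ : Submodule ℝ H) := by rw [← h2]; infer_instance
  exact Module.Finite.of_surjective (⊤ : Submodule ℝ H).subtype fun x => ⟨⟨x, trivial⟩, rfl⟩

/-- Any two Lagrangian subspaces are isomorphic. -/
theorem nonempty_equiv (L M : Lagr J) : Nonempty (L.carrier ≃L[ℝ] M.carrier) := by
  by_cases hfin : FiniteDimensional ℝ H
  · have key : ∀ N : Lagr J, Module.finrank ℝ N.carrier + Module.finrank ℝ N.carrier =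
        Module.finrank ℝ H := fun N => by
      have hJ : Function.Injective (J.op : H →ₗ[ℝ] H) := fun x y h => by
        have h' : J.op x = J.op y := h
        have := congrArg J.op h'
        rw [J_J, J_J] at this
        exact neg_injective this
      have e := (Submodule.equivMapOfInjective _ hJ N.carrier).finrank_eq
      rw [N.map_eq] at e
      conv_lhs => rhs; rw [e]
      exact N.carrier.finrank_add_finrank_orthogonal
    exact ⟨ContinuousLinearEquiv.ofFinrankEq (by have := key L; have := key M; omega)⟩
  · have inf : ∀ (N : Lagr J), Infinite (basisIndex N.carrier) := fun N => by
      by_contra h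
      rw [not_infinite_iff_finite] at h
      have := Fintype.ofFinite (basisIndex N.carrier)
      have : FiniteDimensional ℝ N.carrier :=
        (basis N.carrier).toOrthonormalBasis.toBasis.finiteDimensional_of_finite
      exact hfin (finiteDimensional_of_Lagr N)
    have := inf L
    have := inf M
    obtain ⟨e⟩ := Cardinal.eq.1 (le_antisymm (mk_basis_le (basis L.carrier) (basis M.carrier))
      (mk_basis_le (basis M.carrier) (basis L.carrier)))
    let b := basis L.carrier
    let b' : HilbertBasis (basisIndex M.carrier) ℝ L.carrier :=
      HilbertBasis.mk (b.orthonormal.comp e.symm e.symm.injective) (by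
        have : Set.range (b ∘ e.symm) = Set.range b := e.symm.surjective.range_comp b
        rw [this]
        exact b.dense_span.ge)
    exact ⟨(b'.repr.trans (basis M.carrier).repr.symm).toContinuousLinearEquiv⟩

end Existence

section LagrManifold

variable {H : Type*} [NormedAddCommGroup H] [InnerProductSpace ℝ H] [CompleteSpace H]
  {J : ComplexStructure H} {L₀ : Lagr J}

theorem mem_Omega_self (L : Lagr J) : L ∈ Omega L :=
  Submodule.isCompl_orthogonal L.carrier

/-- The Banach manifold structure of `Λ(H)` given by the atlas of all charts `φ_L`. Their model
spaces `B(L)_s` are identified with `B(L₀)_s` by all possible isomorphisms `e : L₀ → L`. -/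
instance : ChartedSpace (SymB L₀) (Lagr J) where
  atlas := {c | ∃ (L : Lagr J) (e : L₀.carrier ≃L[ℝ] L.carrier), c = lagrChart L e}
  chartAt L := lagrChart L (nonempty_equiv L₀ L).some
  mem_chart_source L := by
    simp only [lagrChart, mfld_simps]
    exact mem_Omega_self L
  chart_mem_atlas L := ⟨L, _, rfl⟩

instance : IsManifold 𝓘(ℝ, SymB L₀) ∞ (Lagr J) := by
  refine isManifold_of_contDiffOn _ _ _ ?_
  rintro _ _ ⟨L, e, rfl⟩ ⟨M, e', rfl⟩
  simp only [modelWithCornersSelf_coe, modelWithCornersSelf_coe_symm, Set.preimage_id,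
    Set.range_id, Set.inter_univ, Function.comp_id, Function.id_comp]
  refine ((contDiff_symCongr e').comp_contDiffOn
    ((contDiffOn_trans L M).comp (contDiff_symCongr_symm e).contDiffOn ?_))
  intro ψ hψ
  simp only [lagrChart, mfld_simps] at hψ
  exact hψ.2

end LagrManifold

section RestrictedGrassmannian

variable {H : Type*} [NormedAddCommGroup H] [InnerProductSpace ℝ H] [CompleteSpace H]
  {J : ComplexStructure H}

/-- The restricted symplectic group acts on `Λ(H)` by `g • L = g(L)`. -/
instance : MulAction (Sp2 J) (Lagr J) := MulAction.compHom _ Sp2.toSp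

theorem sp2_smul_def (g : Sp2 J) (L : Lagr J) : g • L = g.toSp • L := rfl

/-- The orbit `O_{L₀} = {g(L₀) : g ∈ Sp₂(H)} ⊆ Λ(H)`, as a type of its own (it does not carry the
topology induced by `Λ(H)`). -/
def Orbit (L₀ : Lagr J) : Type _ := MulAction.orbit (Sp2 J) L₀

namespace Orbit

variable {L₀ : Lagr J}

/-- The inclusion `O_{L₀} → Λ(H)`. -/
def toLagr (L : Orbit L₀) : Lagr J := Subtype.val (p := (· ∈ MulAction.orbit (Sp2 J) L₀)) L

theorem toLagr_injective : Function.Injective (toLagr : Orbit L₀ → Lagr J) :=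
  Subtype.val_injective

theorem exists_smul (L : Orbit L₀) : ∃ g : Sp2 J, g • L₀ = L.toLagr :=
  Subtype.property (p := (· ∈ MulAction.orbit (Sp2 J) L₀)) L

/-- The element of `O_{L₀}` given by a Lagrangian subspace of the form `g(L₀)`. -/
def mk (L : Lagr J) (h : ∃ g : Sp2 J, g • L₀ = L) : Orbit L₀ := ⟨L, h⟩

@[simp] theorem toLagr_mk (L : Lagr J) (h : ∃ g : Sp2 J, g • L₀ = L) : (mk L h).toLagr = L := rfl

/-- The action of `Sp₂(H)` on `O_{L₀}`. -/
instance : MulAction (Sp2 J) (Orbit L₀) :=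
  inferInstanceAs (MulAction (Sp2 J) (MulAction.orbit (Sp2 J) L₀))

@[simp] theorem toLagr_smul (g : Sp2 J) (L : Orbit L₀) : (g • L).toLagr = g • L.toLagr := rfl

variable (L₀) in
/-- The base point `L₀ ∈ O_{L₀}`. -/
def base : Orbit L₀ := mk L₀ ⟨1, one_smul _ _⟩

@[simp] theorem toLagr_base : (base L₀).toLagr = L₀ := rfl

theorem exists_smul' (L M : Orbit L₀) : ∃ g : Sp2 J, g • M.toLagr = L.toLagr := by
  obtain ⟨g, hg⟩ := L.exists_smul
  obtain ⟨h, hh⟩ := M.exists_smul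
  exact ⟨g * h⁻¹, by rw [← hg, ← hh, mul_smul, inv_smul_smul]⟩

/-- For `W = g(M)` with `g ∈ Sp₂(H)`, the operator `π₀ J|_W` is Hilbert–Schmidt, where `π₀` is the
projection onto `M`. -/
theorem proj_J_incl_mem (M W : Orbit L₀) :
    M.toLagr.proj ∘L J.op ∘L W.toLagr.incl ∈ hsSubmodule W.toLagr.carrier M.toLagr.carrier := by
  obtain ⟨g, hg⟩ := M.exists_smul' W
  have hk := mem_hs_comp (comp_mem_hs (M.toLagr.proj ∘L J.op)
    (neg_mem (HS.toOp_mem g.toHS))) W.toLagr.incl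
  convert! hk using 1
  ext1 w
  have hw : g.toSp.toOp w ∈ M.toLagr.carrier := by
    rw [← hg]; exact Submodule.mem_map_of_mem w.2
  have h0 := M.toLagr.proj_J ⟨_, hw⟩
  change M.toLagr.proj (J.op w) = M.toLagr.proj (J.op (-(g.toSp.toOp w - (w : H))))
  rw [neg_sub, map_sub, map_sub, h0, sub_zero]

/-- The Hilbert–Schmidt operator `π₀ J|_W`. -/
def offDiag (M W : Orbit L₀) : HS W.toLagr.carrier M.toLagr.carrier :=
  HS.mk _ (proj_J_incl_mem M W)

theorem phi_mem_hs (L W : Orbit L₀) :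
    phi L.toLagr W.toLagr ∈ hsSubmodule L.toLagr.carrier L.toLagr.carrier := by
  rw [phi_eq]
  exact mem_hs_comp (proj_J_incl_mem L W) _

end Orbit

/-- The space `B₂(L)_s` of symmetric Hilbert–Schmidt operators on `L`, with the `2`-norm. -/
abbrev SymHS (L : Lagr J) : Type _ := symHS L.carrier

variable {L₀ : Lagr J}

/-- The chart map `φ_L` on `O_{L₀}`, with values in `B₂(L)_s`. -/
def phiSymHS (L W : Orbit L₀) : SymHS L.toLagr :=
  ⟨HS.mk (phi L.toLagr W.toLagr) (Orbit.phi_mem_hs L W), phi_mem _ _⟩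

theorem symHSIncl_phiSymHS (L W : Orbit L₀) :
    symHSIncl (phiSymHS L W) = phiSym L.toLagr W.toLagr := rfl

theorem shear_sub_one_mem (L : Lagr J) (χ : HS L.carrier L.carrier) :
    (1 - J.op * extOp L (HS.toOp χ)) - 1 ∈ hsSubmodule H H := by
  have e : (1 - J.op * extOp L (HS.toOp χ)) - 1 = -((J.op ∘L L.incl ∘L HS.toOp χ) ∘L L.proj) := by
    rw [sub_sub_cancel_left]; rfl
  rw [e]
  exact neg_mem (mem_hs_comp (comp_mem_hs J.op (comp_mem_hs L.incl (HS.toOp_mem χ))) L.proj)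

/-- For `ψ ∈ B₂(L)_s`, the symplectic operator `1 - J ψ P_L` belongs to `Sp₂(H)`. -/
def shear2 (L : Lagr J) (ψ : SymHS L) : Sp2 J :=
  ⟨shear L (symHSIncl ψ), shear_sub_one_mem L (ψ : HS L.carrier L.carrier)⟩

/-- The subspace `Gr_{-J|_L ψ} ∈ O_{L₀}`, for `L ∈ O_{L₀}` and `ψ ∈ B₂(L)_s`. -/
def graph2 (L : Orbit L₀) (ψ : SymHS L.toLagr) : Orbit L₀ := shear2 L.toLagr ψ • L

theorem toLagr_graph2 (L : Orbit L₀) (ψ : SymHS L.toLagr) :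
    (graph2 L ψ).toLagr = graph L.toLagr (symHSIncl ψ) := rfl

/-- The set `Ω(L^⊥) ∩ O_{L₀}`. -/
def Omega2 (L : Orbit L₀) : Set (Orbit L₀) := {W | W.toLagr ∈ Omega L.toLagr}

variable (L₀) in
/-- The topology of `O_{L₀}` defined by the atlas of the restricted charts: a set is open if and
only if its image in each chart is open. -/
instance : TopologicalSpace (Orbit L₀) :=
  ⨆ L : Orbit L₀, TopologicalSpace.coinduced (graph2 L) inferInstance

theorem isOpen_Orbit {s : Set (Orbit L₀)} :
    IsOpen s ↔ ∀ L : Orbit L₀, IsOpen (graph2 L ⁻¹' s) := by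
  rw [isOpen_iSup_iff]; rfl

theorem graph2_mem_Omega2_iff (L M : Orbit L₀) (ψ : SymHS L.toLagr) :
    graph2 L ψ ∈ Omega2 M ↔
      (M.toLagr.proj ∘L graphMap L.toLagr (HS.toOp (ψ : HS _ _))).IsInvertible :=
  graph_mem_Omega_iff L.toLagr M.toLagr (symHSIncl ψ)

theorem contDiff_graphMap2 (L : Orbit L₀) :
    ContDiff ℝ ∞ (fun ψ : SymHS L.toLagr => graphMap L.toLagr (HS.toOp (ψ : HS _ _))) :=
  (contDiff_graphMap L.toLagr).comp contDiff_symHSIncl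

theorem isOpen_trans2 (L M : Orbit L₀) :
    IsOpen {ψ : SymHS L.toLagr | graph2 L ψ ∈ Omega2 M} := by
  simp only [graph2_mem_Omega2_iff]
  exact isOpen_isInvertible.preimage (continuous_const.clm_comp
    (contDiff_graphMap2 L).continuous)

theorem phiSymHS_graph2 (L M : Orbit L₀) (ψ : SymHS L.toLagr) :
    (phiSymHS M (graph2 L ψ) : HS _ _) = HS.compR _ _ _
      (Orbit.offDiag M L + HS.compL _ _ _ (M.toLagr.proj ∘L L.toLagr.incl) (ψ : HS _ _))
      (M.toLagr.proj ∘L graphMap L.toLagr (HS.toOp (ψ : HS _ _))).inverse := by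
  ext1
  have h := phi_graph' L.toLagr M.toLagr (symHSIncl ψ)
  refine h.trans ?_
  have e : M.toLagr.proj ∘L J.op ∘L graphMap L.toLagr (symHSIncl ψ).1 =
      M.toLagr.proj ∘L J.op ∘L L.toLagr.incl +
        (M.toLagr.proj ∘L L.toLagr.incl) ∘L HS.toOp (ψ : HS _ _) := by
    ext1 l
    change M.toLagr.proj (J.op ((l : H) - J.op ((symHSIncl ψ).1 l))) =
      M.toLagr.proj (J.op l) + M.toLagr.proj ((symHSIncl ψ).1 l)
    rw [map_sub, J_J, sub_neg_eq_add, map_add]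
  rw [e]
  rfl

theorem contDiffOn_trans2 (L M : Orbit L₀) :
    ContDiffOn ℝ ∞ (fun ψ : SymHS L.toLagr => phiSymHS M (graph2 L ψ))
      {ψ | graph2 L ψ ∈ Omega2 M} := by
  refine contDiffOn_of_retract (symHSProj M.toLagr.carrier) symHSProj_coe ?_
  simp only [phiSymHS_graph2, graph2_mem_Omega2_iff]
  refine HS.contDiffOn_compR ?_ (contDiffOn_inverse ?_ fun ψ hψ => hψ)
  · exact (contDiff_const.add (contDiff_const.clm_apply contDiff_symHS_coe)).contDiffOn
  · exact (contDiff_const.clm_comp (contDiff_graphMap2 L)).contDiffOn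

/-- The restricted chart `φ_L : Ω(L^⊥) ∩ O_{L₀} → B₂(L)_s`. -/
def phiChart2 (L : Orbit L₀) : OpenPartialHomeomorph (Orbit L₀) (SymHS L.toLagr) where
  toFun := phiSymHS L
  invFun := graph2 L
  source := Omega2 L
  target := Set.univ
  map_source' _ _ := Set.mem_univ _
  map_target' ψ _ := graph_mem_Omega L.toLagr (symHSIncl ψ)
  left_inv' _ h := Orbit.toLagr_injective (graph_phiSym h)
  right_inv' ψ _ := Subtype.ext (HS.ext (phi_graph L.toLagr (symHSIncl ψ)))
  open_source := isOpen_Orbit.2 fun M => isOpen_trans2 M L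
  open_target := isOpen_univ
  continuousOn_toFun := by
    have hΩ : IsOpen (Omega2 L) := isOpen_Orbit.2 fun M => isOpen_trans2 M L
    rw [continuousOn_open_iff hΩ]
    intro t ht
    exact isOpen_Orbit.2 fun M =>
      (contDiffOn_trans2 M L).continuousOn.isOpen_inter_preimage (isOpen_trans2 M L) ht
  continuousOn_invFun := by
    rw [continuousOn_univ, continuous_def]
    exact fun s hs => isOpen_Orbit.1 hs L

/-- The chart `φ_L` of `O_{L₀}`, with its model space `B₂(L)_s` identified with `B₂(L₀)_s` by an
isomorphism `e : L₀ → L`: `W ↦ e* φ_L(W) e`. -/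
def orbitChart (L : Orbit L₀) (e : L₀.carrier ≃L[ℝ] L.toLagr.carrier) :
    OpenPartialHomeomorph (Orbit L₀) (SymHS L₀) :=
  (phiChart2 L).trans (symHSCongr e).toHomeomorph.toOpenPartialHomeomorph

/-- The manifold structure of `O_{L₀}` given by the atlas of all restricted charts `φ_L`. Their
model spaces `B₂(L)_s` are identified with `B₂(L₀)_s` by all possible isomorphisms `L₀ → L`. -/
instance : ChartedSpace (SymHS L₀) (Orbit L₀) where
  atlas := {c | ∃ (L : Orbit L₀) (e : L₀.carrier ≃L[ℝ] L.toLagr.carrier), c = orbitChart L e}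
  chartAt L := orbitChart L (nonempty_equiv L₀ L.toLagr).some
  mem_chart_source L := by
    simp only [orbitChart, mfld_simps]
    exact mem_Omega_self L.toLagr
  chart_mem_atlas L := ⟨L, _, rfl⟩

instance : IsManifold 𝓘(ℝ, SymHS L₀) ∞ (Orbit L₀) := by
  refine isManifold_of_contDiffOn _ _ _ ?_
  rintro _ _ ⟨L, e, rfl⟩ ⟨M, e', rfl⟩
  simp only [modelWithCornersSelf_coe, modelWithCornersSelf_coe_symm, Set.preimage_id,
    Set.range_id, Set.inter_univ, Function.comp_id, Function.id_comp]
  refine ((contDiff_symHSCongr e').comp_contDiffOn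
    ((contDiffOn_trans2 L M).comp (contDiff_symHSCongr_symm e).contDiffOn ?_))
  intro ψ hψ
  simp only [orbitChart, mfld_simps] at hψ
  exact hψ.2

end RestrictedGrassmannian

section Statements

/-- A smooth map between Banach manifolds is a submersion if its tangent map at each point is onto
and has a complemented kernel. -/
def IsSmoothSubmersion {E F M N : Type*} [NormedAddCommGroup E] [NormedSpace ℝ E]
    [NormedAddCommGroup F] [NormedSpace ℝ F] [TopologicalSpace M] [ChartedSpace E M]
    [TopologicalSpace N] [ChartedSpace F N] (f : M → N) : Prop :=
  ContMDiff 𝓘(ℝ, E) 𝓘(ℝ, F) ∞ f ∧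
    ∀ x : M, Function.Surjective (mfderiv 𝓘(ℝ, E) 𝓘(ℝ, F) f x) ∧
      (mfderiv 𝓘(ℝ, E) 𝓘(ℝ, F) f x).ker.ClosedComplemented

variable {H : Type*} [NormedAddCommGroup H] [InnerProductSpace ℝ H] [CompleteSpace H]

/-- `u` is the unitary part of `g`: `g = u |g|`, where `u` is unitary and `|g| = (g* g)^(1/2)` is
the positive square root of `g* g`. -/
def IsUnitaryPart (g u : H →L[ℝ] H) : Prop :=
  u ∈ unitary (H →L[ℝ] H) ∧ ∃ p : H →L[ℝ] H, p.IsPositive ∧ p * p = star g * g ∧ g = u * p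

variable (J : ComplexStructure H)

/-- The unitary group `U(H_J)`: the unitary operators that commute with `J`. -/
def UJ : Set (H →L[ℝ] H) := {u | u ∈ unitary (H →L[ℝ] H) ∧ u * J.op = J.op * u}

/-- The restricted unitary group `U₂(H_J) = {u ∈ U(H_J) : u - 1 ∈ B₂(H)}`. -/
def U2J : Set (H →L[ℝ] H) := {u | u ∈ UJ J ∧ u - 1 ∈ hsSubmodule H H}

variable {J}

/-- The operator `g_L = (1 + ε_L ε_{L₀}) / 2`. -/
def gOp (L₀ L : Lagr J) : H →L[ℝ] H := (1 / 2 : ℝ) • (1 + L.eps * L₀.eps)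

/-- The orbit map `π_L : Sp(H) → Λ(H)`, `g ↦ g(L)`. -/
def orbitMap (L : Lagr J) (g : Sp J) : Lagr J := g • L

/-- The restricted orbit map `π_L : Sp₂(H) → O_{L₀}`, `g ↦ g(L)`, for `L ∈ O_{L₀}`. -/
def orbitMap2 {L₀ : Lagr J} (L : Orbit L₀) (g : Sp2 J) : Orbit L₀ := g • L

end Statements

end SympLagr

end

open SympLagr
open scoped Manifold ContDiff

open scoped Topology

noncomputable section

namespace SympLagr

/-! ### Submersions via local sections; square roots near the identity of a Banach algebra -/

section General

/-! Smoothness and submersion. Near `g₀`, in the chart `φ_N` at `N = g₀(M)`, the orbit map `g ↦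
g(M)` is given by `phi_smul`: `(π_N J g|_M)(π_N g|_M)⁻¹`. This is rational in the operator `g`,
hence smooth, because `Sp(H) → B(H)` is smooth. For `Sp₂(H)` the numerator equals `π_N J (g -
g₀)|_M`, since `π_N J` vanishes on `N = g₀(M)`; it is therefore Hilbert–Schmidt and depends smoothly
on `g - 1` in the 2-norm. For the submersion property, `W ↦ shear_N(φ_N(W)) g₀` is a smooth local
section through `g₀`: the shear `1 - J ψ P_N` carries `N` onto the graph of `-J ψ` and is the
identity at `ψ = 0`. Differentiating the relation "map after section is the identity" gives a
bounded right inverse of the tangent map, so the tangent map is onto with complemented kernel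
(`mfderiv_surjective_of_section`).

The unitary section. Let `W` be the graph of `-J ψ` over `L₀`, write `P`, `ε` for `P_{L₀}`,
`ε_{L₀}`, and put `A = J ψ P + ψ P J`. Then `A` is skew-adjoint, commutes with `J` and anticommutes
with `ε`. As `1 - A` carries `L₀` into `W` and `L₀^⊥` into `W^⊥`, it satisfies `ε_W (1 - A) = (1 -
A) ε = ε (1 + A)`. Consequently `ε_W ε (1 + A) = 1 - A`, and `g_W (1 + A) = 1` (`gOp_graph_mul`). If
`R² = 1 - A² = (1 - A)(1 + A)` with `R` close to `1`, then `g_W = (1 - A) R⁻¹ · R⁻¹`, where `(1 - A)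
R⁻¹` is unitary and `R⁻¹` is positive. So the unitary part is `u = (1 - A) R⁻¹`. It commutes with
`J`, and `u(L₀) = W` because `R` preserves `L₀` (`unitaryPart_graph`).

The root `R` comes from the inverse function theorem applied to `y ↦ y²` at `1`, which makes it
smooth in `ψ`. No functional calculus is needed: a square root within distance less than `1` of the
identity is unique (`eq_of_mul_self_eq`), so `R` inherits self-adjointness and commutation with `J`
and `ε` from `R²`. In the restricted case `u - 1 = (A² (R + 1)⁻¹ - A) R⁻¹`. This has a
Hilbert–Schmidt factor linear in `ψ` in each term, so `u - 1` is Hilbert–Schmidt and smooth in the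
2-norm.

Other base points. Any two Lagrangian subspaces are isomorphic, and an isomorphism `L → M` extends
to a symplectic operator (`exists_smul_eq`), so `Sp(H)` is transitive on `Λ(H)`. Each group element
acts smoothly, so conjugating the section at `L₀` by `g` gives a section at `g(L₀)`. -/

/-- A smooth map with a differentiable local section through `x` has a tangent map at `x` that is
onto and has a complemented kernel. -/
theorem mfderiv_surjective_of_section {E F M N : Type*} [NormedAddCommGroup E] [NormedSpace ℝ E]
    [NormedAddCommGroup F] [NormedSpace ℝ F] [TopologicalSpace M] [ChartedSpace E M]
    [TopologicalSpace N] [ChartedSpace F N] {f : M → N} {s : N → M} {x : M}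
    (hf : MDifferentiableAt 𝓘(ℝ, E) 𝓘(ℝ, F) f x)
    (hs : MDifferentiableAt 𝓘(ℝ, F) 𝓘(ℝ, E) s (f x)) (hx : s (f x) = x)
    (h : ∀ᶠ y in 𝓝 (f x), f (s y) = y) :
    Function.Surjective (mfderiv 𝓘(ℝ, E) 𝓘(ℝ, F) f x) ∧
      (mfderiv 𝓘(ℝ, E) 𝓘(ℝ, F) f x).ker.ClosedComplemented := by
  have hf' : HasMFDerivAt 𝓘(ℝ, E) 𝓘(ℝ, F) f (s (f x)) (mfderiv 𝓘(ℝ, E) 𝓘(ℝ, F) f x) := by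
    rw [hx]; exact hf.hasMFDerivAt
  have hc := hf'.comp (f x) hs.hasMFDerivAt
  have hid : HasMFDerivAt 𝓘(ℝ, F) 𝓘(ℝ, F) (f ∘ s) (f x)
      (ContinuousLinearMap.id ℝ (TangentSpace 𝓘(ℝ, F) (f x))) :=
    (hasMFDerivAt_id (f x)).congr_of_eventuallyEq h
  have e := hasMFDerivAt_unique hc hid
  -- By the chain rule, the derivative `b` of the section is a bounded right inverse of the
  -- derivative `a` of `f`.
  let a : E →L[ℝ] F := mfderiv 𝓘(ℝ, E) 𝓘(ℝ, F) f x
  let b : F →L[ℝ] E := mfderiv 𝓘(ℝ, F) 𝓘(ℝ, E) s (f x)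
  have hab : Function.RightInverse b a := fun v => congrArg (fun c : F →L[ℝ] F => c v) e
  exact ⟨hab.surjective, a.closedComplemented_ker_of_rightInverse b hab⟩

/-- Near `1`, a Banach algebra has a smooth square root. -/
theorem exists_contDiffOn_sqrt (A : Type*) [NormedRing A] [NormedAlgebra ℝ A] [CompleteSpace A] :
    ∃ (s : A → A) (U : Set A), IsOpen U ∧ 1 ∈ U ∧ ContDiffOn ℝ ∞ s U ∧
      ∀ x ∈ U, s x * s x = x ∧ ‖s x - 1‖ < 1 := by
  let f : A → A := fun y => y * y
  let e : A ≃L[ℝ] A := ContinuousLinearEquiv.smulLeft (Units.mk0 (2 : ℝ) two_ne_zero)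
  -- Order `ω` rather than `∞`: analyticity at a point holds on a whole neighbourhood, whereas
  -- `ContDiffAt` of order `∞` allows a neighbourhood shrinking with the order. The step
  -- `hs.eventually` below needs this.
  have hc : ContDiffAt ℝ ω f 1 := contDiffAt_id.mul contDiffAt_id
  have hd : HasFDerivAt f (e : A →L[ℝ] A) 1 := by
    have := (hasFDerivAt_id (𝕜 := ℝ) (1 : A)).mul' (hasFDerivAt_id (𝕜 := ℝ) (1 : A))
    refine this.congr_fderiv (ContinuousLinearMap.ext fun v => ?_)
    change (1 : A) • v + MulOpposite.op (1 : A) • v = (2 : ℝ) • v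
    rw [one_smul, MulOpposite.op_one, one_smul, two_smul]
  have hω : (ω : WithTop ℕ∞) ≠ 0 := by simp
  let s := hc.localInverse hd hω
  have f1 : f 1 = 1 := by simp [f]
  have hs1 : s 1 = 1 := by
    have := hc.localInverse_apply_image hd hω
    rwa [f1] at this
  have hs : ContDiffAt ℝ ω s 1 := by
    have := hc.to_localInverse hd hω
    rwa [f1] at this
  have h1 : ∀ᶠ x in 𝓝 (1 : A), f (s x) = x := by
    have := (hc.hasStrictFDerivAt' hd hω).eventually_right_inverse
    rwa [f1] at this
  have h2 : ∀ᶠ x in 𝓝 (1 : A), ‖s x - 1‖ < 1 := by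
    have : Filter.Tendsto (fun x => ‖s x - 1‖) (𝓝 1) (𝓝 ‖s 1 - 1‖) :=
      (hs.continuousAt.sub continuousAt_const).norm
    refine this.eventually (gt_mem_nhds ?_)
    simp [hs1]
  have h3 := hs.eventually (by simp)
  obtain ⟨U, hU, hUo, hU1⟩ := eventually_nhds_iff.1 (h1.and (h2.and h3))
  exact ⟨s, U, hUo, hU1, fun x hx => ((hU x hx).2.2.of_le le_top).contDiffWithinAt,
    fun x hx => ⟨(hU x hx).1, (hU x hx).2.1⟩⟩

/-- Square roots in the open unit ball about `1` are unique. -/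
theorem eq_of_mul_self_eq {A : Type*} [NormedRing A] [NormedAlgebra ℝ A] {y z : A}
    (hy : ‖y - 1‖ < 1) (hz : ‖z - 1‖ < 1) (h : y * y = z * z) : y = z := by
  -- The right side has norm at most `(‖y - 1‖ + ‖z - 1‖) ‖y - z‖`, which is less than `2 ‖y - z‖`
  -- unless `y = z`.
  have e : (2 : ℝ) • (y - z) = -((y - 1) * (y - z) + (y - z) * (z - 1)) := by
    have : (y - 1) * (y - z) + (y - z) * (z - 1) = y * y - z * z - (y - z) - (y - z) := by
      noncomm_ring
    rw [this, h, two_smul]; abel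
  have h1 := congrArg norm e
  rw [norm_smul, norm_neg] at h1
  have h2 := (norm_add_le ((y - 1) * (y - z)) ((y - z) * (z - 1))).trans
    (add_le_add (norm_mul_le _ _) (norm_mul_le _ _))
  rw [← h1] at h2
  by_contra hne
  have h3 : 0 < ‖y - z‖ := norm_pos_iff.2 (sub_ne_zero.2 hne)
  have h4 : ‖(2 : ℝ)‖ = 2 := by simp
  rw [h4] at h2
  nlinarith

end General

/-! ### Smooth maps out of and into `Sp(H)`, tested in `B(H)` -/

section SymplecticGroup

variable {H : Type*} [NormedAddCommGroup H] [InnerProductSpace ℝ H] [CompleteSpace H]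
  {J : ComplexStructure H}

theorem mem_spChart_source {g₀ g : Sp J} :
    g ∈ (spChart g₀).source ↔ IsUnit (g₀⁻¹.toOp * g.toOp + 1) := by
  simp only [spChart, mfld_simps]; rfl

theorem spChart_mem_maximalAtlas (g₀ : Sp J) :
    spChart g₀ ∈ IsManifold.maximalAtlas 𝓘(ℝ, sp J) ∞ (Sp J) :=
  IsManifold.subset_maximalAtlas ⟨g₀, rfl⟩

theorem contDiffOn_cayley :
    ContDiffOn ℝ ∞ (cayley : (H →L[ℝ] H) → (H →L[ℝ] H)) {y | IsUnit (y + 1)} :=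
  (contDiffOn_id.sub contDiffOn_const).mul
    (contDiffAt_inverse_comp (contDiffOn_id.add contDiffOn_const) fun _ hx => hx)

theorem contDiffOn_cayleyInv :
    ContDiffOn ℝ ∞ (cayleyInv : (H →L[ℝ] H) → (H →L[ℝ] H)) {y | IsUnit (1 - y)} :=
  (contDiffOn_const.add contDiffOn_id).mul
    (contDiffAt_inverse_comp (contDiffOn_const.sub contDiffOn_id) fun _ hx => hx)

theorem isOpen_isUnit_add_one : IsOpen {y : H →L[ℝ] H | IsUnit (y + 1)} :=
  Units.isOpen.preimage (continuous_id.add continuous_const)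

theorem isOpen_isUnit_one_sub : IsOpen {y : H →L[ℝ] H | IsUnit (1 - y)} :=
  Units.isOpen.preimage (continuous_const.sub continuous_id)

theorem contDiff_sp_coe : ContDiff ℝ ∞ (fun x : sp J => (x : H →L[ℝ] H)) :=
  (show ContDiff ℝ ∞ (sp J).subtypeL from ContinuousLinearMap.contDiff _)

theorem contDiff_spProj : ContDiff ℝ ∞ (spProj J) := ContinuousLinearMap.contDiff _

/-- The inclusion of `Sp(H)` in `B(H)` is smooth. -/
theorem contMDiff_toOp : ContMDiff 𝓘(ℝ, sp J) 𝓘(ℝ, H →L[ℝ] H) ∞ (Sp.toOp : Sp J → _) := by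
  intro g₀
  have hs : g₀ ∈ (spChart g₀).source := mem_chart_source (sp J) g₀
  have h1 := contMDiffAt_of_mem_maximalAtlas (spChart_mem_maximalAtlas g₀) hs
  have h2 : IsUnit (1 - (spChart g₀ g₀ : H →L[ℝ] H)) :=
    isUnit_one_sub_cayley (mem_spChart_source.1 hs)
  -- The inclusion read in the chart at `g₀` is `x ↦ g₀ (1 + x)(1 - x)⁻¹`.
  have h3 : ContMDiffAt 𝓘(ℝ, sp J) 𝓘(ℝ, H →L[ℝ] H) ∞
      (fun x : sp J => g₀.toOp * cayleyInv (x : H →L[ℝ] H)) (spChart g₀ g₀) := by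
    refine (contDiffAt_const.mul (ContDiffAt.comp (g := cayleyInv) _ ?_
      contDiff_sp_coe.contDiffAt)).contMDiffAt
    exact contDiffOn_cayleyInv.contDiffAt (isOpen_isUnit_one_sub.mem_nhds h2)
  refine (h3.comp g₀ h1).congr_of_eventuallyEq ?_
  filter_upwards [(spChart g₀).open_source.mem_nhds hs] with g hg
  rw [mem_spChart_source] at hg
  change g.toOp = g₀.toOp * cayleyInv (cayley (g₀⁻¹.toOp * g.toOp))
  rw [cayleyInv_cayley hg, ← mul_assoc, g₀.mul_inv, one_mul]

/-- A map into `Sp(H)` is smooth if it is smooth as a map into `B(H)`. -/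
theorem contMDiffAt_sp {E M : Type*} [NormedAddCommGroup E] [NormedSpace ℝ E] [TopologicalSpace M]
    [ChartedSpace E M] {f : M → Sp J} {x : M}
    (hf : ContMDiffAt 𝓘(ℝ, E) 𝓘(ℝ, H →L[ℝ] H) ∞ (fun y => (f y).toOp) x) :
    ContMDiffAt 𝓘(ℝ, E) 𝓘(ℝ, sp J) ∞ f x := by
  set g₀ := f x
  have hs : g₀ ∈ (spChart g₀).source := mem_chart_source (sp J) g₀
  have hu := mem_spChart_source.1 hs
  -- The Cayley formula of the chart extends to an open set of `B(H)`; composing with the projection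
  -- `spProj` puts its values in `sp(H)` without changing them on symplectic operators.
  have h1 : ContMDiffAt 𝓘(ℝ, H →L[ℝ] H) 𝓘(ℝ, sp J) ∞
      (fun y => spProj J (cayley (g₀⁻¹.toOp * y))) g₀.toOp := by
    refine (contDiff_spProj.contDiffAt.comp _ (ContDiffAt.comp (g := cayley) _ ?_
      (contDiffAt_const.mul contDiffAt_id))).contMDiffAt
    exact contDiffOn_cayley.contDiffAt (isOpen_isUnit_add_one.mem_nhds hu)
  have h2 : ContMDiffAt 𝓘(ℝ, sp J) 𝓘(ℝ, sp J) ∞ (spChart g₀).symm (spChart g₀ g₀) :=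
    contMDiffAt_symm_of_mem_maximalAtlas (spChart_mem_maximalAtlas g₀)
      ((spChart g₀).map_source hs)
  have e0 : ∀ g : Sp J, spProj J (cayley (g₀⁻¹.toOp * g.toOp)) = spChart g₀ g := fun g =>
    spProj_coe (spChart g₀ g)
  have h3 := h1.comp x hf
  rw [← e0] at h2
  refine (h2.comp x h3).congr_of_eventuallyEq ?_
  have ho : IsOpen {y : H →L[ℝ] H | IsUnit (g₀⁻¹.toOp * y + 1)} :=
    Units.isOpen.preimage ((continuous_const.mul continuous_id).add continuous_const)
  filter_upwards [hf.continuousAt.preimage_mem_nhds (ho.mem_nhds hu)] with y hy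
  change f y = (spChart g₀).symm (spProj J (cayley (g₀⁻¹.toOp * (f y).toOp)))
  rw [e0, (spChart g₀).left_inv (mem_spChart_source.2 hy)]

end SymplecticGroup

/-! ### The orbit maps of `Sp(H)` on `Λ(H)` -/

section LagrSmooth

variable {H : Type*} [NormedAddCommGroup H] [InnerProductSpace ℝ H] [CompleteSpace H]
  {J : ComplexStructure H} {L₀ : Lagr J}

theorem lagrChart_mem_maximalAtlas (L : Lagr J) (e : L₀.carrier ≃L[ℝ] L.carrier) :
    lagrChart L e ∈ IsManifold.maximalAtlas 𝓘(ℝ, SymB L₀) ∞ (Lagr J) :=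
  IsManifold.subset_maximalAtlas ⟨L, e, rfl⟩

theorem contDiff_symProj (E : Type*) [NormedAddCommGroup E] [InnerProductSpace ℝ E]
    [CompleteSpace E] : ContDiff ℝ ∞ (symProj E) := ContinuousLinearMap.contDiff _

theorem isOpen_Omega (M : Lagr J) : IsOpen (Omega M) := (phiChart M).open_source

/-- The charts of the atlas are `φ_M` followed by the transport `ψ ↦ e* ψ e` to the fixed model
`B(L₀)_s`. Undoing this linear isomorphism allows later arguments to use `φ_M` itself, in its
natural space `B(M)_s`; `contMDiff_graph` does the same for the inverse. -/
theorem contMDiffOn_phiSym (M : Lagr J) :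
    ContMDiffOn 𝓘(ℝ, SymB L₀) 𝓘(ℝ, SymB M) ∞ (phiSym M) (Omega M) := by
  let e := (nonempty_equiv L₀ M).some
  have h1 := contMDiffOn_of_mem_maximalAtlas (lagrChart_mem_maximalAtlas M e)
  have hs : (lagrChart M e).source = Omega M := by
    simp only [lagrChart, mfld_simps]; rfl
  rw [hs] at h1
  refine ((contDiff_symCongr_symm e).contMDiff.comp_contMDiffOn h1).congr fun W _ => ?_
  exact ((symCongr e).symm_apply_apply (phiSym M W)).symm

theorem contMDiff_graph (M : Lagr J) :
    ContMDiff 𝓘(ℝ, SymB M) 𝓘(ℝ, SymB L₀) ∞ (graph M) := by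
  let e := (nonempty_equiv L₀ M).some
  have h1 := contMDiffOn_symm_of_mem_maximalAtlas (lagrChart_mem_maximalAtlas M e)
  have hs : (lagrChart M e).target = Set.univ := by
    simp only [lagrChart, mfld_simps]; rfl
  rw [hs, contMDiffOn_univ] at h1
  refine (h1.comp (contDiff_symCongr e).contMDiff).congr fun ψ => ?_
  change graph M ψ = graph M ((symCongr e).symm (symCongr e ψ))
  rw [(symCongr e).symm_apply_apply]

/-- The orbit maps of `Sp(H)` on `Λ(H)` are smooth. -/
theorem contMDiff_orbitMap (M : Lagr J) :
    ContMDiff 𝓘(ℝ, sp J) 𝓘(ℝ, SymB L₀) ∞ (orbitMap M) := by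
  intro g₀
  set N := g₀ • M
  have hN : (N.proj ∘L g₀.toOp ∘L M.incl).IsInvertible :=
    (smul_mem_Omega_iff g₀ M N).1 (mem_Omega_self N)
  let s : Set (H →L[ℝ] H) := {y | (N.proj ∘L y ∘L M.incl).IsInvertible}
  have hs : IsOpen s := isOpen_isInvertible.preimage
    (continuous_const.clm_comp (continuous_id.clm_comp continuous_const))
  -- The formula of `phi_smul` makes sense for every bounded `y` with `π_N y|_M` invertible,
  -- symplectic or not. Its values need not be symmetric then, hence the projection `symProj` in
  -- `h2`.
  have h1 : ContDiffOn ℝ ∞ (fun y : H →L[ℝ] H =>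
      (N.proj ∘L J.op ∘L y ∘L M.incl) ∘L (N.proj ∘L y ∘L M.incl).inverse) s :=
    ContDiffOn.clm_comp (by fun_prop) (contDiffOn_inverse (by fun_prop) fun y hy => hy)
  have h2 : ContDiffAt ℝ ∞ (fun y : H →L[ℝ] H => symProj N.carrier
      ((N.proj ∘L J.op ∘L y ∘L M.incl) ∘L (N.proj ∘L y ∘L M.incl).inverse)) g₀.toOp :=
    (contDiff_symProj N.carrier).contDiffAt.comp _ (h1.contDiffAt (hs.mem_nhds hN))
  refine (((contMDiff_graph N).contMDiffAt.comp _ h2.contMDiffAt).comp g₀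
    contMDiff_toOp.contMDiffAt).congr_of_eventuallyEq ?_
  filter_upwards [Sp.continuous_toOp.continuousAt.preimage_mem_nhds (hs.mem_nhds hN)] with g hg
  change g • M = graph N (symProj N.carrier ((N.proj ∘L J.op ∘L g.toOp ∘L M.incl) ∘L
    (N.proj ∘L g.toOp ∘L M.incl).inverse))
  rw [← phi_smul]
  have e : symProj N.carrier (phi N (g • M)) = phiSym N (g • M) := symProj_coe (phiSym N (g • M))
  rw [e, graph_phiSym ((smul_mem_Omega_iff g M N).2 hg)]

theorem contDiff_extOp (M : Lagr J) : ContDiff ℝ ∞ (extOp M) := by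
  unfold extOp; fun_prop

/-- The map `W ↦ shear_M(φ_M(W)) g`, which for `M = g(L)` is a local section of `π_L` through
`g`. -/
theorem contMDiffOn_shear (M : Lagr J) (a b : Sp J) :
    ContMDiffOn 𝓘(ℝ, SymB L₀) 𝓘(ℝ, sp J) ∞ (fun W => a * shear M (phiSym M W) * b)
      (Omega M) := by
  intro W hW
  refine (contMDiffAt_sp ?_).contMDiffWithinAt
  have h1 : ContDiff ℝ ∞ (fun ψ : SymB M => a.toOp * (1 - J.op * extOp M ψ.1) * b.toOp) :=
    (contDiff_const.mul (contDiff_const.sub (contDiff_const.mul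
      ((contDiff_extOp M).comp contDiff_symOp_coe)))).mul contDiff_const
  exact h1.contMDiff.contMDiffAt.comp W
    ((contMDiffOn_phiSym M).contMDiffAt ((isOpen_Omega M).mem_nhds hW))

/-- The action of a symplectic operator on `Λ(H)` is smooth. -/
theorem contMDiff_smul (g : Sp J) :
    ContMDiff 𝓘(ℝ, SymB L₀) 𝓘(ℝ, SymB L₀) ∞ (fun W : Lagr J => g • W) := by
  intro M
  -- Near `M`, `W = shear_M(φ_M(W))(M)`, so `W ↦ g(W)` is the orbit map of `M` composed with a
  -- smooth map into `Sp(H)`.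
  have h1 := (contMDiffOn_shear (L₀ := L₀) M g 1).contMDiffAt
    ((isOpen_Omega M).mem_nhds (mem_Omega_self M))
  refine ((contMDiff_orbitMap M).contMDiffAt.comp M h1).congr_of_eventuallyEq ?_
  filter_upwards [(isOpen_Omega M).mem_nhds (mem_Omega_self M)] with W hW
  change g • W = (g * shear M (phiSym M W) * 1) • M
  rw [mul_one, mul_smul]
  exact congrArg (g • ·) (graph_phiSym hW).symm

theorem phi_self (M : Lagr J) : phi M M = 0 := by
  rw [phi_eq, proj_J_incl, ContinuousLinearMap.zero_comp]

/-- The coordinate of `M` in its own chart is `0`, because `J` sends `M` into `M^⊥`. This makes the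
local section built from shears pass through the prescribed group element. -/
theorem shear_phiSym_self (M : Lagr J) : shear M (phiSym M M) = 1 := by
  apply Sp.toOp_injective
  have h : (phiSym M M).1 = 0 := phi_self M
  rw [toOp_shear, h, Sp.toOp_one]
  simp [extOp]

/-- Through each `g` there is the local section `W ↦ shear_N(φ_N(W)) g` with `N = g(M)`: `g` takes
`M` to `N`, and the shear takes `N` to `W`. -/
theorem isSmoothSubmersion_orbitMap (M : Lagr J) :
    IsSmoothSubmersion (E := sp J) (F := SymB L₀) (orbitMap M) := by
  refine ⟨contMDiff_orbitMap M, fun g => ?_⟩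
  set N := g • M
  have hN := (isOpen_Omega N).mem_nhds (mem_Omega_self N)
  refine mfderiv_surjective_of_section (s := fun W => 1 * shear N (phiSym N W) * g)
    ((contMDiff_orbitMap M).mdifferentiableAt (by simp))
    (((contMDiffOn_shear N 1 g).contMDiffAt hN).mdifferentiableAt (by simp)) ?_ ?_
  · change 1 * shear N (phiSym N N) * g = g
    rw [shear_phiSym_self, one_mul, one_mul]
  · filter_upwards [hN] with W hW
    change (1 * shear N (phiSym N W) * g) • M = W
    rw [one_mul, mul_smul]
    exact graph_phiSym hW

end LagrSmooth

/-! ### Smooth maps out of and into `Sp₂(H)`, tested on `g - 1` in `B₂(H)` -/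

section RestrictedGroupSmooth

variable {H : Type*} [NormedAddCommGroup H] [InnerProductSpace ℝ H] [CompleteSpace H]
  {J : ComplexStructure H}

theorem mem_sp2Chart_source {g₀ g : Sp2 J} :
    g ∈ (sp2Chart g₀).source ↔ IsUnit ((g₀⁻¹ * g).toSp.toOp + 1) := by
  simp only [sp2Chart, mfld_simps]; rfl

theorem sp2Chart_mem_maximalAtlas (g₀ : Sp2 J) :
    sp2Chart g₀ ∈ IsManifold.maximalAtlas 𝓘(ℝ, sp2 J) ∞ (Sp2 J) :=
  IsManifold.subset_maximalAtlas ⟨g₀, rfl⟩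

theorem contDiff_inclL {E F : Type*}
    [NormedAddCommGroup E] [InnerProductSpace ℝ E] [CompleteSpace E]
    [NormedAddCommGroup F] [InnerProductSpace ℝ F] [CompleteSpace F] :
    ContDiff ℝ ∞ (HS.toOp : HS E F → (E →L[ℝ] F)) := (HS.inclL E F).contDiff

theorem contDiff_sp2Proj : ContDiff ℝ ∞ (sp2Proj J) := ContinuousLinearMap.contDiff _

/-- The map `g ↦ g - 1` from `Sp₂(H)` to `B₂(H)` is smooth. -/
theorem contMDiff_toHS : ContMDiff 𝓘(ℝ, sp2 J) 𝓘(ℝ, HS H H) ∞ (Sp2.toHS : Sp2 J → _) := by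
  intro g₀
  have hs : g₀ ∈ (sp2Chart g₀).source := mem_chart_source (sp2 J) g₀
  have h1 := contMDiffAt_of_mem_maximalAtlas (sp2Chart_mem_maximalAtlas g₀) hs
  let s : Set (sp2 J) := {x | IsUnit (1 - HS.toOp (x : HS H H))}
  have hso : IsOpen s :=
    Units.isOpen.preimage (continuous_const.sub contDiff_sp2_toOp.continuous)
  have h2 : sp2Chart g₀ g₀ ∈ s := isUnit_one_sub_cayley (mem_sp2Chart_source.1 hs)
  -- With `g = g₀ (1 + x)(1 - x)⁻¹` one has `g - 1 = (g₀ - 1) + g₀ x · 2(1 - x)⁻¹`, in which the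
  -- factor `x` is Hilbert–Schmidt.
  have h3 : ContMDiffAt 𝓘(ℝ, sp2 J) 𝓘(ℝ, HS H H) ∞
      (fun x : sp2 J => Sp2.toHS g₀ + HS.compL H H H g₀.toSp.toOp
        (HS.compR H H H x ((2 : ℝ) • Ring.inverse (1 - HS.toOp (x : HS H H)))))
      (sp2Chart g₀ g₀) :=
    ((contDiffOn_const.add ((HS.compL H H H g₀.toSp.toOp).contDiff.comp_contDiffOn
      (contDiffOn_cayleySp2 (s := s) fun x hx => hx))).contDiffAt (hso.mem_nhds h2)).contMDiffAt
  refine (h3.comp g₀ h1).congr_of_eventuallyEq ?_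
  filter_upwards [(sp2Chart g₀).open_source.mem_nhds hs] with g hg
  have hg' := mem_sp2Chart_source.1 hg
  have hu : IsUnit (1 - HS.toOp (sp2Chart g₀ g : HS H H)) := isUnit_one_sub_cayley hg'
  have e : cayleySp2 (sp2Chart g₀ g) hu = g₀⁻¹ * g :=
    Sp2.toSp_injective (Sp.toOp_injective (cayleyInv_cayley hg'))
  change g.toHS = Sp2.toHS g₀ + HS.compL H H H g₀.toSp.toOp
    (HS.compR H H H (sp2Chart g₀ g)
      ((2 : ℝ) • Ring.inverse (1 - HS.toOp (sp2Chart g₀ g : HS H H))))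
  rw [← toHS_cayleySp2 _ hu, ← Sp2.toHS_mul, e, mul_inv_cancel_left]

/-- A map into `Sp₂(H)` is smooth if `f - 1` is smooth as a map into `B₂(H)`. -/
theorem contMDiffAt_sp2 {E M : Type*} [NormedAddCommGroup E] [NormedSpace ℝ E]
    [TopologicalSpace M] [ChartedSpace E M] {f : M → Sp2 J} {x : M}
    (hf : ContMDiffAt 𝓘(ℝ, E) 𝓘(ℝ, HS H H) ∞ (fun y => (f y).toHS) x) :
    ContMDiffAt 𝓘(ℝ, E) 𝓘(ℝ, sp2 J) ∞ f x := by
  set g₀ := f x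
  have hs : g₀ ∈ (sp2Chart g₀).source := mem_chart_source (sp2 J) g₀
  -- `k(h) = g₀⁻¹ (1 + h) - 1`, affine in `h`, so that `k(g - 1) = g₀⁻¹ g - 1`.
  let k : HS H H → HS H H := fun h => Sp2.toHS g₀⁻¹ + HS.compL H H H (Sp2.toSp g₀⁻¹).toOp h
  have hk : ContDiff ℝ ∞ k :=
    contDiff_const.add (HS.compL H H H (Sp2.toSp g₀⁻¹).toOp).contDiff
  have hk1 : ∀ g : Sp2 J, k g.toHS = Sp2.toHS (g₀⁻¹ * g) := fun g => (Sp2.toHS_mul _ _).symm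
  have hk2 : ContDiff ℝ ∞ (fun h => 1 + HS.toOp (k h) + 1) :=
    (contDiff_const.add (contDiff_inclL.comp hk)).add contDiff_const
  let s : Set (HS H H) := {h | IsUnit (1 + HS.toOp (k h) + 1)}
  have hso : IsOpen s := Units.isOpen.preimage hk2.continuous
  have hsm : ∀ g : Sp2 J, g ∈ (sp2Chart g₀).source ↔ g.toHS ∈ s := fun g => by
    change _ ↔ IsUnit (1 + HS.toOp (k g.toHS) + 1)
    rw [mem_sp2Chart_source, hk1, ← Sp2.toOp_eq]
  -- The Cayley chart at `g₀`, extended to an open set of `B₂(H)`: the Hilbert–Schmidt numerator is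
  -- `k(h)`, and `sp2Proj` corrects the values outside the group.
  let c : HS H H → sp2 J := fun h =>
    sp2Proj J (HS.compR H H H (k h) (Ring.inverse (1 + HS.toOp (k h) + 1)))
  have hc : ContDiffOn ℝ ∞ c s := contDiff_sp2Proj.comp_contDiffOn
    (HS.contDiffOn_compR hk.contDiffOn (contDiffAt_inverse_comp hk2.contDiffOn fun h hh => hh))
  have hc1 : ∀ g : Sp2 J, c g.toHS = sp2Chart g₀ g := fun g => by
    refine Eq.trans ?_ (sp2Proj_coe (sp2Chart g₀ g))
    change sp2Proj J (HS.compR H H H (k g.toHS) (Ring.inverse (1 + HS.toOp (k g.toHS) + 1))) = _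
    rw [hk1, ← Sp2.toOp_eq]
    rfl
  have hx : g₀.toHS ∈ s := (hsm g₀).1 hs
  have h1 : ContMDiffAt 𝓘(ℝ, HS H H) 𝓘(ℝ, sp2 J) ∞ c g₀.toHS :=
    (hc.contDiffAt (hso.mem_nhds hx)).contMDiffAt
  have h2 : ContMDiffAt 𝓘(ℝ, sp2 J) 𝓘(ℝ, sp2 J) ∞ (sp2Chart g₀).symm (sp2Chart g₀ g₀) :=
    contMDiffAt_symm_of_mem_maximalAtlas (sp2Chart_mem_maximalAtlas g₀)
      ((sp2Chart g₀).map_source hs)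
  rw [← hc1] at h2
  refine (h2.comp x (h1.comp x hf)).congr_of_eventuallyEq ?_
  filter_upwards [hf.continuousAt.preimage_mem_nhds (hso.mem_nhds hx)] with y hy
  change f y = (sp2Chart g₀).symm (c (f y).toHS)
  rw [hc1, (sp2Chart g₀).left_inv ((hsm _).2 hy)]

/-- The identity `a g b - 1 = (a b - 1) + a (g - 1) b`. It exhibits two-sided translation as a
continuous affine map in `g - 1`, and so smooth for the 2-norm. -/
theorem Sp2.toHS_mul_mul (a g b : Sp2 J) : (a * g * b).toHS =
    (a * b).toHS + HS.compL H H H a.toSp.toOp (HS.compR H H H g.toHS b.toSp.toOp) := by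
  ext1
  rw [map_add, HS.toOp_compL, HS.toOp_compR, Sp2.toOp_toHS, Sp2.toOp_toHS, Sp2.toOp_toHS]
  simp only [map_mul, Sp.toOp_mul]
  change _ = a.toSp.toOp * b.toSp.toOp - 1 + a.toSp.toOp * ((g.toSp.toOp - 1) * b.toSp.toOp)
  noncomm_ring

theorem contDiff_toHS_mul_mul (a b : Sp2 J) : ContDiff ℝ ∞ (fun h : HS H H =>
    (a * b).toHS + HS.compL H H H a.toSp.toOp (HS.compR H H H h b.toSp.toOp)) :=
  contDiff_const.add ((HS.compL H H H a.toSp.toOp).contDiff.comp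
    ((HS.compR H H H).contDiff.clm_apply contDiff_const))

end RestrictedGroupSmooth

/-! ### The orbit maps of `Sp₂(H)` on `O_{L₀}` -/

section OrbitSmooth

variable {H : Type*} [NormedAddCommGroup H] [InnerProductSpace ℝ H] [CompleteSpace H]
  {J : ComplexStructure H} {L₀ : Lagr J}

theorem orbitChart_mem_maximalAtlas (L : Orbit L₀)
    (e : L₀.carrier ≃L[ℝ] L.toLagr.carrier) :
    orbitChart L e ∈ IsManifold.maximalAtlas 𝓘(ℝ, SymHS L₀) ∞ (Orbit L₀) :=
  IsManifold.subset_maximalAtlas ⟨L, e, rfl⟩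

theorem contDiff_symHSProj (E : Type*) [NormedAddCommGroup E] [InnerProductSpace ℝ E]
    [CompleteSpace E] : ContDiff ℝ ∞ (symHSProj E) := ContinuousLinearMap.contDiff _

theorem isOpen_Omega2 (M : Orbit L₀) : IsOpen (Omega2 M) := (phiChart2 M).open_source

theorem mem_Omega2_self (M : Orbit L₀) : M ∈ Omega2 M := mem_Omega_self M.toLagr

theorem graph2_phiSymHS {M W : Orbit L₀} (h : W ∈ Omega2 M) : graph2 M (phiSymHS M W) = W :=
  (phiChart2 M).left_inv h

/-- As for `Λ(H)`, the atlas charts differ from `φ_M` only by a linear transport of the model space,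
which is undone here. -/
theorem contMDiffOn_phiSymHS (M : Orbit L₀) :
    ContMDiffOn 𝓘(ℝ, SymHS L₀) 𝓘(ℝ, SymHS M.toLagr) ∞ (phiSymHS M) (Omega2 M) := by
  let e := (nonempty_equiv L₀ M.toLagr).some
  have h1 := contMDiffOn_of_mem_maximalAtlas (orbitChart_mem_maximalAtlas M e)
  have hs : (orbitChart M e).source = Omega2 M := by
    simp only [orbitChart, mfld_simps]; rfl
  rw [hs] at h1
  refine ((contDiff_symHSCongr_symm e).contMDiff.comp_contMDiffOn h1).congr fun W _ => ?_
  exact ((symHSCongr e).symm_apply_apply (phiSymHS M W)).symm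

theorem contMDiff_graph2 (M : Orbit L₀) :
    ContMDiff 𝓘(ℝ, SymHS M.toLagr) 𝓘(ℝ, SymHS L₀) ∞ (graph2 M) := by
  let e := (nonempty_equiv L₀ M.toLagr).some
  have h1 := contMDiffOn_symm_of_mem_maximalAtlas (orbitChart_mem_maximalAtlas M e)
  have hs : (orbitChart M e).target = Set.univ := by
    simp only [orbitChart, mfld_simps]; rfl
  rw [hs, contMDiffOn_univ] at h1
  refine (h1.comp (contDiff_symHSCongr e).contMDiff).congr fun ψ => ?_
  change graph2 M ψ = graph2 M ((symHSCongr e).symm (symHSCongr e ψ))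
  rw [(symHSCongr e).symm_apply_apply]

/-- The orbit maps of `Sp₂(H)` on `O_{L₀}` are smooth. -/
theorem contMDiff_orbitMap2 (M : Orbit L₀) :
    ContMDiff 𝓘(ℝ, sp2 J) 𝓘(ℝ, SymHS L₀) ∞ (orbitMap2 M) := by
  intro g₀
  obtain ⟨N, hNdef⟩ : ∃ N, N = g₀ • M := ⟨_, rfl⟩
  let p : HS H H → (M.toLagr.carrier →L[ℝ] N.toLagr.carrier) := fun h =>
    N.toLagr.proj ∘L (1 + HS.toOp h) ∘L M.toLagr.incl
  have hp : ContDiff ℝ ∞ p :=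
    contDiff_const.clm_comp ((contDiff_const.add contDiff_inclL).clm_comp contDiff_const)
  let s : Set (HS H H) := {h | (p h).IsInvertible}
  have hs : IsOpen s := isOpen_isInvertible.preimage hp.continuous
  have hsm : ∀ g : Sp2 J, g • M ∈ Omega2 N ↔ g.toHS ∈ s := fun g => by
    change g.toSp • M.toLagr ∈ Omega N.toLagr ↔
      (N.toLagr.proj ∘L (1 + HS.toOp g.toHS) ∘L M.toLagr.incl).IsInvertible
    rw [← Sp2.toOp_eq]
    exact smul_mem_Omega_iff g.toSp M.toLagr N.toLagr
  have hN : g₀.toHS ∈ s := (hsm g₀).1 (hNdef ▸ mem_Omega2_self N)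
  -- The chart expression `(π_N J (1 + h)|_M)(π_N (1 + h)|_M)⁻¹`, with `1 + h` in the numerator
  -- replaced by `h - (g₀ - 1)`. Nothing is lost, since `π_N J g₀|_M = 0`, and the numerator becomes
  -- visibly Hilbert–Schmidt.
  let q : HS H H → HS N.toLagr.carrier N.toLagr.carrier := fun h =>
    HS.compR _ _ _ (HS.compR _ _ _ (HS.compL _ _ _ (N.toLagr.proj ∘L J.op)
      (h - g₀.toHS)) M.toLagr.incl) (p h).inverse
  have hq : ContDiffOn ℝ ∞ q s :=
    HS.contDiffOn_compR (HS.contDiffOn_compR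
      ((HS.compL _ _ _ (N.toLagr.proj ∘L J.op)).contDiff.comp_contDiffOn
        (contDiffOn_id.sub contDiffOn_const)) contDiffOn_const)
      (contDiffOn_inverse hp.contDiffOn fun h hh => hh)
  have hq1 : ∀ g : Sp2 J, q g.toHS = (phiSymHS N (g • M) : HS _ _) := fun g => by
    have e1 : N.toLagr.proj ∘L J.op ∘L g.toSp.toOp ∘L M.toLagr.incl =
        ((N.toLagr.proj ∘L J.op) ∘L HS.toOp (g.toHS - g₀.toHS)) ∘L M.toLagr.incl := by
      ext1 l
      have hl : g₀.toSp.toOp l ∈ N.toLagr.carrier := by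
        rw [hNdef]; exact Submodule.mem_map_of_mem l.2
      have h0 : N.toLagr.proj (J.op (g₀.toSp.toOp l)) = 0 := N.toLagr.proj_J ⟨_, hl⟩
      rw [map_sub, Sp2.toOp_toHS, Sp2.toOp_toHS, sub_sub_sub_cancel_right]
      change N.toLagr.proj (J.op (g.toSp.toOp l)) =
        N.toLagr.proj (J.op (g.toSp.toOp l - g₀.toSp.toOp l))
      rw [map_sub, map_sub, h0, sub_zero]
    apply HS.ext
    refine Eq.trans ?_ (phi_smul g.toSp M.toLagr N.toLagr).symm
    simp only [q, p, HS.toOp_compR, HS.toOp_compL]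
    rw [e1, ← Sp2.toOp_eq]
  have h2 : ContDiffAt ℝ ∞ (fun h => symHSProj N.toLagr.carrier (q h)) g₀.toHS :=
    (contDiff_symHSProj _).contDiffAt.comp _ (hq.contDiffAt (hs.mem_nhds hN))
  refine (((contMDiff_graph2 N).contMDiffAt.comp _ h2.contMDiffAt).comp g₀
    contMDiff_toHS.contMDiffAt).congr_of_eventuallyEq ?_
  filter_upwards [Sp2.continuous_toHS.continuousAt.preimage_mem_nhds (hs.mem_nhds hN)] with g hg
  change g • M = graph2 N (symHSProj N.toLagr.carrier (q g.toHS))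
  rw [hq1, symHSProj_coe, graph2_phiSymHS ((hsm g).2 hg)]

theorem toHS_shear2 (M : Lagr J) (ψ : SymHS M) : (shear2 M ψ).toHS =
    -HS.compR _ _ _ (HS.compL _ _ _ (J.op ∘L M.incl) (ψ : HS _ _)) M.proj := by
  ext1
  exact sub_sub_cancel_left _ _

/-- The difference of the shear and the identity, `-J ψ P_M`, is bounded linear in `ψ` from the
2-norm to the 2-norm. -/
theorem contDiff_toHS_shear2 (M : Lagr J) : ContDiff ℝ ∞ (fun ψ : SymHS M =>
    (shear2 M ψ).toHS) := by
  simp only [toHS_shear2]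
  exact (show ContDiff ℝ ∞ ((HS.compR H M.carrier H).flip M.proj ∘L
    HS.compL M.carrier M.carrier H (J.op ∘L M.incl) ∘L (symHS M.carrier).subtypeL)
    from ContinuousLinearMap.contDiff _).neg

/-- The map `W ↦ shear_M(φ_M(W)) g`, which for `M = g(L)` is a local section of `π_L` through
`g`. -/
theorem contMDiffOn_shear2 (M : Orbit L₀) (a b : Sp2 J) :
    ContMDiffOn 𝓘(ℝ, SymHS L₀) 𝓘(ℝ, sp2 J) ∞
      (fun W => a * shear2 M.toLagr (phiSymHS M W) * b) (Omega2 M) := by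
  intro W hW
  refine (contMDiffAt_sp2 ?_).contMDiffWithinAt
  simp only [Sp2.toHS_mul_mul]
  exact (((contDiff_toHS_mul_mul a b).comp
    (contDiff_toHS_shear2 M.toLagr)).contMDiff.contMDiffAt).comp W
    ((contMDiffOn_phiSymHS M).contMDiffAt ((isOpen_Omega2 M).mem_nhds hW))

/-- The action of an element of `Sp₂(H)` on `O_{L₀}` is smooth. -/
theorem contMDiff_smul2 (g : Sp2 J) :
    ContMDiff 𝓘(ℝ, SymHS L₀) 𝓘(ℝ, SymHS L₀) ∞ (fun W : Orbit L₀ => g • W) := by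
  intro M
  have h1 := (contMDiffOn_shear2 M g 1).contMDiffAt
    ((isOpen_Omega2 M).mem_nhds (mem_Omega2_self M))
  refine ((contMDiff_orbitMap2 M).contMDiffAt.comp M h1).congr_of_eventuallyEq ?_
  filter_upwards [(isOpen_Omega2 M).mem_nhds (mem_Omega2_self M)] with W hW
  change g • W = (g * shear2 M.toLagr (phiSymHS M W) * 1) • M
  rw [mul_one, mul_smul]
  exact congrArg (g • ·) (graph2_phiSymHS hW).symm

/-- The same shear sections as for `Sp(H)` work: for Hilbert–Schmidt `ψ` the shear lies in `Sp₂(H)`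
and depends smoothly on `ψ` there. -/
theorem isSmoothSubmersion_orbitMap2 (M : Orbit L₀) :
    IsSmoothSubmersion (E := sp2 J) (F := SymHS L₀) (orbitMap2 M) := by
  refine ⟨contMDiff_orbitMap2 M, fun g => ?_⟩
  set N := g • M
  have hN := (isOpen_Omega2 N).mem_nhds (mem_Omega2_self N)
  refine mfderiv_surjective_of_section
    (s := fun W => 1 * shear2 N.toLagr (phiSymHS N W) * g)
    ((contMDiff_orbitMap2 M).mdifferentiableAt (by simp))
    (((contMDiffOn_shear2 N 1 g).contMDiffAt hN).mdifferentiableAt (by simp)) ?_ ?_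
  · change 1 * shear2 N.toLagr (phiSymHS N N) * g = g
    have e : shear2 N.toLagr (phiSymHS N N) = 1 :=
      Sp2.toSp_injective (shear_phiSym_self N.toLagr)
    rw [e, one_mul, one_mul]
  · filter_upwards [hN] with W hW
    change (1 * shear2 N.toLagr (phiSymHS N W) * g) • M = W
    rw [one_mul, mul_smul]
    exact graph2_phiSymHS hW

end OrbitSmooth

/-! ### Properties a square root near the identity inherits from its square -/

section SquareRoot

variable {H : Type*} [NormedAddCommGroup H] [InnerProductSpace ℝ H] [CompleteSpace H]

/-- Conjugation by a unitary preserves the distance to `1`, so `c R c*` is again a root in the unit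
ball about `1`; it has the same square as `R` and thus equals `R`. -/
theorem unitary_mul_comm_of_sq {c R : H →L[ℝ] H} (hc : c ∈ unitary (H →L[ℝ] H))
    (hR : ‖R - 1‖ < 1) (h : c * (R * R) = R * R * c) : c * R = R * c := by
  obtain ⟨h1, h2⟩ := Unitary.mem_iff.1 hc
  have e : c * R * star c - 1 = c * (R - 1) * star c := by
    rw [mul_sub, sub_mul, mul_one, h2]
  have hn : ‖c * R * star c - 1‖ < 1 := by
    rw [e, CStarRing.norm_mul_mem_unitary _ (Unitary.star_mem hc),
      CStarRing.norm_mem_unitary_mul _ hc]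
    exact hR
  have hs : c * R * star c * (c * R * star c) = R * R := by
    calc c * R * star c * (c * R * star c) = c * R * (star c * c) * R * star c := by
          simp only [mul_assoc]
      _ = c * (R * R) * star c := by rw [h1]; simp only [mul_assoc, mul_one]
      _ = R * R * (c * star c) := by rw [h, mul_assoc]
      _ = R * R := by rw [h2, mul_one]
  have := eq_of_mul_self_eq hn hR hs
  calc c * R = c * R * (star c * c) := by rw [h1, mul_one]
    _ = c * R * star c * c := by simp only [mul_assoc]
    _ = R * c := by rw [this]

/-- The adjoint `R*` is as close to `1` as `R` and has the same square, so uniqueness of the root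
applies. -/
theorem star_eq_of_sq {R : H →L[ℝ] H} (hR : ‖R - 1‖ < 1) (h : star (R * R) = R * R) :
    star R = R := by
  refine eq_of_mul_self_eq ?_ hR (by rw [← star_mul, h])
  rwa [← star_one, ← star_sub, norm_star]

theorem isUnit_of_norm_sub_one {A : Type*} [NormedRing A] [CompleteSpace A] {R : A}
    (hR : ‖R - 1‖ < 1) : IsUnit R := by
  have := isUnit_one_sub_of_norm_lt_one (x := 1 - R) (by rwa [norm_sub_rev])
  rwa [sub_sub_cancel] at this

/-- The midpoint `(R + 1)/2` is at half the distance of `R` from `1`, so it is invertible. The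
inverse of `R + 1` enters the Hilbert–Schmidt formula for `u - 1`. -/
theorem isUnit_add_one_of_norm_sub_one {A : Type*} [NormedRing A] [NormedAlgebra ℝ A]
    [CompleteSpace A] {R : A} (hR : ‖R - 1‖ < 1) : IsUnit (R + 1) := by
  have h : IsUnit ((1 / 2 : ℝ) • (R + 1)) := by
    apply isUnit_of_norm_sub_one
    have e : (1 / 2 : ℝ) • (R + 1) - 1 = (1 / 2 : ℝ) • (R - 1) := by
      have : (1 : A) = (1 / 2 : ℝ) • (1 + 1) := by
        rw [← two_smul ℝ (1 : A), smul_smul]; norm_num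
      nth_rewrite 2 [this]
      rw [← smul_sub]; congr 1; abel
    rw [e, norm_smul]
    have : ‖(1 / 2 : ℝ)‖ = 1 / 2 := by norm_num
    rw [this]; linarith [norm_nonneg (R - 1)]
  have h2 := h.smul (Units.mk0 (2 : ℝ) two_ne_zero)
  rw [Units.smul_mk0, smul_smul] at h2
  norm_num at h2
  exact h2

/-- The inverse of a self-adjoint operator at distance less than `1` from the identity is
positive. -/
theorem isPositive_inverse {R : H →L[ℝ] H} (hs : star R = R) (hR : ‖R - 1‖ < 1) :
    (Ring.inverse R).IsPositive := by
  have hu := isUnit_of_norm_sub_one hR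
  refine (ContinuousLinearMap.isPositive_iff' _).2 ⟨?_, fun x => ?_⟩
  · change star _ = _
    rw [← Ring.inverse_star, hs]
  -- With `x = R y` the quadratic form becomes `⟪y, R y⟫ = ‖y‖² + ⟪y, (R - 1) y⟫`, which is
  -- nonnegative since `‖R - 1‖ < 1`.
  · obtain ⟨y, rfl⟩ : ∃ y, R y = x := ⟨Ring.inverse R x, by
      change (R * Ring.inverse R) x = x
      rw [Ring.mul_inverse_cancel _ hu]; rfl⟩
    have e : Ring.inverse R (R y) = y := by
      change (Ring.inverse R * R) y = y
      rw [Ring.inverse_mul_cancel _ hu]; rfl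
    rw [e]
    have h1 : R y = y + (R - 1) y := by simp
    rw [h1, inner_add_right, real_inner_self_eq_norm_sq]
    have h2 := abs_le.1 (abs_real_inner_le_norm y ((R - 1) y))
    have h3 : ‖(R - 1) y‖ ≤ 1 * ‖y‖ := (R - 1).le_of_opNorm_le hR.le y
    nlinarith [norm_nonneg y]

end SquareRoot

/-! ### The operator `A`, the unitary part of `g_W`, and transitivity of `Sp(H)` -/

section Symmetry

variable {H : Type*} [NormedAddCommGroup H] [InnerProductSpace ℝ H] [CompleteSpace H]
  {J : ComplexStructure H}

theorem op_mem_unitary : J.op ∈ unitary (H →L[ℝ] H) :=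
  Unitary.mem_iff.2 ⟨by rw [J.adj, neg_mul, J.sq, neg_neg],
    by rw [J.adj, mul_neg, J.sq, neg_neg]⟩

theorem Lagr.ext_op (L : Lagr J) {a b : H →L[ℝ] H} (h1 : ∀ x ∈ L.carrier, a x = b x)
    (h2 : ∀ x ∈ L.carrierᗮ, a x = b x) : a = b := by
  ext1 x
  rw [← L.add_proj x, map_add, map_add, h1 _ (L.proj x).2, h2 _ (L.projPerp x).2]

theorem Lagr.eps_apply (L : Lagr J) (x : H) : L.eps x = (2 : ℝ) • (L.proj x : H) - x := rfl

theorem Lagr.eps_of_mem (L : Lagr J) {x : H} (hx : x ∈ L.carrier) : L.eps x = x := by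
  rw [L.eps_apply, L.proj_of_mem hx, two_smul, add_sub_cancel_right]

theorem Lagr.eps_of_perp (L : Lagr J) {x : H} (hx : x ∈ L.carrierᗮ) : L.eps x = -x := by
  rw [L.eps_apply, L.proj_perp hx]; simp

theorem Lagr.mem_of_eps (L : Lagr J) {x : H} (hx : L.eps x = x) : x ∈ L.carrier := by
  rw [L.eps_apply, sub_eq_iff_eq_add, ← two_smul ℝ x] at hx
  have := smul_right_injective H (two_ne_zero (α := ℝ)) hx
  rw [← this]; exact (L.proj x).2

theorem Lagr.eps_mul_eps (L : Lagr J) : L.eps * L.eps = 1 :=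
  L.ext_op (fun x hx => by
    change L.eps (L.eps x) = x
    rw [L.eps_of_mem hx, L.eps_of_mem hx]) (fun x hx => by
    change L.eps (L.eps x) = x
    rw [L.eps_of_perp hx, map_neg, L.eps_of_perp hx, neg_neg])

theorem Lagr.star_eps (L : Lagr J) : star L.eps = L.eps := by
  have h : star L.P = L.P := isSelfAdjoint_starProjection L.carrier
  rw [Lagr.eps, star_sub, star_smul, h, star_one]; simp

theorem Lagr.eps_mem_unitary (L : Lagr J) : L.eps ∈ unitary (H →L[ℝ] H) :=
  Unitary.mem_iff.2 ⟨by rw [L.star_eps, L.eps_mul_eps], by rw [L.star_eps, L.eps_mul_eps]⟩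

/-- `J` exchanges `L` and `L^⊥`, the eigenspaces of `ε_L` for `1` and `-1`. -/
theorem Lagr.eps_mul_J (L : Lagr J) : L.eps * J.op = -(J.op * L.eps) :=
  L.ext_op (fun x hx => by
    change L.eps (J.op x) = -J.op (L.eps x)
    rw [L.eps_of_mem hx, L.eps_of_perp (L.J_mem hx)]) (fun x hx => by
    change L.eps (J.op x) = -J.op (L.eps x)
    rw [L.eps_of_perp hx, L.eps_of_mem (L.J_mem_of_perp hx), map_neg, neg_neg])

theorem Lagr.eps_mul_extOp (L : Lagr J) (χ : L.carrier →L[ℝ] L.carrier) :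
    L.eps * extOp L χ = extOp L χ := by
  ext1 x
  exact L.eps_of_mem (χ (L.proj x)).2

theorem Lagr.extOp_mul_eps (L : Lagr J) (χ : L.carrier →L[ℝ] L.carrier) :
    extOp L χ * L.eps = extOp L χ :=
  L.ext_op (fun x hx => congrArg (extOp L χ) (L.eps_of_mem hx)) fun x hx => by
    change (χ (L.proj (L.eps x)) : H) = χ (L.proj x)
    rw [L.eps_of_perp hx, map_neg, L.proj_perp hx, neg_zero]

/-- The skew-adjoint operator `J ψ P_L + ψ P_L J`, which commutes with `J` and equals `J ψ`
on `L`. -/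
def skewOp (L : Lagr J) (χ : L.carrier →L[ℝ] L.carrier) : H →L[ℝ] H :=
  J.op * extOp L χ + extOp L χ * J.op

theorem star_skewOp (L : Lagr J) (ψ : SymB L) : star (skewOp L ψ.1) = -skewOp L ψ.1 := by
  rw [skewOp, star_add, star_mul, star_mul, star_extOp, J.adj]; noncomm_ring

theorem J_mul_skewOp (L : Lagr J) (χ : L.carrier →L[ℝ] L.carrier) :
    J.op * skewOp L χ = skewOp L χ * J.op := by
  rw [skewOp, mul_add, add_mul, ← mul_assoc, J.sq, mul_assoc (extOp L χ), J.sq]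
  noncomm_ring

/-- The operator is off-diagonal for `H = L ⊕ L^⊥`: `J χ P_L` maps `L` to `L^⊥` and kills `L^⊥`,
while `χ P_L J` maps `L^⊥` to `L` and kills `L`. -/
theorem eps_mul_skewOp (L : Lagr J) (χ : L.carrier →L[ℝ] L.carrier) :
    L.eps * skewOp L χ = -(skewOp L χ * L.eps) := by
  rw [skewOp, mul_add, add_mul, ← mul_assoc, L.eps_mul_J, neg_mul, mul_assoc J.op,
    L.eps_mul_extOp, ← mul_assoc, L.eps_mul_extOp, mul_assoc J.op, L.extOp_mul_eps,
    mul_assoc (extOp L χ) J.op]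
  have h : J.op * L.eps = -(L.eps * J.op) := by rw [L.eps_mul_J, neg_neg]
  rw [h, mul_neg, ← mul_assoc, L.extOp_mul_eps]
  abel

/-- On `L` the summand `χ P_L J` vanishes, so `1 - A` agrees there with the shear that parametrizes
the graph. Unlike the shear, it commutes with `J`. -/
theorem one_sub_skewOp_apply (L : Lagr J) (χ : L.carrier →L[ℝ] L.carrier) (l : L.carrier) :
    (1 - skewOp L χ) (l : H) = l - J.op (χ l) := by
  change (l : H) - (J.op (χ (L.proj l)) + (χ (L.proj (J.op l)) : H)) = l - J.op (χ l)
  rw [L.proj_J, L.proj_incl]; simp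

theorem one_sub_skewOp_mem_graph (L : Lagr J) (ψ : SymB L) {x : H} (hx : x ∈ L.carrier) :
    (1 - skewOp L ψ.1) x ∈ (graph L ψ).carrier :=
  (mem_graph L ψ _).2 ⟨⟨x, hx⟩, (one_sub_skewOp_apply L ψ.1 ⟨x, hx⟩).symm⟩

/-- For `x ∈ L^⊥` one has `J x ∈ L`, so `(1 - A) J x` lies in the graph `W`. Applying `J`, which
commutes with `1 - A` and maps `W` into `W^⊥`, gives `-(1 - A) x`. -/
theorem one_sub_skewOp_mem_perp (L : Lagr J) (ψ : SymB L) {x : H} (hx : x ∈ L.carrierᗮ) :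
    (1 - skewOp L ψ.1) x ∈ (graph L ψ).carrierᗮ := by
  have h := (graph L ψ).J_mem (one_sub_skewOp_mem_graph L ψ (L.J_mem_of_perp hx))
  have e : J.op * (1 - skewOp L ψ.1) = (1 - skewOp L ψ.1) * J.op := by
    rw [mul_sub, sub_mul, J_mul_skewOp, mul_one, one_mul]
  have e' : J.op ((1 - skewOp L ψ.1) (J.op x)) = -(1 - skewOp L ψ.1) x := by
    change (J.op * (1 - skewOp L ψ.1)) (J.op x) = _
    rw [e]
    change (1 - skewOp L ψ.1) (J.op (J.op x)) = _
    rw [J_J, map_neg]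
  rw [e'] at h
  exact neg_mem_iff.1 h

/-- Since `1 - A` respects the two orthogonal splittings `L ⊕ L^⊥` and `W ⊕ W^⊥`, it intertwines the
corresponding symmetries. -/
theorem eps_graph_mul (L : Lagr J) (ψ : SymB L) :
    (graph L ψ).eps * (1 - skewOp L ψ.1) = (1 - skewOp L ψ.1) * L.eps :=
  L.ext_op (fun x hx => by
    change (graph L ψ).eps ((1 - skewOp L ψ.1) x) = (1 - skewOp L ψ.1) (L.eps x)
    rw [L.eps_of_mem hx, Lagr.eps_of_mem _ (one_sub_skewOp_mem_graph L ψ hx)]) (fun x hx => by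
    change (graph L ψ).eps ((1 - skewOp L ψ.1) x) = (1 - skewOp L ψ.1) (L.eps x)
    rw [L.eps_of_perp hx, Lagr.eps_of_perp _ (one_sub_skewOp_mem_perp L ψ hx), map_neg])

/-- The anticommutation `ε_L (1 + A) = (1 - A) ε_L` and the intertwining relation give `ε_W ε_L (1 +
A) = 1 - A`; averaging with `1 + A` leaves `1`. The inverse of `g_W` is thus linear in the
coordinate `ψ`. -/
theorem gOp_graph_mul (L : Lagr J) (ψ : SymB L) :
    gOp L (graph L ψ) * (1 + skewOp L ψ.1) = 1 := by
  have h1 : L.eps * (1 + skewOp L ψ.1) = (1 - skewOp L ψ.1) * L.eps := by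
    rw [mul_add, eps_mul_skewOp, sub_mul, mul_one, one_mul, sub_eq_add_neg]
  have h2 : (graph L ψ).eps * L.eps * (1 + skewOp L ψ.1) = 1 - skewOp L ψ.1 := by
    rw [mul_assoc, h1, ← mul_assoc, eps_graph_mul, mul_assoc, L.eps_mul_eps, mul_one]
  rw [gOp, smul_mul_assoc, add_mul, h2, one_mul]
  have : (1 + skewOp L ψ.1) + (1 - skewOp L ψ.1) = (2 : ℝ) • (1 : H →L[ℝ] H) := by
    rw [two_smul]; abel
  rw [this, smul_smul]; norm_num

variable {L : Lagr J} {ψ : SymB L} {R : H →L[ℝ] H}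

/-- With `A = J ψ P_L + ψ P_L J`, the operator `(1 - A) R⁻¹`, where `R² = 1 - A²`, is the unitary
part of `g_W`, for `W` the graph of `-J|_L ψ`. -/
theorem unitaryPart_graph (hR : ‖R - 1‖ < 1)
    (hsq : R * R = 1 - skewOp L ψ.1 * skewOp L ψ.1) :
    IsUnit (gOp L (graph L ψ)) ∧
      IsUnitaryPart (gOp L (graph L ψ)) ((1 - skewOp L ψ.1) * Ring.inverse R) ∧
      (1 - skewOp L ψ.1) * Ring.inverse R ∈ UJ J ∧
      L.carrier.map (((1 - skewOp L ψ.1) * Ring.inverse R : H →L[ℝ] H) : H →ₗ[ℝ] H) =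
        (graph L ψ).carrier := by
  have hg := gOp_graph_mul L ψ
  have hstA := star_skewOp L ψ
  have hJA := J_mul_skewOp L ψ.1
  have hεA := eps_mul_skewOp L ψ.1
  have hW := fun x hx => one_sub_skewOp_mem_graph L ψ (x := x) hx
  have hWl := one_sub_skewOp_apply L ψ.1
  -- From here only the recorded relations of `A` with the adjoint, `J`, `ε_L`, `g_W` and the graph
  -- are used.
  generalize skewOp L ψ.1 = A at *
  have hRu := isUnit_of_norm_sub_one hR
  have hsR : star R = R := star_eq_of_sq hR (by
    rw [hsq, star_sub, star_one, star_mul, hstA, neg_mul_neg])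
  -- `A²` commutes with `J` because `A` does, and with `ε_L` because `A` anticommutes with it; both
  -- relations pass to the root `R`.
  have hJR : J.op * R = R * J.op := unitary_mul_comm_of_sq op_mem_unitary hR (by
    rw [hsq, mul_sub, sub_mul, ← mul_assoc, hJA, mul_assoc, hJA]; noncomm_ring)
  have hεR : L.eps * R = R * L.eps := unitary_mul_comm_of_sq L.eps_mem_unitary hR (by
    rw [hsq, mul_sub, sub_mul, ← mul_assoc, hεA, neg_mul, mul_assoc, hεA]; noncomm_ring)
  have hpos := isPositive_inverse hsR hR
  have hRQ := Ring.mul_inverse_cancel _ hRu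
  have hQR := Ring.inverse_mul_cancel _ hRu
  generalize Ring.inverse R = Q at *
  have hcomm : ∀ c : H →L[ℝ] H, c * R = R * c → c * Q = Q * c := fun c hc => by
    calc c * Q = Q * R * c * Q := by rw [hQR, one_mul]
      _ = Q * (R * c) * Q := by rw [mul_assoc Q R]
      _ = Q * c * (R * Q) := by rw [← hc]; simp only [mul_assoc]
      _ = Q * c := by rw [hRQ, mul_one]
  have hsQ : star Q = Q := hpos.isSelfAdjoint
  have hQQ : Q * Q * (R * R) = 1 := by
    rw [mul_assoc, ← mul_assoc Q R, hQR, one_mul, hQR]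
  have hRR : R * R * (Q * Q) = 1 := by
    rw [mul_assoc, ← mul_assoc R Q, hRQ, one_mul, hRQ]
  have hm : (1 - A) * (1 + A) = R * R := by rw [hsq]; noncomm_ring
  have hp : (1 + A) * (1 - A) = R * R := by rw [hsq]; noncomm_ring
  -- `1 + A` commutes with `R² = (1 + A)(1 - A) = (1 - A)(1 + A)`, hence with the inverse `Q²` of
  -- `R²`.
  have hc : (1 + A) * (Q * Q) = Q * Q * (1 + A) := by
    calc (1 + A) * (Q * Q) = Q * Q * (R * R) * ((1 + A) * (Q * Q)) := by rw [hQQ, one_mul]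
      _ = Q * Q * (1 + A) * ((1 - A) * (1 + A) * (Q * Q)) := by
        rw [← hp]; simp only [mul_assoc]
      _ = Q * Q * (1 + A) := by rw [hm, hRR, mul_one]
  have hsu : star ((1 - A) * Q) = Q * (1 + A) := by
    rw [star_mul, hsQ, star_sub, star_one, hstA, sub_neg_eq_add]
  -- This is `(1 + A)⁻¹ = (1 - A) R⁻²`, already in the form of a polar decomposition with unitary
  -- factor `(1 - A) Q` and positive factor `Q`.
  have hgu : gOp L (graph L ψ) = (1 - A) * Q * Q := by
    calc gOp L (graph L ψ) = gOp L (graph L ψ) * ((1 + A) * (1 - A) * (Q * Q)) := by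
          rw [hp, hRR, mul_one]
      _ = gOp L (graph L ψ) * (1 + A) * ((1 - A) * Q * Q) := by simp only [mul_assoc]
      _ = _ := by rw [hg, one_mul]
  have hunit : (1 - A) * Q ∈ unitary (H →L[ℝ] H) := by
    refine Unitary.mem_iff.2 ⟨?_, ?_⟩
    · rw [hsu]
      calc Q * (1 + A) * ((1 - A) * Q) = Q * ((1 + A) * (1 - A)) * Q := by
            simp only [mul_assoc]
        _ = (Q * R) * (R * Q) := by rw [hp]; simp only [mul_assoc]
        _ = 1 := by rw [hQR, hRQ, one_mul]
    · rw [hsu]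
      calc (1 - A) * Q * (Q * (1 + A)) = (1 - A) * (Q * Q * (1 + A)) := by
            simp only [mul_assoc]
        _ = R * R * (Q * Q) := by rw [← hc, ← mul_assoc, hm]
        _ = 1 := hRR
  refine ⟨⟨⟨_, 1 + A, hg, ?_⟩, rfl⟩, ⟨hunit, Q, hpos, ?_, hgu⟩, ⟨hunit, ?_⟩, ?_⟩
  · rw [hgu, mul_assoc, ← mul_assoc, hp, hRR]
  · have h1 := (Unitary.mem_iff.1 hunit).1
    rw [hgu, star_mul _ Q, mul_assoc (star Q), ← mul_assoc (star _) _ Q, h1, one_mul, hsQ]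
  · rw [mul_assoc, ← hcomm _ hJR, ← mul_assoc, ← mul_assoc, sub_mul, mul_sub, hJA, one_mul,
      mul_one]
  -- An operator commuting with `ε_L` preserves its eigenspace `L`. Thus `Q` and `R` preserve `L`,
  -- and `(1 - A) Q` has the same image of `L` as `1 - A`.
  · have hmem : ∀ c : H →L[ℝ] H, L.eps * c = c * L.eps → ∀ x ∈ L.carrier, c x ∈ L.carrier :=
      fun c hc x hx => L.mem_of_eps (by
        change (L.eps * c) x = c x
        rw [hc]
        exact congrArg c (L.eps_of_mem hx))
    ext x
    constructor
    · rintro ⟨l, hl, rfl⟩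
      exact hW _ (hmem Q (hcomm _ hεR) l hl)
    · intro hx
      obtain ⟨l, rfl⟩ := (mem_graph L ψ x).1 hx
      refine ⟨R l, hmem R hεR l l.2, ?_⟩
      change ((1 - A) * Q * R) (l : H) = _
      rw [mul_assoc, hQR, mul_one, hWl]

/-- An operator in `U(H_J)` is symplectic. -/
theorem exists_sp_of_mem_UJ {u : H →L[ℝ] H} (hu : u ∈ UJ J) : ∃ k : Sp J, k.toOp = u := by
  obtain ⟨h, hJ⟩ := hu
  obtain ⟨h1, h2⟩ := Unitary.mem_iff.1 h
  refine ⟨⟨⟨u, star u, h2, h1⟩, ?_⟩, rfl⟩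
  change star u * J.op * u = J.op
  rw [mul_assoc, ← hJ, ← mul_assoc, h1, one_mul]

/-- The symplectic group acts transitively on `Λ(H)`. -/
theorem exists_smul_eq (L M : Lagr J) : ∃ g : Sp J, g • L = M := by
  obtain ⟨e⟩ := nonempty_equiv L M
  let a : L.carrier →L[ℝ] M.carrier := e
  let b : M.carrier →L[ℝ] L.carrier := e.symm
  have hab : ∀ x, a (b x) = x := e.apply_symm_apply
  have hba : ∀ x, b (a x) = x := e.symm_apply_apply
  have hab' : ∀ x, b.adjoint (a.adjoint x) = x := fun x => by
    refine ext_inner_left ℝ fun y => ?_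
    rw [ContinuousLinearMap.adjoint_inner_right, ContinuousLinearMap.adjoint_inner_right, hab]
  have hba' : ∀ x, a.adjoint (b.adjoint x) = x := fun x => by
    refine ext_inner_left ℝ fun y => ?_
    rw [ContinuousLinearMap.adjoint_inner_right, ContinuousLinearMap.adjoint_inner_right, hba]
  -- `f` is `a` on `L` and sends `J l` to `J b* l`. The inverse adjoint `b* = (a*)⁻¹` on the second
  -- half is what symplecticity forces; `k` is built in the same way from the inverse isomorphism.
  let f : H →L[ℝ] H := M.incl ∘L a ∘L L.proj - J.op ∘L M.incl ∘L b.adjoint ∘L L.proj ∘L J.op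
  let k : H →L[ℝ] H := L.incl ∘L b ∘L M.proj - J.op ∘L L.incl ∘L a.adjoint ∘L M.proj ∘L J.op
  have f1 : ∀ l : L.carrier, f l = a l := fun l => by
    change (a (L.proj l) : H) - J.op (b.adjoint (L.proj (J.op l))) = a l
    rw [L.proj_J, L.proj_incl]; simp
  have f2 : ∀ l : L.carrier, f (J.op l) = J.op (b.adjoint l) := fun l => by
    change (a (L.proj (J.op l)) : H) - J.op (b.adjoint (L.proj (J.op (J.op l)))) = _
    rw [L.proj_J, J_J, map_neg, L.proj_incl]; simp
  have k1 : ∀ l : M.carrier, k l = b l := fun l => by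
    change (b (M.proj l) : H) - J.op (a.adjoint (M.proj (J.op l))) = b l
    rw [M.proj_J, M.proj_incl]; simp
  have k2 : ∀ l : M.carrier, k (J.op l) = J.op (a.adjoint l) := fun l => by
    change (b (M.proj (J.op l)) : H) - J.op (a.adjoint (M.proj (J.op (J.op l)))) = _
    rw [M.proj_J, J_J, map_neg, M.proj_incl]; simp
  have hperp : ∀ (N : Lagr J) (x : H), x ∈ N.carrierᗮ → ∃ l : N.carrier, J.op l = x :=
    fun N x hx => by
      rw [← N.map_eq] at hx
      obtain ⟨l, hl, h⟩ := hx
      exact ⟨⟨l, hl⟩, h⟩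
  have hfk : f * k = 1 := M.ext_op (fun x hx => by
    lift x to M.carrier using hx
    change f (k x) = x
    rw [k1, f1, hab]) (fun x hx => by
    obtain ⟨l, rfl⟩ := hperp M x hx
    change f (k (J.op l)) = J.op l
    rw [k2, f2, hab'])
  have hkf : k * f = 1 := L.ext_op (fun x hx => by
    lift x to L.carrier using hx
    change k (f x) = x
    rw [f1, k1, hba]) (fun x hx => by
    obtain ⟨l, rfl⟩ := hperp L x hx
    change k (f (J.op l)) = J.op l
    rw [f2, k2, hba'])
  -- With `k = f⁻¹`, this is the symplectic condition `f* J f = J`.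
  have hsf : star f * J.op = J.op * k := by
    have e : star f = L.incl ∘L a.adjoint ∘L M.proj - J.op ∘L L.incl ∘L b ∘L M.proj ∘L J.op := by
      change f.adjoint = _
      simp only [f, map_sub, ContinuousLinearMap.adjoint_comp, L.adjoint_proj, M.adjoint_incl,
        adjoint_J, ContinuousLinearMap.adjoint_adjoint]
      ext1 x
      simp
    rw [e]
    ext1 x
    change (a.adjoint (M.proj (J.op x)) : H) - J.op (b (M.proj (J.op (J.op x)))) =
      J.op ((b (M.proj x) : H) - J.op (a.adjoint (M.proj (J.op x))))
    rw [J_J, map_sub, J_J]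
    simp [add_comm]
  refine ⟨⟨⟨f, k, hfk, hkf⟩, ?_⟩, ?_⟩
  · change star f * J.op * f = J.op
    rw [hsf, mul_assoc, hkf, mul_one]
  · ext x
    constructor
    · rintro ⟨l, hl, rfl⟩
      change f l ∈ M.carrier
      lift l to L.carrier using hl
      rw [f1]; exact (a l).2
    · intro hx
      lift x to M.carrier using hx
      refine ⟨b x, (b x).2, ?_⟩
      change f (b x) = x
      rw [f1, hab]

end Symmetry

/-! ### The unitary cross sections and their translates -/

section Sections

variable {H : Type*} [NormedAddCommGroup H] [InnerProductSpace ℝ H] [CompleteSpace H]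
  {J : ComplexStructure H}

theorem contDiff_skewOp (L : Lagr J) : ContDiff ℝ ∞ (skewOp L) :=
  (contDiff_const.mul (contDiff_extOp L)).add ((contDiff_extOp L).mul contDiff_const)

/-- A smooth choice of `(1 - A²)^(1/2)`, for `A = J ψ P_L + ψ P_L J` and `ψ` near `0`. -/
theorem exists_sqrt_skewOp (L : Lagr J) :
    ∃ (R : (L.carrier →L[ℝ] L.carrier) → (H →L[ℝ] H)) (D : Set (L.carrier →L[ℝ] L.carrier)),
      IsOpen D ∧ 0 ∈ D ∧ ContDiffOn ℝ ∞ R D ∧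
        ∀ χ ∈ D, ‖R χ - 1‖ < 1 ∧ R χ * R χ = 1 - skewOp L χ * skewOp L χ := by
  obtain ⟨s, U, hUo, hU1, hs, hsU⟩ := exists_contDiffOn_sqrt (H →L[ℝ] H)
  have hX : ContDiff ℝ ∞ (fun χ => 1 - skewOp L χ * skewOp L χ) :=
    contDiff_const.sub ((contDiff_skewOp L).mul (contDiff_skewOp L))
  refine ⟨fun χ => s (1 - skewOp L χ * skewOp L χ), {χ | 1 - skewOp L χ * skewOp L χ ∈ U},
    hUo.preimage hX.continuous, ?_, hs.comp hX.contDiffOn fun χ hχ => hχ,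
    fun χ hχ => ⟨(hsU _ hχ).2, (hsU _ hχ).1⟩⟩
  have h0 : skewOp L 0 = 0 := by simp [skewOp, extOp]
  change 1 - skewOp L 0 * skewOp L 0 ∈ U
  rwa [h0, mul_zero, sub_zero]

/-- The local cross section of `π_{L₀} : Sp(H) → Λ(H)` given by the unitary part of `g_L`. -/
theorem exists_section (L₀ : Lagr J) : ∃ (σ : Lagr J → Sp J) (V : Set (Lagr J)),
    IsOpen V ∧ L₀ ∈ V ∧ ContMDiffOn 𝓘(ℝ, SymB L₀) 𝓘(ℝ, sp J) ∞ σ V ∧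
      ∀ L ∈ V, IsUnit (gOp L₀ L) ∧ IsUnitaryPart (gOp L₀ L) (σ L).toOp ∧
        (σ L).toOp ∈ UJ J ∧ orbitMap L₀ (σ L) = L := by
  obtain ⟨R, D, hDo, hD0, hR, hRD⟩ := exists_sqrt_skewOp L₀
  let u : (L₀.carrier →L[ℝ] L₀.carrier) → (H →L[ℝ] H) := fun χ =>
    (1 - skewOp L₀ χ) * Ring.inverse (R χ)
  let D' : Set (SymB L₀) := {ψ | ψ.1 ∈ D}
  have hD' : IsOpen D' := hDo.preimage continuous_subtype_val
  let V : Set (Lagr J) := Omega L₀ ∩ phiSym L₀ ⁻¹' D'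
  have hV : IsOpen V := (phiChart L₀).isOpen_inter_preimage hD'
  have key : ∀ W ∈ V, IsUnit (gOp L₀ W) ∧ IsUnitaryPart (gOp L₀ W) (u (phi L₀ W)) ∧
      u (phi L₀ W) ∈ UJ J ∧
      -- Every `W ∈ V` is the graph attached to its own coordinate `φ_{L₀}(W)`, so
      -- `unitaryPart_graph` applies to it.
      L₀.carrier.map (u (phi L₀ W) : H →ₗ[ℝ] H) = W.carrier := fun W hW => by
    obtain ⟨h1, h2⟩ := hRD _ hW.2
    have h := unitaryPart_graph (ψ := phiSym L₀ W) h1 h2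
    rwa [graph_phiSym hW.1] at h
  have hex : ∀ W, ∃ k : Sp J, W ∈ V → k.toOp = u (phi L₀ W) := fun W => by
    by_cases hW : W ∈ V
    · obtain ⟨k, hk⟩ := exists_sp_of_mem_UJ (key W hW).2.2.1
      exact ⟨k, fun _ => hk⟩
    -- The value outside `V` is arbitrary.
    · exact ⟨1, fun h => absurd h hW⟩
  choose σ hσ using hex
  refine ⟨σ, V, hV, ⟨mem_Omega_self L₀, ?_⟩, fun W hW => ?_, fun W hW => ?_⟩
  · change phi L₀ L₀ ∈ D
    rwa [phi_self]
  · refine (contMDiffAt_sp ?_).contMDiffWithinAt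
    have hu : ContDiffOn ℝ ∞ (fun ψ : SymB L₀ => u ψ.1) D' :=
      ((contDiff_const.sub (contDiff_skewOp L₀)).contDiffOn.mul (contDiffAt_inverse_comp hR
        fun χ hχ => isUnit_of_norm_sub_one (hRD χ hχ).1)).comp contDiff_symOp_coe.contDiffOn
        fun ψ hψ => hψ
    refine ((hu.contDiffAt (hD'.mem_nhds hW.2)).contMDiffAt.comp W
      ((contMDiffOn_phiSym L₀).contMDiffAt ((isOpen_Omega L₀).mem_nhds hW.1)))
      |>.congr_of_eventuallyEq ?_
    filter_upwards [hV.mem_nhds hW] with W' hW'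
    exact hσ W' hW'
  · obtain ⟨h1, h2, h3, h4⟩ := key W hW
    rw [← hσ W hW] at h2 h3 h4
    exact ⟨h1, h2, h3, Lagr.ext h4⟩

/-- The operator `ψ P_L` for a Hilbert–Schmidt operator `ψ`. -/
def extHS (L : Lagr J) : HS L.carrier L.carrier →L[ℝ] HS H H :=
  (HS.compR H L.carrier H).flip L.proj ∘L HS.compL L.carrier L.carrier H L.incl

/-- The operator `J ψ P_L + ψ P_L J` for a Hilbert–Schmidt operator `ψ`. -/
def skewHS (L : Lagr J) : HS L.carrier L.carrier →L[ℝ] HS H H :=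
  HS.compL H H H J.op ∘L extHS L + (HS.compR H H H).flip J.op ∘L extHS L

/-- The operator `(1 - A) R⁻¹ - 1 = (A² (R + 1)⁻¹ - A) R⁻¹`, where `A = J ψ P_L + ψ P_L J` and
`R = (1 - A²)^(1/2)`, as a Hilbert–Schmidt operator. -/
def unitaryHS (L : Lagr J) (R : (L.carrier →L[ℝ] L.carrier) → (H →L[ℝ] H))
    (χ : HS L.carrier L.carrier) : HS H H :=
  HS.compR H H H
    (HS.compR H H H (HS.compL H H H (skewOp L (HS.toOp χ)) (skewHS L χ))
      (Ring.inverse (R (HS.toOp χ) + 1)) - skewHS L χ) (Ring.inverse (R (HS.toOp χ)))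

/-- From `A² = 1 - R² = -(R - 1)(R + 1)` one gets `A² (R + 1)⁻¹ = 1 - R`, so the expression is `(1 -
R - A) R⁻¹`. This form avoids having to treat `R` as a root inside the Hilbert–Schmidt operators. -/
theorem toOp_unitaryHS {L : Lagr J} {R : (L.carrier →L[ℝ] L.carrier) → (H →L[ℝ] H)}
    {χ : HS L.carrier L.carrier} (h1 : ‖R (HS.toOp χ) - 1‖ < 1)
    (h2 : R (HS.toOp χ) * R (HS.toOp χ) =
      1 - skewOp L (HS.toOp χ) * skewOp L (HS.toOp χ)) :
    HS.toOp (unitaryHS L R χ) =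
      (1 - skewOp L (HS.toOp χ)) * Ring.inverse (R (HS.toOp χ)) - 1 := by
  change (skewOp L (HS.toOp χ) * skewOp L (HS.toOp χ) *
    Ring.inverse (R (HS.toOp χ) + 1) - skewOp L (HS.toOp χ)) * Ring.inverse (R (HS.toOp χ)) = _
  generalize skewOp L (HS.toOp χ) = A at *
  generalize R (HS.toOp χ) = r at *
  have hr := Ring.mul_inverse_cancel _ (isUnit_of_norm_sub_one h1)
  have hr1 := Ring.mul_inverse_cancel _ (isUnit_add_one_of_norm_sub_one h1)
  have e : A * A = -((r - 1) * (r + 1)) := by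
    have : (r - 1) * (r + 1) = r * r - 1 := by noncomm_ring
    rw [this, h2]; abel
  rw [e, neg_mul, mul_assoc (r - 1), hr1, mul_one, sub_mul, neg_mul, sub_mul, hr]
  noncomm_ring

/-- In each term one factor `A` is a bounded linear function of `χ` with values in `B₂(H)`. The
remaining factors need only be smooth in operator norm, as multiplication `B(H) × B₂(H) → B₂(H)` is
bounded. -/
theorem contDiffOn_unitaryHS {L : Lagr J} {R : (L.carrier →L[ℝ] L.carrier) → (H →L[ℝ] H)}
    {D : Set (L.carrier →L[ℝ] L.carrier)} (hR : ContDiffOn ℝ ∞ R D)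
    (h : ∀ χ ∈ D, ‖R χ - 1‖ < 1) :
    ContDiffOn ℝ ∞ (unitaryHS L R) {χ | HS.toOp χ ∈ D} := by
  have hR' : ContDiffOn ℝ ∞ (fun χ : HS L.carrier L.carrier => R (HS.toOp χ))
      {χ | HS.toOp χ ∈ D} := hR.comp contDiff_inclL.contDiffOn fun χ hχ => hχ
  have hs : ContDiff ℝ ∞ (skewHS L) := (skewHS L).contDiff
  have hs' : ContDiff ℝ ∞ (fun χ : HS L.carrier L.carrier => skewOp L (HS.toOp χ)) :=
    (contDiff_skewOp L).comp contDiff_inclL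
  have hc : ContDiff ℝ ∞ (fun χ : HS L.carrier L.carrier =>
      HS.compL H H H (skewOp L (HS.toOp χ))) := (HS.compL H H H).contDiff.comp hs'
  have h1 : ContDiffOn ℝ ∞ (fun χ : HS L.carrier L.carrier => Ring.inverse (R (HS.toOp χ) + 1))
      {χ | HS.toOp χ ∈ D} := contDiffAt_inverse_comp (hR'.add contDiffOn_const)
    fun χ hχ => isUnit_add_one_of_norm_sub_one (h _ hχ)
  have h2 : ContDiffOn ℝ ∞ (fun χ : HS L.carrier L.carrier => Ring.inverse (R (HS.toOp χ)))
      {χ | HS.toOp χ ∈ D} := contDiffAt_inverse_comp hR'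
    fun χ hχ => isUnit_of_norm_sub_one (h _ hχ)
  have h3 := HS.contDiffOn_compR (hc.clm_apply hs).contDiffOn h1
  exact HS.contDiffOn_compR (h3.sub hs.contDiffOn) h2

/-- The local cross section of `π_{L₀} : Sp₂(H) → O_{L₀}` given by the unitary part of `g_L`. -/
theorem exists_section2 (L₀ : Lagr J) : ∃ (σ : Orbit L₀ → Sp2 J) (V : Set (Orbit L₀)),
    IsOpen V ∧ Orbit.base L₀ ∈ V ∧ ContMDiffOn 𝓘(ℝ, SymHS L₀) 𝓘(ℝ, sp2 J) ∞ σ V ∧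
      ∀ L ∈ V, IsUnit (gOp L₀ L.toLagr) ∧
        IsUnitaryPart (gOp L₀ L.toLagr) (σ L).toSp.toOp ∧
        (σ L).toSp.toOp ∈ U2J J ∧ orbitMap2 (Orbit.base L₀) (σ L) = L := by
  obtain ⟨R, D, hDo, hD0, hR, hRD⟩ := exists_sqrt_skewOp L₀
  let u : (L₀.carrier →L[ℝ] L₀.carrier) → (H →L[ℝ] H) := fun χ =>
    (1 - skewOp L₀ χ) * Ring.inverse (R χ)
  let B : Orbit L₀ := Orbit.base L₀
  let D' : Set (SymHS L₀) := {ψ | HS.toOp (ψ : HS _ _) ∈ D}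
  have hD' : IsOpen D' := hDo.preimage contDiff_symHSIncl.continuous
  let V : Set (Orbit L₀) := Omega2 B ∩ phiSymHS B ⁻¹' D'
  have hV : IsOpen V := (phiChart2 B).isOpen_inter_preimage hD'
  have key : ∀ W ∈ V, IsUnit (gOp L₀ W.toLagr) ∧
      IsUnitaryPart (gOp L₀ W.toLagr) (u (phi L₀ W.toLagr)) ∧
      u (phi L₀ W.toLagr) ∈ UJ J ∧
      L₀.carrier.map (u (phi L₀ W.toLagr) : H →ₗ[ℝ] H) = W.toLagr.carrier := fun W hW => by
    obtain ⟨h1, h2⟩ := hRD _ hW.2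
    have h := unitaryPart_graph (ψ := phiSym L₀ W.toLagr) h1 h2
    have e : graph L₀ (phiSym L₀ W.toLagr) = W.toLagr := graph_phiSym hW.1
    rwa [e] at h
  have hex : ∀ W, ∃ k : Sp2 J, W ∈ V → k.toSp.toOp = u (phi L₀ W.toLagr) := fun W => by
    by_cases hW : W ∈ V
    · obtain ⟨k, hk⟩ := exists_sp_of_mem_UJ (key W hW).2.2.1
      -- The coordinate of `W` is Hilbert–Schmidt, so the formula for `u - 1` puts the unitary part
      -- in `Sp₂(H)`.
      have hm : k.toOp - 1 ∈ hsSubmodule H H := by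
        rw [hk]
        have h := hRD _ hW.2
        have e : HS.toOp (unitaryHS L₀ R (phiSymHS B W).1) = u (phi L₀ W.toLagr) - 1 :=
          toOp_unitaryHS h.1 h.2
        rw [← e]
        exact HS.toOp_mem _
      exact ⟨⟨k, hm⟩, fun _ => hk⟩
    · exact ⟨1, fun h => absurd h hW⟩
  choose σ hσ using hex
  refine ⟨σ, V, hV, ⟨mem_Omega2_self B, ?_⟩, fun W hW => ?_, fun W hW => ?_⟩
  · change phi L₀ L₀ ∈ D
    rwa [phi_self]
  · refine (contMDiffAt_sp2 ?_).contMDiffWithinAt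
    have hvs : ContDiffOn ℝ ∞ (fun ψ : SymHS L₀ => unitaryHS L₀ R ψ.1) D' :=
      (contDiffOn_unitaryHS hR fun χ hχ => (hRD χ hχ).1).comp contDiff_symHS_coe.contDiffOn
        fun ψ hψ => hψ
    refine ((hvs.contDiffAt (hD'.mem_nhds hW.2)).contMDiffAt.comp W
      ((contMDiffOn_phiSymHS B).contMDiffAt ((isOpen_Omega2 B).mem_nhds hW.1)))
      |>.congr_of_eventuallyEq ?_
    filter_upwards [hV.mem_nhds hW] with W' hW'
    apply HS.ext
    rw [Sp2.toOp_toHS, hσ W' hW']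
    have h := hRD _ hW'.2
    exact (toOp_unitaryHS (χ := (phiSymHS B W').1) h.1 h.2).symm
  · obtain ⟨h1, h2, h3, h4⟩ := key W hW
    rw [← hσ W hW] at h2 h3 h4
    exact ⟨h1, h2, ⟨h3, (σ W).toHS.toOp_mem⟩, Orbit.toLagr_injective (Lagr.ext h4)⟩

/-- A smooth local section of `π_{L₀}` over `V` translates to one of `π_{g(L₀)}` over `g(V)`. -/
theorem translate_section {L₀ : Lagr J} {σ : Lagr J → Sp J} {V : Set (Lagr J)} (hV : IsOpen V)
    (hσ : ContMDiffOn 𝓘(ℝ, SymB L₀) 𝓘(ℝ, sp J) ∞ σ V)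
    (h : ∀ L ∈ V, orbitMap L₀ (σ L) = L) (g : Sp J) :
    IsOpen {W : Lagr J | g⁻¹ • W ∈ V} ∧
      ContMDiffOn 𝓘(ℝ, SymB L₀) 𝓘(ℝ, sp J) ∞
        (fun W : Lagr J => g * σ (g⁻¹ • W) * g⁻¹) {W : Lagr J | g⁻¹ • W ∈ V} ∧
      ∀ W : Lagr J, g⁻¹ • W ∈ V → orbitMap (g • L₀) (g * σ (g⁻¹ • W) * g⁻¹) = W := by
  -- The set `{W | g⁻¹(W) ∈ V}` is `g(V)`, written as the preimage of `V` under the smooth action of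
  -- `g⁻¹`.
  refine ⟨hV.preimage (contMDiff_smul (L₀ := L₀) g⁻¹).continuous, fun W hW => ?_,
    fun W hW => ?_⟩
  · refine (contMDiffAt_sp ?_).contMDiffWithinAt
    have h1 : ContDiff ℝ ∞ (fun y : H →L[ℝ] H => g.toOp * y * g⁻¹.toOp) := by fun_prop
    exact (h1.contMDiff.contMDiffAt.comp _ contMDiff_toOp.contMDiffAt).comp W
      ((hσ.contMDiffAt (hV.mem_nhds hW)).comp W (contMDiff_smul (L₀ := L₀) g⁻¹).contMDiffAt)
  · have := h _ hW
    change σ (g⁻¹ • W) • L₀ = g⁻¹ • W at this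
    change (g * σ (g⁻¹ • W) * g⁻¹) • g • L₀ = W
    rw [mul_smul, inv_smul_smul, mul_smul, this, smul_inv_smul]

/-- A smooth local section of the restricted orbit map `π_{L₀}` over `V` translates to one of
`π_{g(L₀)}` over `g(V)`. -/
theorem translate_section2 {L₀ : Lagr J} {M : Orbit L₀} {σ : Orbit L₀ → Sp2 J}
    {V : Set (Orbit L₀)} (hV : IsOpen V)
    (hσ : ContMDiffOn 𝓘(ℝ, SymHS L₀) 𝓘(ℝ, sp2 J) ∞ σ V)
    (h : ∀ L ∈ V, orbitMap2 M (σ L) = L) (g : Sp2 J) :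
    IsOpen {W : Orbit L₀ | g⁻¹ • W ∈ V} ∧
      ContMDiffOn 𝓘(ℝ, SymHS L₀) 𝓘(ℝ, sp2 J) ∞
        (fun W : Orbit L₀ => g * σ (g⁻¹ • W) * g⁻¹) {W : Orbit L₀ | g⁻¹ • W ∈ V} ∧
      ∀ W : Orbit L₀, g⁻¹ • W ∈ V → orbitMap2 (g • M) (g * σ (g⁻¹ • W) * g⁻¹) = W := by
  refine ⟨hV.preimage (contMDiff_smul2 g⁻¹).continuous, fun W hW => ?_, fun W hW => ?_⟩
  · refine (contMDiffAt_sp2 ?_).contMDiffWithinAt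
    -- Conjugation by `g` is affine on the differences from `1`, hence smooth in the 2-norm.
    simp only [Sp2.toHS_mul_mul]
    exact ((contDiff_toHS_mul_mul g g⁻¹).contMDiff.contMDiffAt.comp _
      contMDiff_toHS.contMDiffAt).comp W
      ((hσ.contMDiffAt (hV.mem_nhds hW)).comp W (contMDiff_smul2 g⁻¹).contMDiffAt)
  · have := h _ hW
    change σ (g⁻¹ • W) • M = g⁻¹ • W at this
    change (g * σ (g⁻¹ • W) * g⁻¹) • g • M = W
    rw [mul_smul, inv_smul_smul, mul_smul, this, smul_inv_smul]

end Sections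

end SympLagr

end

/-! ### The theorem, assembled from the submersions, the sections and their translates -/

theorem mainTheorem3 {H : Type*} [NormedAddCommGroup H] [InnerProductSpace ℝ H] [CompleteSpace H]
    (_hH : ¬ FiniteDimensional ℝ H) (J : ComplexStructure H) (L₀ : Lagr J) :
    -- the two orbit maps are smooth submersions
    IsSmoothSubmersion (E := sp J) (F := SymB L₀) (orbitMap L₀) ∧
    IsSmoothSubmersion (E := sp2 J) (F := SymHS L₀) (orbitMap2 (Orbit.base L₀)) ∧
    -- the local cross section of the full orbit map, and its translates
    (∃ (σ : Lagr J → Sp J) (V : Set (Lagr J)), IsOpen V ∧ L₀ ∈ V ∧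
      ContMDiffOn 𝓘(ℝ, SymB L₀) 𝓘(ℝ, sp J) ∞ σ V ∧
      (∀ L ∈ V, IsUnit (gOp L₀ L) ∧ IsUnitaryPart (gOp L₀ L) (σ L).toOp ∧
        (σ L).toOp ∈ UJ J ∧ orbitMap L₀ (σ L) = L) ∧
      ∀ L : Lagr J, (∃ g : Sp J, g • L₀ = L) ∧ ∀ g : Sp J, g • L₀ = L →
        IsOpen {W : Lagr J | g⁻¹ • W ∈ V} ∧ g⁻¹ • L ∈ V ∧
        ContMDiffOn 𝓘(ℝ, SymB L₀) 𝓘(ℝ, sp J) ∞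
          (fun W : Lagr J => g * σ (g⁻¹ • W) * g⁻¹) {W : Lagr J | g⁻¹ • W ∈ V} ∧
        ∀ W : Lagr J, g⁻¹ • W ∈ V → orbitMap L (g * σ (g⁻¹ • W) * g⁻¹) = W) ∧
    -- the local cross section of the restricted orbit map, and its translates
    (∃ (σ : Orbit L₀ → Sp2 J) (V : Set (Orbit L₀)), IsOpen V ∧ Orbit.base L₀ ∈ V ∧
      ContMDiffOn 𝓘(ℝ, SymHS L₀) 𝓘(ℝ, sp2 J) ∞ σ V ∧
      (∀ L ∈ V, IsUnit (gOp L₀ L.toLagr) ∧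
        IsUnitaryPart (gOp L₀ L.toLagr) (σ L).toSp.toOp ∧
        (σ L).toSp.toOp ∈ U2J J ∧ orbitMap2 (Orbit.base L₀) (σ L) = L) ∧
      ∀ L : Orbit L₀, (∃ g : Sp2 J, g • Orbit.base L₀ = L) ∧
        ∀ g : Sp2 J, g • Orbit.base L₀ = L →
        IsOpen {W : Orbit L₀ | g⁻¹ • W ∈ V} ∧ g⁻¹ • L ∈ V ∧
        ContMDiffOn 𝓘(ℝ, SymHS L₀) 𝓘(ℝ, sp2 J) ∞
          (fun W : Orbit L₀ => g * σ (g⁻¹ • W) * g⁻¹) {W : Orbit L₀ | g⁻¹ • W ∈ V} ∧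
        ∀ W : Orbit L₀, g⁻¹ • W ∈ V → orbitMap2 L (g * σ (g⁻¹ • W) * g⁻¹) = W) := by
  refine ⟨isSmoothSubmersion_orbitMap L₀, isSmoothSubmersion_orbitMap2 (Orbit.base L₀), ?_, ?_⟩
  · obtain ⟨σ, V, hV, hL, hσ, h⟩ := exists_section L₀
    refine ⟨σ, V, hV, hL, hσ, h, fun L => ⟨exists_smul_eq L₀ L, ?_⟩⟩
    rintro g rfl
    obtain ⟨h1, h2, h3⟩ := translate_section hV hσ (fun L hL => (h L hL).2.2.2) g
    exact ⟨h1, by rwa [inv_smul_smul], h2, h3⟩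
  · obtain ⟨σ, V, hV, hL, hσ, h⟩ := exists_section2 L₀
    refine ⟨σ, V, hV, hL, hσ, h, fun L => ⟨?_, ?_⟩⟩
    -- In the restricted case transitivity is the definition of the orbit.
    · obtain ⟨g, hg⟩ := L.exists_smul
      exact ⟨g, Orbit.toLagr_injective hg⟩
    · rintro g rfl
      obtain ⟨h1, h2, h3⟩ := translate_section2 hV hσ (fun L hL => (h L hL).2.2.2) g
      exact ⟨h1, by rwa [inv_smul_smul], h2, h3⟩
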